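/- Let $k$ be a commutative field. All algebras are associative unital $k$-algebras, all homomorphisms are $k$-algebra homomorphisms, and $\otimes=\otimes_k$. For an algebra $A$ let $A^\circ$ be its opposite algebra, and define the homological transcendence degree of $A$ by $\operatorname{htr} A=\operatorname{injdim}(A\otimes A^\circ)\in\{0,1,2,\dots\}\cup\{\infty\}$ (for $A\neq 0$), the injective dimension of $A\otimes A^\circ$ as a left module over itself. Let $D$ be a division algebra over $k$ and let $C\subseteq D$ be a division subalgebra. (a) $\operatorname{htr} C\le \operatorname{htr} D$. (b) If $D$ is finitely generated as a left $C$-module or as a right $C$-module, then $\operatorname{htr} C=\operatorname{htr} D$. (c) Suppose that $C\otimes C^\circ$ is noetherian of finite global dimension. If $\alpha$ is a $k$-algebra automorphism of $C$ and $D$ is the quotient division ring of the skew polynomial ring $C[x;\alpha]$ (where $xc=\alpha(c)x$ for $c\in C$), with $C\subseteq C[x;\alpha]\subseteq D$, then $\operatorname{htr} D=\operatorname{htr} C+1$. (d) If $D$ is a PI ring (i.e. some nonzero element of the free algebra $k\langle x_0,x_1,\dots\rangle$ vanishes under all substitutions of elements of $D$) and its center $Z$ is finitely generated over $k$ as a field,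 then $\operatorname{htr} D=\operatorname{tr} D$, where $\operatorname{tr} D$ is the classical transcendence degree of $D$, that is, the transcendence degree of $Z$ over $k$. (e) $\operatorname{htr} D=\operatorname{htr} D^\circ$. -/

import Mathlib

open CategoryTheory TensorProduct

universe v u

/-- The enveloping algebra `A ⊗ₖ A°` of a `k`-algebra `A`. -/
abbrev EnvAlg (k : Type v) (A : Type u) [Field k] [Ring A] [Algebra k A] : Type u :=
  A ⊗[k] Aᵐᵒᵖ

/-- The homological transcendence degree of `A` over `k`: the injective dimension of the enveloping
algebra `A ⊗ₖ A°` as a left module over itself. -/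
noncomputable def htr (k : Type v) (A : Type u) [Field k] [Ring A] [Algebra k A] : WithBot ℕ∞ :=
  injectiveDimension (ModuleCat.of (EnvAlg k A) (EnvAlg k A))

/-- The (left) global dimension of a ring: the supremum of the projective dimensions of its
left modules. -/
noncomputable def globalDim (R : Type u) [Ring R] : WithBot ℕ∞ :=
  ⨆ M : ModuleCat.{u} R, projectiveDimension M

/-- An automorphism `α` of a `k`-algebra `C` makes `ℕ` act on `C` through the powers of `α`; this is
the datum from which `SkewPolynomial C` gets its multiplication `X c = α(c) X`. -/
@[reducible]
def skewAction {k : Type v} {C : Type u} [Field k] [Ring C] [Algebra k C] (α : C ≃ₐ[k] C) :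
    MulSemiringAction (Multiplicative ℕ) C :=
  MulSemiringAction.compHom C (powersHom (C ≃ₐ[k] C) α)

/-- The action of the generator is `α`, so that `X c = α(c) X` in the skew polynomial ring. -/
theorem skewAction_X_mul {k : Type v} {C : Type u} [Field k] [Ring C] [Algebra k C]
    (α : C ≃ₐ[k] C) (c : C) :
    letI := skewAction α
    (SkewPolynomial.X : SkewPolynomial C) * SkewPolynomial.C c =
      SkewPolynomial.C (α c) * SkewPolynomial.X := by
  let _ := skewAction α
  have h : (Multiplicative.ofAdd 1 : Multiplicative ℕ) • c = α c := by
    change (powersHom (C ≃ₐ[k] C) α (Multiplicative.ofAdd 1)) c = α c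
    simp
  rw [← SkewPolynomial.monomial_zero_left, ← SkewPolynomial.monomial_zero_left,
    SkewPolynomial.X_mul_monomial, SkewPolynomial.monomial_mul_X,
    ← h]
  rfl

/-- A homomorphism `f` from a ring `A` to a division ring `D` exhibits `D` as the quotient division
ring of (the Ore domain) `A`: it is injective, and every element of `D` is a fraction
`f(s)⁻¹ f(a)` with `a, s ∈ A` and `s ≠ 0`. -/
def IsQuotientDivisionRing {A : Type*} {D : Type*} [Ring A] [DivisionRing D] (f : A →+* D) : Prop :=
  Function.Injective f ∧ ∀ d : D, ∃ a s : A, s ≠ 0 ∧ d = (f s)⁻¹ * f a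

/-- `D` is the quotient division ring of the skew polynomial ring `C[x; α]`, where `C` is a
subalgebra of `D`: the inclusion of `C` extends to a ring homomorphism `C[x; α] → D` that exhibits
`D` as the quotient division ring of `C[x; α]`. -/
def IsQuotientOfSkewPolynomial {k : Type v} {D : Type u} [Field k] [DivisionRing D] [Algebra k D]
    (C : Subalgebra k D) (α : C ≃ₐ[k] C) : Prop :=
  letI := skewAction α
  ∃ f : SkewPolynomial C →+* D,
    (∀ c : C, f (SkewPolynomial.C c) = (c : D)) ∧ IsQuotientDivisionRing f

/-- `A` is a PI algebra: it satisfies a nonzero polynomial identity, that is, some nonzero element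
of the free algebra `k⟨x₀, x₁, …⟩` vanishes under all substitutions of elements of `A`. -/
def IsPIAlgebra (k : Type v) (A : Type u) [Field k] [Ring A] [Algebra k A] : Prop :=
  ∃ p : FreeAlgebra k ℕ, p ≠ 0 ∧ ∀ a : ℕ → A, FreeAlgebra.lift k a p = 0

/-- The center of a division algebra is a field. -/
noncomputable instance centerField (k : Type v) (D : Type u) [Field k] [DivisionRing D]
    [Algebra k D] : Field (Subalgebra.center k D) where
  __ := (inferInstance : CommRing (Subalgebra.center k D))
  inv x := ⟨(x : D)⁻¹, Set.inv_mem_center x.2⟩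
  exists_pair_ne := ⟨0, 1, zero_ne_one⟩
  mul_inv_cancel x hx := Subtype.ext (mul_inv_cancel₀ fun h => hx (Subtype.ext h))
  inv_zero := Subtype.ext inv_zero
  nnqsmul := _
  nnqsmul_def := fun _ _ => rfl
  qsmul := _
  qsmul_def := fun _ _ => rfl

/-- The classical transcendence degree of a division algebra that is a PI ring (hence finite over
its center): the transcendence degree over `k` of its center. -/
noncomputable def classicalTr (k : Type v) (D : Type u) [Field k] [DivisionRing D] [Algebra k D] :
    Cardinal.{u} :=
  Algebra.trdeg k (Subalgebra.center k D)

/-! Write A^e for A ⊗ A°. One change-of-rings device carries the proof. Let P be an (E, B)-bimodule,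
projective over E and flat over B. Then Hom_E(P, -) is exact and preserves injectives, so it does
not raise injective dimension (`Coind.injDimLT`); by adjunction P ⊗_B - does not raise projective
dimension (`IsTensor.projDimLT`). Over division algebras all modules are free, so tensor products
over k of bimodules are free over the relevant enveloping algebras on either side.

For (a), D^e is right flat over C^e, so restriction does not raise injective dimension, and C^e is a
direct summand of D^e as a left module. For (b), with D of finite left dimension, put P = D ⊗
Hom_C(D, C): then Hom_{C^e}(P, C^e) contains D^e as a direct summand, which gives the other
inequality. The right-handed case reduces to this one by (e), and (e) is the exchange of factors
(D°)^e ≅ D^e.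

For (c), every D^e-module M is (D ⊗ M) ⊗_{D^e} D, so the projective dimension of D as a bimodule
bounds that of all bimodules, hence bounds htr D (`projDimLT_env`). If C^e is noetherian and C has
finite bimodule projective dimension d, then Ext^d(C, C^e) ≠ 0 and htr C = d
(`htr_eq_of_projDimLT`). Let S = C^e * ℤ be the skew Laurent ring whose generator acts by α ⊗ α,
mapped to D^e by sending the generator to x ⊗ x⁻¹. Then D^e is right flat over S and D = D^e ⊗_S C,
so pd D ≤ pd_S C ≤ d + 1, the last step by the resolution 0 → S ⊗ C → S ⊗ C → C → 0 over C^e.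
Conversely, embedding D in skew Laurent series gives coefficient maps that split S off D^e as a left
S-module. If D^e had injective dimension at most d, then Ext^{d+1}_S(C, S) would vanish, and a trace
argument (`Induced.extZero_of_extZero_induced`; `Induced.eq_zero_of_extZero_one` when d = 0) would
give Ext^d(C, C^e) = 0, a contradiction.

For (d), Kaplansky's theorem makes D finite over its center Z, so htr D = htr Z by (b). Z is finite
over some k(s) with s a finite transcendence basis, and the argument of (c) with trivial
automorphism, applied once for each element of s, gives htr k(s) = |s|. The bound on the projective
dimension is carried through this induction along with the value of htr. -/

/-! ### Ext and homological dimensions for unbundled modules -/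

section Homological

open Abelian

variable (R : Type u) [Ring R]
variable (M N : Type u) [AddCommGroup M] [Module R M] [AddCommGroup N] [Module R N]

/-- The injective dimension of the module `N` is less than `n`. -/
abbrev InjDimLT (n : ℕ) : Prop := HasInjectiveDimensionLT (ModuleCat.of R N) n

/-- The projective dimension of the module `M` is less than `n`. -/
abbrev ProjDimLT (n : ℕ) : Prop := HasProjectiveDimensionLT (ModuleCat.of R M) n

/-- The group `Ext^n(M, N)` vanishes. -/
abbrev ExtZero (n : ℕ) : Prop := Subsingleton (Ext (ModuleCat.of R M) (ModuleCat.of R N) n)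

variable {M N}

/-- `f` and `g` form a short exact sequence of modules. -/
structure IsSES {M₁ M₂ M₃ : Type u} [AddCommGroup M₁] [Module R M₁] [AddCommGroup M₂] [Module R M₂]
    [AddCommGroup M₃] [Module R M₃] (f : M₁ →ₗ[R] M₂) (g : M₂ →ₗ[R] M₃) : Prop where
  inj : Function.Injective f
  exact : Function.Exact f g
  surj : Function.Surjective g

variable {R}

section

variable {M₁ M₂ M₃ : Type u} [AddCommGroup M₁] [Module R M₁] [AddCommGroup M₂] [Module R M₂]
    [AddCommGroup M₃] [Module R M₃] {f : M₁ →ₗ[R] M₂} {g : M₂ →ₗ[R] M₃}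

/-- The short complex of a short exact sequence of modules. -/
abbrev IsSES.complex (h : IsSES R f g) : ShortComplex (ModuleCat.{u} R) :=
  ShortComplex.mk (ModuleCat.ofHom f) (ModuleCat.ofHom g)
    (by ext x; exact (h.exact _).2 ⟨x, rfl⟩)

theorem IsSES.shortExact (h : IsSES R f g) : h.complex.ShortExact where
  exact := (ShortComplex.ShortExact.moduleCat_exact_iff_function_exact _).2 h.exact
  mono_f := (ModuleCat.mono_iff_injective _).2 h.inj
  epi_g := (ModuleCat.epi_iff_surjective _).2 h.surj

theorem injDimLT_one_iff : InjDimLT R N 1 ↔ Module.Injective R N :=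
   injective_iff_hasInjectiveDimensionLT_one.symm.trans
    (Module.injective_iff_injective_object R N).symm

theorem projDimLT_one_iff : ProjDimLT R M 1 ↔ Module.Projective R M :=
   projective_iff_hasProjectiveDimensionLT_one.symm.trans
    (IsProjective.iff_projective M).symm

/-- Dimension shift. It starts at `n + 1` because injectivity of `M₁` makes `M₃` injective but not
zero. -/
theorem IsSES.injDimLT_iff (h : IsSES R f g) (hI : Module.Injective R M₂) (n : ℕ) :
    InjDimLT R M₃ (n + 1) ↔ InjDimLT R M₁ (n + 2) :=
  h.shortExact.hasInjectiveDimensionLT_X₃_iff n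
    ((Module.injective_iff_injective_object R M₂).1 hI)

theorem IsSES.projDimLT_iff (h : IsSES R f g) (hP : Module.Projective R M₂) (n : ℕ) :
    ProjDimLT R M₁ (n + 1) ↔ ProjDimLT R M₃ (n + 2) :=
  (h.shortExact.hasProjectiveDimensionLT_X₃_iff n
    ((IsProjective.iff_projective M₂).1 hP)).symm

theorem IsSES.projDimLT_right (h : IsSES R f g) {n : ℕ} (h₁ : ProjDimLT R M₁ n)
    (h₂ : ProjDimLT R M₂ (n + 1)) : ProjDimLT R M₃ (n + 1) :=
  h.shortExact.hasProjectiveDimensionLT_X₃ n h₁ h₂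

end

theorem InjDimLT.mono {n m : ℕ} (h : InjDimLT R N n) (hnm : n ≤ m) : InjDimLT R N m :=
  hasInjectiveDimensionLT_of_ge _ n m hnm

theorem ProjDimLT.mono {n m : ℕ} (h : ProjDimLT R M n) (hnm : n ≤ m) : ProjDimLT R M m :=
  hasProjectiveDimensionLT_of_ge _ n m hnm

theorem InjDimLT.of_retract {N' : Type u} [AddCommGroup N'] [Module R N'] {n : ℕ}
    (h : InjDimLT R N n) (i : N' →ₗ[R] N) (r : N →ₗ[R] N') (hr : ∀ x, r (i x) = x) :
    InjDimLT R N' n := by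
  have : HasInjectiveDimensionLT (ModuleCat.of R N) n := h
  exact (Retract.mk (X := ModuleCat.of R N') (Y := ModuleCat.of R N) (ModuleCat.ofHom i)
    (ModuleCat.ofHom r) (by ext x; exact hr x)).hasInjectiveDimensionLT n

theorem InjDimLT.of_equiv {N' : Type u} [AddCommGroup N'] [Module R N'] {n : ℕ}
    (h : InjDimLT R N n) (e : N ≃ₗ[R] N') : InjDimLT R N' n :=
  h.of_retract e.symm.toLinearMap e.toLinearMap (by simp)

variable (R N) in
/-- Every module has an injective hull sitting in a short exact sequence. -/
theorem exists_injective_ses : ∃ (I Q : Type u) (_ : AddCommGroup I) (_ : Module R I)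
    (_ : AddCommGroup Q) (_ : Module R Q) (f : N →ₗ[R] I) (g : I →ₗ[R] Q),
    Module.Injective R I ∧ IsSES R f g := by
  obtain ⟨⟨J, hJ, j, hj⟩⟩ := EnoughInjectives.presentation (ModuleCat.of R N)
  refine ⟨J, _ ⧸ LinearMap.range j.hom, _, _, _, _, j.hom, (LinearMap.range j.hom).mkQ,
    (Module.injective_iff_injective_object R J).2 hJ, ?_, ?_, ?_⟩
  · exact (ModuleCat.mono_iff_injective _).1 hj
  · exact LinearMap.exact_map_mkQ_range _
  · exact Submodule.mkQ_surjective _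

theorem extZero_of_injDimLT {n : ℕ} (h : InjDimLT R N n) : ExtZero R M N n :=
  HasInjectiveDimensionLT.subsingleton _ n n le_rfl _

theorem extZero_of_projDimLT {n : ℕ} (h : ProjDimLT R M n) : ExtZero R M N n :=
  HasProjectiveDimensionLT.subsingleton _ n n le_rfl _

theorem projDimLT_of_extZero {n : ℕ}
    (h : ∀ (N : Type u) [AddCommGroup N] [Module R N], ExtZero R M N n) : ProjDimLT R M n :=
  hasProjectiveDimensionLT_of_enoughInjectives _ n fun Y => h Y

theorem injDimLT_of_extZero {n : ℕ}
    (h : ∀ (M : Type u) [AddCommGroup M] [Module R M], ExtZero R M N n) : InjDimLT R N n :=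
  hasInjectiveDimensionLT_of_enoughProjectives _ n fun Y => h Y

section

variable {N₁ N₂ N₃ : Type u} [AddCommGroup N₁] [Module R N₁] [AddCommGroup N₂] [Module R N₂]
    [AddCommGroup N₃] [Module R N₃] {f : N₁ →ₗ[R] N₂} {g : N₂ →ₗ[R] N₃}

theorem IsSES.extZero_succ (h : IsSES R f g) {n : ℕ} (h₂ : ExtZero R M N₂ (n + 1))
    (h₃ : ExtZero R M N₃ n) : ExtZero R M N₁ (n + 1) := by
  refine ⟨fun a b => ?_⟩
  suffices ∀ a : Ext (ModuleCat.of R M) (ModuleCat.of R N₁) (n + 1), a = 0 by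
    rw [this a, this b]
  intro a
  obtain ⟨x, rfl⟩ := Ext.covariant_sequence_exact₁ (ModuleCat.of R M) h.shortExact a
    (h₂.elim _ _) rfl
  rw [h₃.elim x 0, Ext.zero_comp]

theorem IsSES.extZero_right (h : IsSES R f g) {n : ℕ} (h₂ : ExtZero R M N₂ n)
    (h₁ : ExtZero R M N₁ (n + 1)) : ExtZero R M N₃ n := by
  refine ⟨fun a b => ?_⟩
  suffices ∀ a : Ext (ModuleCat.of R M) (ModuleCat.of R N₃) n, a = 0 by
    rw [this a, this b]
  intro a
  obtain ⟨x, rfl⟩ := Ext.covariant_sequence_exact₃ (ModuleCat.of R M) h.shortExact a rfl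
    (h₁.elim _ _)
  rw [h₂.elim x 0, Ext.zero_comp]

theorem IsSES.extZero_left_contra (h : IsSES R f g) {n : ℕ} (h₂ : ExtZero R N₂ N n)
    (h₃ : ExtZero R N₃ N (n + 1)) : ExtZero R N₁ N n := by
  refine ⟨fun a b => ?_⟩
  suffices ∀ a : Ext (ModuleCat.of R N₁) (ModuleCat.of R N) n, a = 0 by
    rw [this a, this b]
  intro a
  obtain ⟨x, rfl⟩ := Ext.contravariant_sequence_exact₁ h.shortExact (ModuleCat.of R N) a
    (add_comm 1 n) (h₃.elim _ _)
  rw [h₂.elim x 0, Ext.comp_zero]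

theorem IsSES.extZero_succ_contra (h : IsSES R f g) {n : ℕ} (h₂ : ExtZero R N₂ N (n + 1))
    (h₁ : ExtZero R N₁ N n) : ExtZero R N₃ N (n + 1) := by
  refine ⟨fun a b => ?_⟩
  suffices ∀ a : Ext (ModuleCat.of R N₃) (ModuleCat.of R N) (n + 1), a = 0 by
    rw [this a, this b]
  intro a
  obtain ⟨x, rfl⟩ := Ext.contravariant_sequence_exact₃ h.shortExact (ModuleCat.of R N) a
    (h₂.elim _ _) (add_comm 1 n)
  rw [h₁.elim x 0, Ext.comp_zero]

/-- If `Ext¹(M, N₁) = 0`, homomorphisms from `M` lift along `N₂ → N₃`. -/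
theorem IsSES.exists_lift (h : IsSES R f g) (h₁ : ExtZero R M N₁ 1) (φ : M →ₗ[R] N₃) :
    ∃ ψ : M →ₗ[R] N₂, g ∘ₗ ψ = φ := by
  obtain ⟨x, hx⟩ := Ext.covariant_sequence_exact₃ (ModuleCat.of R M) h.shortExact
    (Ext.mk₀ (ModuleCat.ofHom φ)) (zero_add 1) (h₁.elim _ _)
  obtain ⟨ψ, rfl⟩ := Ext.homEquiv₀.symm.surjective x
  refine ⟨ψ.hom, ?_⟩
  have : ψ ≫ ModuleCat.ofHom g = ModuleCat.ofHom φ :=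
    Ext.homEquiv₀.symm.injective (by simpa using hx)
  exact congrArg ModuleCat.Hom.hom this

/-- A class in Ext¹(M, N₁) is the image of some φ : M → N₃ under the connecting map. If φ factors
through `g` the image is zero, because `g` composed with the extension class is zero. -/
theorem IsSES.extZero_one_of_lift (h : IsSES R f g) (h₂ : ExtZero R M N₂ 1)
    (H : ∀ φ : M →ₗ[R] N₃, ∃ ψ : M →ₗ[R] N₂, g ∘ₗ ψ = φ) : ExtZero R M N₁ 1 := by
  refine ⟨fun a b => ?_⟩
  suffices ∀ a : Ext (ModuleCat.of R M) (ModuleCat.of R N₁) 1, a = 0 by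
    rw [this a, this b]
  intro a
  obtain ⟨x, rfl⟩ := Ext.covariant_sequence_exact₁ (ModuleCat.of R M) h.shortExact a
    (h₂.elim _ _) (zero_add 1)
  obtain ⟨φ, rfl⟩ := Ext.homEquiv₀.symm.surjective x
  obtain ⟨ψ, hψ⟩ := H φ.hom
  have : φ = ModuleCat.ofHom ψ ≫ ModuleCat.ofHom g := by
    ext x; exact (LinearMap.congr_fun hψ x).symm
  rw [Ext.homEquiv₀_symm_apply, this, ← Ext.mk₀_comp_mk₀,
    Ext.comp_assoc_of_second_deg_zero]
  exact (congrArg (fun z => Ext.comp _ z _) h.shortExact.comp_extClass).trans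
    (Ext.comp_zero _ _ _ _ _)

/-- If `Ext¹(N₃, N) = 0`, homomorphisms to `N` extend along `N₁ → N₂`. -/
theorem IsSES.exists_extension (h : IsSES R f g) (h₁ : ExtZero R N₃ N 1) (φ : N₁ →ₗ[R] N) :
    ∃ ψ : N₂ →ₗ[R] N, ψ ∘ₗ f = φ := by
  obtain ⟨x, hx⟩ := Ext.contravariant_sequence_exact₁ h.shortExact (ModuleCat.of R N)
    (Ext.mk₀ (ModuleCat.ofHom φ)) (add_zero 1) (h₁.elim _ _)
  obtain ⟨ψ, rfl⟩ := Ext.homEquiv₀.symm.surjective x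
  refine ⟨ψ.hom, ?_⟩
  have : ModuleCat.ofHom f ≫ ψ = ModuleCat.ofHom φ :=
    Ext.homEquiv₀.symm.injective (by simpa using hx)
  exact congrArg ModuleCat.Hom.hom this

theorem extZero_of_projective [Module.Projective R M] (n : ℕ) : ExtZero R M N (n + 1) :=
  extZero_of_projDimLT ((projDimLT_one_iff.2 ‹_›).mono (by lia))

theorem extZero_of_injective (h : Module.Injective R N) (n : ℕ) : ExtZero R M N (n + 1) :=
  extZero_of_injDimLT ((injDimLT_one_iff.2 ‹_›).mono (by lia))

end

end Homological

open MulOpposite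

/-! ### Coinduction Hom_E(P, -), its exactness, and the adjoint tensor product -/

section Coinduction

variable {E B : Type u} [Ring E] [Ring B] {P : Type u} [AddCommGroup P] [Module E P]

/-- For an `(E, B)`-bimodule `P`, with right action given by `ρ`, and an `E`-module `N`, this is
`Hom_E(P, N)`, considered as a `B`-module. -/
@[nolint unusedArguments]
def Coind (_ρ : Bᵐᵒᵖ →+* Module.End E P) (N : Type u) [AddCommGroup N] [Module E N] : Type u :=
  P →ₗ[E] N

namespace Coind

variable (ρ : Bᵐᵒᵖ →+* Module.End E P) (N : Type u) [AddCommGroup N] [Module E N]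
variable {N' : Type u} [AddCommGroup N'] [Module E N']

instance : AddCommGroup (Coind ρ N) := inferInstanceAs (AddCommGroup (P →ₗ[E] N))

instance : FunLike (Coind ρ N) P N := inferInstanceAs (FunLike (P →ₗ[E] N) P N)

instance : LinearMapClass (Coind ρ N) E P N :=
  inferInstanceAs (LinearMapClass (P →ₗ[E] N) E P N)

instance : Module B (Coind ρ N) where
  smul b f := LinearMap.comp (M₂ := P) f (ρ (op b))
  one_smul f := by
    change LinearMap.comp (M₂ := P) f (ρ 1) = f
    rw [map_one]; rfl
  mul_smul a b f := by
    change LinearMap.comp (M₂ := P) f (ρ (op b * op a)) =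
      LinearMap.comp (LinearMap.comp (M₂ := P) f (ρ (op b))) (ρ (op a))
    rw [map_mul]; rfl
  smul_zero a := LinearMap.zero_comp _
  smul_add a f g := LinearMap.add_comp _ _ _
  add_smul a b f := by
    change LinearMap.comp (M₂ := P) f (ρ (op a + op b)) = _
    rw [map_add]; exact LinearMap.comp_add _ _ _
  zero_smul f := by
    change LinearMap.comp (M₂ := P) f (ρ 0) = _
    rw [map_zero]; exact LinearMap.comp_zero _

variable {ρ N}

theorem smul_apply (b : B) (f : Coind ρ N) (p : P) : (b • f) p = f (ρ (op b) p) := rfl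

@[simp] theorem add_apply (f g : Coind ρ N) (p : P) : (f + g) p = f p + g p := rfl

@[simp] theorem zero_apply (p : P) : (0 : Coind ρ N) p = 0 := rfl

@[ext] theorem ext {f g : Coind ρ N} (h : ∀ p, f p = g p) : f = g := LinearMap.ext h

theorem sum_apply {ι : Type*} (s : Finset ι) (f : ι → Coind ρ N) (p : P) :
    (∑ i ∈ s, f i) p = ∑ i ∈ s, f i p :=
  LinearMap.sum_apply s f p

/-- An element of the coinduced module as a linear map. -/
def toLinearMap (f : Coind ρ N) : P →ₗ[E] N := f

@[simp] theorem toLinearMap_apply (f : Coind ρ N) (p : P) : f.toLinearMap p = f p := rfl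

variable (ρ)

/-- A linear map `P → N` as an element of the coinduced module. -/
def ofLinearMap (f : P →ₗ[E] N) : Coind ρ N := f

@[simp] theorem ofLinearMap_apply (f : P →ₗ[E] N) (p : P) : ofLinearMap ρ f p = f p := rfl

/-- Functoriality of coinduction. -/
def map (g : N →ₗ[E] N') : Coind ρ N →ₗ[B] Coind ρ N' where
  toFun f := g.comp (M₂ := N) f
  map_add' _ _ := LinearMap.comp_add _ _ _
  map_smul' _ _ := rfl

@[simp] theorem map_apply (g : N →ₗ[E] N') (f : Coind ρ N) (p : P) : map ρ g f p = g (f p) := rfl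

/-- Projectivity of `P` serves for surjectivity; left exactness is formal. -/
theorem isSES_map {N'' : Type u} [AddCommGroup N''] [Module E N''] [Module.Projective E P]
    {f : N →ₗ[E] N'} {g : N' →ₗ[E] N''} (h : IsSES E f g) : IsSES B (map ρ f) (map ρ g) where
  inj a b hab := by
    ext p
    exact h.inj (DFunLike.congr_fun hab p)
  exact x := by
    constructor
    · intro hx
      have hx' : ∀ p, ∃ y, f y = x p := fun p => (h.exact _).1 (DFunLike.congr_fun hx p)
      have hr : ∀ p, LinearMap.codRestrict (LinearMap.range f) (M₂ := N') x hx' p =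
        ⟨x p, hx' p⟩ := fun p => rfl
      refine ⟨(LinearEquiv.ofInjective f h.inj).symm.toLinearMap ∘ₗ
        LinearMap.codRestrict (LinearMap.range f) (M₂ := N') x hx', ?_⟩
      refine ext fun p => ?_
      exact congrArg Subtype.val ((LinearEquiv.ofInjective f h.inj).apply_symm_apply ⟨x p, hx' p⟩)
    · rintro ⟨y, rfl⟩
      refine ext fun p => ?_
      exact (h.exact _).2 ⟨_, rfl⟩
  surj φ := by
    obtain ⟨ψ, hψ⟩ := Module.projective_lifting_property (P := P) g φ h.surj
    exact ⟨ψ, hψ⟩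

end Coind

/-- The equational criterion for flatness of the right `B`-module `P`. -/
def RightFlat {B P : Type u} [Ring B] [AddCommGroup P] (ρ : Bᵐᵒᵖ → P → P) : Prop :=
  ∀ (ι : Type u) (s : Finset ι) (p : ι → P) (b : ι → B), ∑ i ∈ s, ρ (op (b i)) (p i) = 0 →
    ∃ (κ : Type u) (t : Finset κ) (q : κ → P) (r : ι → κ → B),
      (∀ i ∈ s, p i = ∑ j ∈ t, ρ (op (r i j)) (q j)) ∧ ∀ j ∈ t, ∑ i ∈ s, r i j * b i = 0

/-- Expanding the `p i` in a basis turns the given relation into one relation per coordinate, and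
the coordinates form the required matrix. The right `B`-action is presented as a left action of a
ring `S` isomorphic to the opposite of `B`. -/
theorem RightFlat.of_free {B P S : Type u} [Ring B] [AddCommGroup P] [Ring S] [Module S P]
    [Module.Free S P] (θ : Bᵐᵒᵖ ≃+* S) : RightFlat (B := B) (P := P) fun b p => θ b • p := by
  classical
  intro ι s p b h
  let v := Module.Free.chooseBasis S P
  refine ⟨_, s.biUnion fun i => (v.repr (p i)).support, v,
    fun i j => unop (θ.symm (v.repr (p i) j)), ?_, ?_⟩
  · intro i hi
    simp only [op_unop, RingEquiv.apply_symm_apply]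
    conv_lhs => rw [← v.linearCombination_repr (p i), Finsupp.linearCombination_apply]
    refine Finsupp.sum_of_support_subset _ (Finset.subset_biUnion_of_mem
      (fun i => (v.repr (p i)).support) hi) _ (by simp)
  · intro j _
    have := congrArg (fun x => unop (θ.symm (v.repr x j))) h
    simpa [Finsupp.finsetSum_apply] using this

/-- X / ker Φ embeds in `P`, and the map induced on it by Ψ extends to `P`. -/
theorem exists_factorization_of_injective {X I : Type u} [AddCommGroup X] [Module E X]
    [AddCommGroup I] [Module E I] (hI : Module.Injective E I) (Φ : X →ₗ[E] P) (Ψ : X →ₗ[E] I)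
    (h : ∀ x, Φ x = 0 → Ψ x = 0) : ∃ g : P →ₗ[E] I, ∀ x, g (Φ x) = Ψ x := by
  obtain ⟨g, hg⟩ := hI.out ((LinearMap.ker Φ).liftQ Φ le_rfl)
    (LinearMap.ker_eq_bot.1 (Submodule.ker_liftQ_eq_bot _ _ _ le_rfl))
    ((LinearMap.ker Φ).liftQ Ψ h)
  exact ⟨g, fun x => hg (Submodule.Quotient.mk x)⟩

variable {ρ : Bᵐᵒᵖ →+* Module.End E P}

/-- Flatness says that J ⊗ P → P is injective for a left ideal J. A map J → Hom_E(P, I) is a map J ⊗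
P → I, which therefore extends to `P`; this is Baer's criterion. -/
theorem Coind.injective (hρ : RightFlat fun b p => ρ b p) {I : Type u} [AddCommGroup I]
    [Module E I] (hI : Module.Injective E I) : Module.Injective B (Coind ρ I) := by
  classical
  refine Module.Baer.injective fun J f => ?_
  -- Finitely supported functions replace J ⊗ P: Φ is b ⊗ p ↦ pb and Ψ is b ⊗ p ↦ f(b)(p). The
  -- equational criterion shows that ker Φ lies in ker Ψ.
  let Φ : (J →₀ P) →ₗ[E] P := Finsupp.lsum ℕ fun b => ρ (op b.1)
  let Ψ : (J →₀ P) →ₗ[E] I := Finsupp.lsum ℕ fun b => (f b).toLinearMap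
  have hΨ : ∀ c, Ψ c = ∑ b ∈ c.support, f b (c b) := fun c => rfl
  have hΦ : ∀ c, Φ c = ∑ b ∈ c.support, ρ (op b.1) (c b) := fun c => rfl
  obtain ⟨g, hg⟩ := exists_factorization_of_injective hI Φ Ψ (fun c hc => by
    rw [hΦ] at hc
    obtain ⟨κ, t, q, r, hp, hr⟩ := hρ J c.support c (fun b => b.1) hc
    rw [hΨ]
    calc ∑ b ∈ c.support, f b (c b)
        = ∑ b ∈ c.support, ∑ j ∈ t, f (r b j • b) (q j) := by
          refine Finset.sum_congr rfl fun b hb => ?_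
          conv_lhs => rw [hp b hb, map_sum]
          refine Finset.sum_congr rfl fun j _ => ?_
          rw [map_smul]; rfl
      _ = ∑ j ∈ t, f (∑ b ∈ c.support, r b j • b) (q j) := by
          rw [Finset.sum_comm]
          refine Finset.sum_congr rfl fun j _ => ?_
          rw [map_sum, Coind.sum_apply]
      _ = 0 := by
          refine Finset.sum_eq_zero fun j hj => ?_
          have : ∑ b ∈ c.support, r b j • b = 0 := by
            apply Subtype.ext
            simpa using hr j hj
          rw [this, map_zero, Coind.zero_apply])
  refine ⟨LinearMap.toSpanSingleton B (Coind ρ I) (Coind.ofLinearMap ρ g), fun b hb => ?_⟩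
  ext p
  have := hg (Finsupp.single ⟨b, hb⟩ p)
  rw [hΦ, hΨ] at this
  rw [LinearMap.toSpanSingleton_apply, Coind.smul_apply, Coind.ofLinearMap_apply]
  have e1 : Φ (Finsupp.single ⟨b, hb⟩ p) = ρ (op b) p := by simp [Φ]
  have e2 : Ψ (Finsupp.single ⟨b, hb⟩ p) = f ⟨b, hb⟩ p := by simp [Ψ]
  rw [← e1, ← e2, hg]

theorem Coind.injDimLT [Module.Projective E P] (hρ : RightFlat fun b p => ρ b p) {n : ℕ}
    {N : Type u} [AddCommGroup N] [Module E N] (h : InjDimLT E N (n + 1)) :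
    InjDimLT B (Coind ρ N) (n + 1) := by
  induction n generalizing N with
  | zero => exact injDimLT_one_iff.2 (Coind.injective hρ (injDimLT_one_iff.1 h))
  | succ n ih =>
    obtain ⟨I, Q, _, _, _, _, f, g, hI, hs⟩ := exists_injective_ses E N
    exact ((Coind.isSES_map ρ hs).injDimLT_iff (Coind.injective hρ hI) n).1
      (ih ((hs.injDimLT_iff hI n).2 h))

/-- `μ` exhibits the `E`-module `M` as the tensor product `P ⊗_B X`. -/
structure IsTensor {X M : Type u} [AddCommGroup X] [Module B X] [AddCommGroup M] [Module E M]
    (μ : X →ₗ[B] Coind ρ M) : Prop where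
  span_eq_top : Submodule.span E {m | ∃ x p, m = μ x p} = ⊤
  exists_lift : ∀ {N : Type u} [AddCommGroup N] [Module E N] (h : X →ₗ[B] Coind ρ N),
    ∃ g : M →ₗ[E] N, ∀ x p, g (μ x p) = h x p

section

variable {X M : Type u} [AddCommGroup X] [Module B X] [AddCommGroup M] [Module E M]
  {μ : X →ₗ[B] Coind ρ M} [Module.Projective E P]

/-- Embed `N` in an injective and shift dimension on both sides at once: coinduction keeps the
sequence exact and its middle term injective. In degree one, a map M → Q corresponds to a map from X
to the coinduced module; this lifts, and the universal property turns the lift back into a map from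
M. -/
theorem IsTensor.extZero (hμ : IsTensor μ) (hρ : RightFlat fun b p => ρ b p) {n : ℕ}
    {N : Type u} [AddCommGroup N] [Module E N] (h : ExtZero B X (Coind ρ N) (n + 1)) :
    ExtZero E M N (n + 1) := by
  induction n generalizing N with
  | zero =>
    obtain ⟨I, Q, _, _, _, _, f, g, hI, hs⟩ := exists_injective_ses E N
    refine hs.extZero_one_of_lift (extZero_of_injective hI 0) fun φ => ?_
    obtain ⟨ψ, hψ⟩ := (Coind.isSES_map ρ hs).exists_lift h (Coind.map ρ φ ∘ₗ μ)
    obtain ⟨ψ', hψ'⟩ := hμ.exists_lift ψ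
    refine ⟨ψ', LinearMap.ext_on hμ.span_eq_top ?_⟩
    rintro _ ⟨x, p, rfl⟩
    have := DFunLike.congr_fun (LinearMap.congr_fun hψ x) p
    simpa [hψ'] using this
  | succ n ih =>
    obtain ⟨I, Q, _, _, _, _, f, g, hI, hs⟩ := exists_injective_ses E N
    exact hs.extZero_succ (extZero_of_injective hI _)
      (ih ((Coind.isSES_map ρ hs).extZero_right
        (extZero_of_injective (Coind.injective hρ hI) n) h))

theorem IsTensor.projDimLT (hμ : IsTensor μ) (hρ : RightFlat fun b p => ρ b p) {n : ℕ}
    (h : ProjDimLT B X (n + 1)) : ProjDimLT E M (n + 1) :=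
  projDimLT_of_extZero fun _ _ _ => hμ.extZero hρ (extZero_of_projDimLT h)

end

end Coinduction

/-! ### Restriction of scalars along a right flat homomorphism -/

section Restriction

variable {A B : Type u} [Ring A] [Ring B] (φ : A →+* B)

/-- The right action of `A` on `B` along a ring homomorphism. -/
def rightMulAction : Aᵐᵒᵖ →+* Module.End B B :=
  (Module.toModuleEnd B (S := Bᵐᵒᵖ) B).comp φ.op

@[simp] theorem rightMulAction_apply (a : Aᵐᵒᵖ) (b : B) :
    rightMulAction φ a b = b * φ a.unop := rfl

/-- `B` is flat as a right `A`-module. -/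
abbrev IsRightFlatHom : Prop := RightFlat fun (a : Aᵐᵒᵖ) (b : B) => b * φ a.unop

variable {N : Type u} [AddCommGroup N] [Module A N] [Module B N]

/-- Restriction of scalars as a coinduction. -/
def coindEquivRestrict (hN : ∀ (a : A) (x : N), a • x = φ a • x) :
    Coind (rightMulAction φ) N ≃ₗ[A] N where
  toFun f := f.toLinearMap 1
  map_add' f g := rfl
  map_smul' a f := by
    simp only [Coind.toLinearMap_apply, Coind.smul_apply, rightMulAction_apply, unop_op, one_mul, RingHom.id_apply, hN]
    rw [← map_smul, smul_eq_mul, mul_one]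
  invFun x := LinearMap.toSpanSingleton B N x
  left_inv f := by
    ext b
    change b • f.toLinearMap 1 = f b
    rw [Coind.toLinearMap_apply, ← map_smul, smul_eq_mul, mul_one]
  right_inv x := one_smul B x

variable {φ}

theorem InjDimLT.restrict (hφ : IsRightFlatHom φ) (hN : ∀ (a : A) (x : N), a • x = φ a • x) {n : ℕ}
    (h : InjDimLT B N (n + 1)) : InjDimLT A N (n + 1) :=
  (Coind.injDimLT (ρ := rightMulAction φ) hφ h).of_equiv (coindEquivRestrict φ hN)

end Restriction

/-! ### Tensor products over k of bimodules, as bimodules over enveloping algebras -/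

section BiTensor

variable (k : Type v) [Field k] (X Y : Type u) [AddCommGroup X] [Module k X] [AddCommGroup Y]
  [Module k Y]

/-- The tensor product `X ⊗ₖ Y`, on which `S₁ ⊗ₖ S₂` acts when `S₁` acts on `X` and `S₂` on `Y`. -/
def BiTensor : Type u := X ⊗[k] Y

namespace BiTensor

noncomputable instance : AddCommGroup (BiTensor k X Y) := inferInstanceAs (AddCommGroup (X ⊗[k] Y))

variable {X Y}

/-- Pure tensors. -/
def tmul (x : X) (y : Y) : BiTensor k X Y := x ⊗ₜ[k] y

variable {k}

@[elab_as_elim]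
theorem induction_on {C : BiTensor k X Y → Prop} (z : BiTensor k X Y) (zero : C 0)
    (tmul : ∀ x y, C (tmul k x y)) (add : ∀ x y, C x → C y → C (x + y)) : C z :=
  TensorProduct.induction_on z zero tmul add

variable {S₁ S₂ : Type u} [Semiring S₁] [Algebra k S₁] [Semiring S₂] [Algebra k S₂]
  [Module S₁ X] [IsScalarTower k S₁ X] [Module S₂ Y] [IsScalarTower k S₂ Y]

variable (k S₁ S₂ X Y) in
/-- The action of `S₁ ⊗ S₂` on `X ⊗ Y`. -/
noncomputable def actionHom : S₁ ⊗[k] S₂ →ₐ[k] Module.End k (X ⊗[k] Y) :=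
  (Module.endTensorEndAlgHom (R := k) (S := k) (A := k) (M := X) (N := Y)).comp
    (Algebra.TensorProduct.map (Algebra.lsmul k k X) (Algebra.lsmul k k Y))

noncomputable instance : Module (S₁ ⊗[k] S₂) (BiTensor k X Y) :=
  Module.compHom (X ⊗[k] Y) (actionHom k X Y S₁ S₂).toRingHom

theorem tmul_smul_tmul (s : S₁) (t : S₂) (x : X) (y : Y) :
    (s ⊗ₜ[k] t : S₁ ⊗[k] S₂) • tmul k x y = tmul k (s • x) (t • y) := by
  change actionHom k X Y S₁ S₂ (s ⊗ₜ t) (x ⊗ₜ y) = _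
  simp [actionHom, Module.endTensorEndAlgHom_apply]
  rfl

/-- Tensors of basis elements form a basis. For division algebras this supplies both the
projectivity and the flatness required by coinduction. -/
instance [Module.Free S₁ X] [Module.Free S₂ Y] : Module.Free (S₁ ⊗[k] S₂) (BiTensor k X Y) := by
  let b₁ := Module.Free.chooseBasis S₁ X
  let b₂ := Module.Free.chooseBasis S₂ Y
  let e : X ⊗[k] Y ≃ₗ[k] (_ × _ →₀ S₁ ⊗[k] S₂) :=
    (TensorProduct.congr (b₁.repr.restrictScalars k) (b₂.repr.restrictScalars k)).trans
      (finsuppTensorFinsupp k k S₁ S₂ _ _)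
  have key : ∀ (s : S₁ ⊗[k] S₂) (z : BiTensor k X Y), e (s • z) = s • e z := by
    intro s z
    induction s with
    | zero => rw [zero_smul, zero_smul]; exact map_zero e
    | add s t hs ht => rw [add_smul, add_smul, ← hs, ← ht]; exact map_add e _ _
    | tmul s t =>
      induction z using BiTensor.induction_on with
      | zero => rw [smul_zero]; exact (map_zero e).trans (by simp [show e (0 : BiTensor k X Y) = 0 from map_zero e])
      | add x y hx hy =>
        have h1 : ∀ a b : BiTensor k X Y, e (a + b) = e a + e b := fun a b => map_add e a b
        rw [smul_add, h1, h1, hx, hy, smul_add]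
      | tmul x y =>
        rw [tmul_smul_tmul]
        change finsuppTensorFinsupp k k S₁ S₂ _ _ (b₁.repr (s • x) ⊗ₜ b₂.repr (t • y)) =
          (s ⊗ₜ[k] t : S₁ ⊗[k] S₂) •
            finsuppTensorFinsupp k k S₁ S₂ _ _ (b₁.repr x ⊗ₜ b₂.repr y)
        ext ⟨i, j⟩
        simp [finsuppTensorFinsupp_apply]
  exact Module.Free.of_equiv (M := _ × _ →₀ S₁ ⊗[k] S₂)
    ({ e with map_smul' := key } : BiTensor k X Y ≃ₗ[S₁ ⊗[k] S₂] (_ × _ →₀ S₁ ⊗[k] S₂)).symm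

end BiTensor

section Bimodule

variable (D : Type u) [Ring D] [Algebra k D]

/-- Exchange of the two factors of an enveloping algebra. -/
noncomputable def envOpEquiv : (EnvAlg k D)ᵐᵒᵖ ≃+* Dᵐᵒᵖ ⊗[k] D :=
  ((Algebra.TensorProduct.opAlgEquiv k k D Dᵐᵒᵖ).symm.trans
    (Algebra.TensorProduct.congr AlgEquiv.refl (AlgEquiv.opOp k D).symm)).toRingEquiv

variable (E : Type u) [Ring E] [Algebra k E]
variable {X Y}
variable [Module E X] [IsScalarTower k E X] [Module Dᵐᵒᵖ X] [IsScalarTower k Dᵐᵒᵖ X]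
  [SMulCommClass E Dᵐᵒᵖ X] [Module Eᵐᵒᵖ Y] [IsScalarTower k Eᵐᵒᵖ Y] [Module D Y]
  [IsScalarTower k D Y] [SMulCommClass Eᵐᵒᵖ D Y]

theorem BiTensor.actionHom_commute (s : E ⊗[k] Eᵐᵒᵖ) (t : Dᵐᵒᵖ ⊗[k] D) :
    Commute (actionHom k X Y E Eᵐᵒᵖ s) (actionHom k X Y Dᵐᵒᵖ D t) := by
  induction s using TensorProduct.induction_on with
  | zero => rw [map_zero]; exact Commute.zero_left _
  | add s s' h h' => rw [map_add]; exact h.add_left h'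
  | tmul s s' =>
    induction t using TensorProduct.induction_on with
    | zero => rw [map_zero]; exact Commute.zero_right _
    | add t t' h h' => rw [map_add]; exact h.add_right h'
    | tmul t t' =>
      refine TensorProduct.ext' fun x y => ?_
      change ((s • t • x) ⊗ₜ (s' • t' • y) : X ⊗[k] Y) = (t • s • x) ⊗ₜ (t' • s' • y)
      rw [smul_comm s t x, smul_comm s' t' y]

instance BiTensor.smulCommClass :
    SMulCommClass (EnvAlg k E) (Dᵐᵒᵖ ⊗[k] D) (BiTensor k X Y) where
  smul_comm s t z := LinearMap.congr_fun (BiTensor.actionHom_commute k D E s t) z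

instance BiTensor.smulCommClass' :
    SMulCommClass (Dᵐᵒᵖ ⊗[k] D) (EnvAlg k E) (BiTensor k X Y) := SMulCommClass.symm _ _ _

variable (X Y)

/-- If `X` is an `(E, D)`-bimodule and `Y` is a `(D, E)`-bimodule, then `X ⊗ₖ Y` is a bimodule over
the enveloping algebras of `E` and `D`. -/
noncomputable def biTensorAction :
    (EnvAlg k D)ᵐᵒᵖ →+* Module.End (EnvAlg k E) (BiTensor k X Y) :=
  (Module.toModuleEnd (EnvAlg k E) (S := Dᵐᵒᵖ ⊗[k] D) (BiTensor k X Y)).comp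
    (envOpEquiv k D).toRingHom

variable {X Y}

theorem biTensorAction_tmul (a : D) (b : Dᵐᵒᵖ) (x : X) (y : Y) :
    biTensorAction k X Y D E (op (a ⊗ₜ b)) (BiTensor.tmul k x y) =
      BiTensor.tmul k (op a • x) (b.unop • y) :=
  BiTensor.tmul_smul_tmul (op a) b.unop x y

theorem biTensorAction_rightFlat [Module.Free Dᵐᵒᵖ X] [Module.Free D Y] :
    RightFlat fun b p => biTensorAction k X Y D E b p :=
  RightFlat.of_free (P := BiTensor k X Y) (S := Dᵐᵒᵖ ⊗[k] D) (envOpEquiv k D)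

end Bimodule
end BiTensor

/-! ### Enveloping algebras, invariance of htr under isomorphism, part (e) -/

section Env

variable (k : Type v) [Field k]

/-- A `k`-algebra is a module over its enveloping algebra. -/
noncomputable instance envModule (D : Type u) [Ring D] [Algebra k D] : Module (EnvAlg k D) D :=
  Module.compHom D (AlgHom.mulLeftRight k D).toRingHom

variable {k}

theorem env_smul {D : Type u} [Ring D] [Algebra k D] (a : D) (b : Dᵐᵒᵖ) (x : D) :
    (a ⊗ₜ[k] b : EnvAlg k D) • x = a * x * b.unop :=
  AlgHom.mulLeftRight_apply k D a b x

instance EnvAlg.nontrivial (D : Type u) [Ring D] [Algebra k D] [Nontrivial D] :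
    Nontrivial (EnvAlg k D) :=
  Module.nontrivial (EnvAlg k D) D

theorem htr_le_iff (D : Type u) [Ring D] [Algebra k D] (n : ℕ) :
    htr k D ≤ n ↔ InjDimLT (EnvAlg k D) (EnvAlg k D) (n + 1) :=
  injectiveDimension_le_iff _ _

theorem htr_ne_bot (D : Type u) [Ring D] [Algebra k D] [Nontrivial D] : htr k D ≠ ⊥ := by
  intro h
  have := (injectiveDimension_eq_bot_iff _).1 h
  exact not_subsingleton (EnvAlg k D) (ModuleCat.subsingleton_of_isZero this)

/-- Only finite bounds matter: the value ⊤ is trivial and ⊥ is excluded because the enveloping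
algebra of `D` is nonzero. -/
theorem htr_le_htr {C D : Type u} [Ring D] [Algebra k D] [Nontrivial D] [Ring C] [Algebra k C]
    (h : ∀ n, InjDimLT (EnvAlg k D) (EnvAlg k D) (n + 1) →
      InjDimLT (EnvAlg k C) (EnvAlg k C) (n + 1)) : htr k C ≤ htr k D := by
  generalize hd : htr k D = d
  induction d with
  | bot => exact absurd hd (htr_ne_bot D)
  | coe d =>
    induction d with
    | top => exact le_top
    | coe d => exact (htr_le_iff C d).2 (h d ((htr_le_iff D d).1 hd.le))

theorem InjDimLT.of_ringEquiv {R S : Type u} [Ring R] [Ring S] (e : R ≃+* S) {n : ℕ}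
    (h : InjDimLT S S (n + 1)) : InjDimLT R R (n + 1) := by
  let _ : Module R S := Module.compHom S e.toRingHom
  have hflat : IsRightFlatHom e.toRingHom :=
    have : Module.Free Sᵐᵒᵖ S := Module.Free.of_equiv (opLinearEquiv Sᵐᵒᵖ).symm
    RightFlat.of_free (B := R) (P := S) (S := Sᵐᵒᵖ) (RingEquiv.op e)
  have h1 : InjDimLT R S (n + 1) := h.restrict hflat fun _ _ => rfl
  exact h1.of_equiv
    { e.symm.toAddEquiv with
      map_smul' := fun r s => by
        change e.symm (e r * s) = r * e.symm s
        simp }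

/-- The enveloping algebras of an algebra and of its opposite are isomorphic. -/
noncomputable def envSwap (D : Type u) [Ring D] [Algebra k D] : EnvAlg k Dᵐᵒᵖ ≃+* EnvAlg k D :=
  ((Algebra.TensorProduct.congr AlgEquiv.refl (AlgEquiv.opOp k D).symm).trans
    (Algebra.TensorProduct.comm k Dᵐᵒᵖ D)).toRingEquiv

theorem htr_op (D : Type u) [Ring D] [Algebra k D] [Nontrivial D] : htr k D = htr k Dᵐᵒᵖ :=
  le_antisymm (htr_le_htr fun _ h => h.of_ringEquiv (envSwap D).symm)
    (htr_le_htr fun _ h => h.of_ringEquiv (envSwap D))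

theorem htr_congr {C D : Type u} [Ring D] [Algebra k D] [Nontrivial D] [Ring C] [Algebra k C]
    [Nontrivial C] (e : C ≃ₐ[k] D) : htr k C = htr k D := by
  let e' : EnvAlg k C ≃+* EnvAlg k D :=
    (Algebra.TensorProduct.congr e (AlgEquiv.op e)).toRingEquiv
  exact le_antisymm (htr_le_htr fun _ h => h.of_ringEquiv e')
    (htr_le_htr fun _ h => h.of_ringEquiv e'.symm)

end Env

/-! ### The bimodule D controls the dimension of all bimodules -/

section Lift

variable {k : Type v} [Field k] {S₁ S₂ X Y Z : Type u} [Semiring S₁] [Algebra k S₁] [Semiring S₂]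
  [Algebra k S₂] [AddCommGroup X] [Module k X] [AddCommGroup Y] [Module k Y] [AddCommGroup Z]
  [Module S₁ X] [IsScalarTower k S₁ X] [Module S₂ Y] [IsScalarTower k S₂ Y] [Module (S₁ ⊗[k] S₂) Z]

/-- A balanced biadditive map induces a linear map on the tensor product of bimodules. -/
noncomputable def BiTensor.lift (f : X →+ Y →+ Z) (hf : ∀ (c : k) x y, f (c • x) y = f x (c • y))
    (hs : ∀ (s : S₁) (t : S₂) x y, f (s • x) (t • y) = (s ⊗ₜ[k] t : S₁ ⊗[k] S₂) • f x y) :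
    BiTensor k X Y →ₗ[S₁ ⊗[k] S₂] Z where
  toFun := TensorProduct.liftAddHom f hf
  map_add' := map_add (TensorProduct.liftAddHom f hf)
  map_smul' a z := by
    have hadd : ∀ z w : BiTensor k X Y, TensorProduct.liftAddHom f hf (z + w) =
      TensorProduct.liftAddHom f hf z + TensorProduct.liftAddHom f hf w := map_add _
    have hzero : TensorProduct.liftAddHom f hf (0 : BiTensor k X Y) = 0 := map_zero _
    induction a using TensorProduct.induction_on with
    | zero => rw [zero_smul, hzero, map_zero, zero_smul]
    | add a b ha hb => rw [add_smul, hadd, ha, hb, map_add, add_smul]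
    | tmul s t =>
      induction z using BiTensor.induction_on with
      | zero => rw [smul_zero, hzero, smul_zero]
      | add z w hz hw => rw [smul_add, hadd, hadd, hz, hw, smul_add]
      | tmul x y =>
        rw [BiTensor.tmul_smul_tmul]
        exact hs s t x y

end Lift

section GlobalDimension

variable {k : Type v} [Field k] {D : Type u} [DivisionRing D] [Algebra k D]

section

variable {M : Type u} [AddCommGroup M] [Module k M] [Module D M] [Module Dᵐᵒᵖ M]
  [IsScalarTower k D M] [IsScalarTower k Dᵐᵒᵖ M] [SMulCommClass Dᵐᵒᵖ D M] [Module (EnvAlg k D) M]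

theorem env_induction {S₁ S₂ : Type u} [Semiring S₁] [Algebra k S₁] [Semiring S₂] [Algebra k S₂]
    {X Y F : Type*} [AddCommMonoid X] [AddCommMonoid Y]
    [Module (S₁ ⊗[k] S₂) X] [Module (S₁ ⊗[k] S₂) Y] [FunLike F X Y] [AddMonoidHomClass F X Y]
    (f : F) (h : ∀ (a : S₁) (b : S₂) x, f ((a ⊗ₜ[k] b : S₁ ⊗[k] S₂) • x) =
      (a ⊗ₜ[k] b : S₁ ⊗[k] S₂) • f x)
    (s : S₁ ⊗[k] S₂) (x : X) : f (s • x) = s • f x := by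
  induction s using TensorProduct.induction_on with
  | zero => rw [zero_smul, zero_smul, map_zero]
  | add s t hs ht => rw [add_smul, map_add, hs, ht, add_smul]
  | tmul s t => exact h s t x

/-- The evaluation `(p ⊗ m, d) ↦ p d m` exhibiting `M` as `(D ⊗ M) ⊗_{D ⊗ D°} D`. -/
noncomputable def evalBimodule
    (hM : ∀ (a : D) (b : Dᵐᵒᵖ) (m : M), (a ⊗ₜ b : EnvAlg k D) • m = a • b • m) :
    D →ₗ[EnvAlg k D] Coind (biTensorAction k D M D D) M :=
  let f : D →+ Coind (biTensorAction k D M D D) M :=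
    AddMonoidHom.mk' (fun d => Coind.ofLinearMap _ <| BiTensor.lift
      (AddMonoidHom.mk' (fun p : D => AddMonoidHom.mk' (fun m : M => (p * d) • m)
        (fun _ _ => smul_add _ _ _)) (fun p q => by ext m; simp [add_mul, add_smul]))
      (fun c x y => by
        change ((c • x) * d) • y = (x * d) • c • y
        rw [smul_mul_assoc, smul_assoc, smul_comm])
      (fun s t x y => by
        change ((s * x) * d) • t • y = (s ⊗ₜ[k] t : EnvAlg k D) • (x * d) • y
        rw [hM, smul_comm t (x * d) y, smul_smul, mul_assoc]))
      (fun x y => Coind.ext fun p => by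
        rw [Coind.add_apply]
        simp only [Coind.ofLinearMap_apply]
        induction p using BiTensor.induction_on with
        | zero => simp
        | add p q hp hq => simp only [map_add, hp, hq]; abel
        | tmul p m =>
          change (p * (x + y)) • m = (p * x) • m + (p * y) • m
          rw [mul_add, add_smul])
  { f with
    map_smul' := fun s x => env_induction f (fun a b x => Coind.ext fun p => by
      rw [Coind.smul_apply]
      induction p using BiTensor.induction_on with
      | zero => simp
      | add p q hp hq => simp only [map_add, hp, hq]
      | tmul p m =>
        rw [biTensorAction_tmul, env_smul]
        change (p * (a * x * b.unop)) • m = ((p * a) * x) • b.unop • m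
        simp only [smul_smul, mul_assoc]) s x }

theorem evalBimodule_tmul
    (hM : ∀ (a : D) (b : Dᵐᵒᵖ) (m : M), (a ⊗ₜ b : EnvAlg k D) • m = a • b • m) (d p : D) (m : M) :
    evalBimodule hM d (BiTensor.tmul k p m) = (p * d) • m := rfl

/-- The factor d of (p ⊗ m) ⊗ d can be moved into either p or m, so everything is determined by the
elements (1 ⊗ m) ⊗ 1. This identifies `M` with (D ⊗ M) ⊗_{D^e} D. -/
theorem isTensor_evalBimodule
    (hM : ∀ (a : D) (b : Dᵐᵒᵖ) (m : M), (a ⊗ₜ b : EnvAlg k D) • m = a • b • m) :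
    IsTensor (evalBimodule (k := k) hM) where
  span_eq_top := by
    rw [eq_top_iff]
    intro m _
    refine Submodule.subset_span ⟨1, BiTensor.tmul k 1 m, ?_⟩
    rw [evalBimodule_tmul, mul_one, one_smul]
  exists_lift {N} _ _ h := by
    have key : ∀ (d p : D) (m : M), h d (BiTensor.tmul k p m) = h 1 (BiTensor.tmul k p (d • m)) := by
      intro d p m
      have : d = (1 ⊗ₜ[k] op d : EnvAlg k D) • (1 : D) := by rw [env_smul]; simp
      conv_lhs => rw [this, map_smul, Coind.smul_apply, biTensorAction_tmul]
      simp
    have key' : ∀ (d p : D) (m : M), h d (BiTensor.tmul k p m) = h 1 (BiTensor.tmul k (p * d) m) := by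
      intro d p m
      have : d = (d ⊗ₜ[k] 1 : EnvAlg k D) • (1 : D) := by rw [env_smul]; simp
      conv_lhs => rw [this, map_smul, Coind.smul_apply, biTensorAction_tmul]
      simp
    let g : M →+ N := AddMonoidHom.mk' (fun m => h 1 (BiTensor.tmul k 1 m)) (fun x y => by
      rw [← map_add]
      exact congrArg _ (TensorProduct.tmul_add _ _ _))
    refine ⟨{ g with map_smul' := env_induction g fun a b m => ?_ }, fun d z => ?_⟩
    · change h 1 (BiTensor.tmul k 1 ((a ⊗ₜ[k] b : EnvAlg k D) • m)) =
        (a ⊗ₜ[k] b : EnvAlg k D) • h 1 (BiTensor.tmul k 1 m)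
      rw [← map_smul, BiTensor.tmul_smul_tmul, hM, ← key, key', one_mul, smul_eq_mul, mul_one]
    · induction z using BiTensor.induction_on with
      | zero => simp
      | add z w hz hw => simp only [map_add, hz, hw]
      | tmul p m =>
        rw [key, evalBimodule_tmul]
        change h 1 (BiTensor.tmul k 1 ((p * d) • m)) = _
        rw [mul_smul, ← key, key', one_mul]

end

/-- The global dimension of the enveloping algebra of a division algebra `D` is at most the
projective dimension of `D` as a bimodule. -/
theorem projDimLT_env {n : ℕ} (h : ProjDimLT (EnvAlg k D) D (n + 1)) (M : Type u) [AddCommGroup M]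
    [Module (EnvAlg k D) M] : ProjDimLT (EnvAlg k D) M (n + 1) := by
  let incl : D →ₐ[k] EnvAlg k D := Algebra.TensorProduct.includeLeft
  let incr : Dᵐᵒᵖ →ₐ[k] EnvAlg k D := Algebra.TensorProduct.includeRight
  let _ : Module D M := Module.compHom M incl.toRingHom
  let _ : Module Dᵐᵒᵖ M := Module.compHom M incr.toRingHom
  let _ : Module k M := Module.compHom M (algebraMap k (EnvAlg k D))
  have hl : ∀ (d : D) (m : M), d • m = (d ⊗ₜ 1 : EnvAlg k D) • m := fun _ _ => rfl
  have hr : ∀ (d : Dᵐᵒᵖ) (m : M), d • m = (1 ⊗ₜ d : EnvAlg k D) • m := fun _ _ => rfl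
  have : IsScalarTower k D M := ⟨fun c d m => by
    change incl (c • d) • m = (algebraMap k (EnvAlg k D) c) • (incl d • m)
    rw [← mul_smul, ← Algebra.smul_def]
    exact congrArg (· • m) (map_smul incl c d)⟩
  have : IsScalarTower k Dᵐᵒᵖ M := ⟨fun c d m => by
    change incr (c • d) • m = (algebraMap k (EnvAlg k D) c) • (incr d • m)
    rw [← mul_smul, ← Algebra.smul_def]
    exact congrArg (· • m) (map_smul incr c d)⟩
  have : SMulCommClass Dᵐᵒᵖ D M := ⟨fun a b m => by
    rw [hl, hr, hr, hl, ← mul_smul, ← mul_smul]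
    simp [Algebra.TensorProduct.tmul_mul_tmul]⟩
  have hlr : ∀ (d : D) (e : Dᵐᵒᵖ) (m : M), (d ⊗ₜ e : EnvAlg k D) • m = d • e • m := by
    intro d e m
    rw [hl, hr, ← mul_smul]
    simp [Algebra.TensorProduct.tmul_mul_tmul]
  exact (isTensor_evalBimodule hlr).projDimLT (biTensorAction_rightFlat k D D) h

/-- If all bimodules have projective dimension at most n, then Ext^{n+1} into D^e vanishes
identically. -/
theorem htr_le_of_projDimLT {n : ℕ} (h : ProjDimLT (EnvAlg k D) D (n + 1)) : htr k D ≤ n :=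
  (htr_le_iff D n).2 (injDimLT_of_extZero fun M _ _ =>
    extZero_of_projDimLT (projDimLT_env h M))

end GlobalDimension

/-! ### Monotonicity, part (a) -/

section Subalgebra

variable {k : Type v} [Field k] {C D : Type u} [DivisionRing C] [Algebra k C] [DivisionRing D]
  [Algebra k D]

theorem RightFlat.of_addEquiv {B P P' : Type u} [Ring B] [AddCommGroup P] [AddCommGroup P']
    {ρ : Bᵐᵒᵖ → P → P} {ρ' : Bᵐᵒᵖ → P' → P'} (h : RightFlat ρ) (e : P ≃+ P')
    (he : ∀ b p, ρ' b (e p) = e (ρ b p)) : RightFlat ρ' := by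
  intro ι s p b hs
  obtain ⟨κ, t, q, r, h₁, h₂⟩ := h ι s (fun i => e.symm (p i)) b (e.injective (by
    rw [map_sum, map_zero, ← hs]
    refine Finset.sum_congr rfl fun i _ => ?_
    rw [← he, e.apply_symm_apply]))
  refine ⟨κ, t, fun j => e (q j), r, fun i hi => ?_, h₂⟩
  rw [← e.apply_symm_apply (p i), h₁ i hi, map_sum]
  exact Finset.sum_congr rfl fun j _ => (he _ _).symm

/-- The homomorphism of enveloping algebras induced by a homomorphism of algebras. -/
noncomputable def envMap (f : C →ₐ[k] D) : EnvAlg k C →ₐ[k] EnvAlg k D :=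
  Algebra.TensorProduct.map f (AlgHom.op f)

@[simp] theorem envMap_tmul (f : C →ₐ[k] D) (a : C) (b : Cᵐᵒᵖ) :
    envMap f (a ⊗ₜ b) = f a ⊗ₜ op (f b.unop) := rfl

/-- As a right C^e-module, D^e is the tensor product of `D` as a right and as a left C-vector space,
hence free. -/
theorem envMap_isRightFlatHom (f : C →ₐ[k] D) : IsRightFlatHom (envMap f).toRingHom := by
  let _ : Module C D := Module.compHom D f.toRingHom
  let _ : Module Cᵐᵒᵖ D := Module.compHom D (AlgHom.op f).toRingHom
  have : IsScalarTower k C D := ⟨fun c x y => by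
    change f (c • x) * y = c • (f x * y)
    rw [map_smul, smul_mul_assoc]⟩
  have : IsScalarTower k Cᵐᵒᵖ D := ⟨fun c x y => by
    change y * f (c • x.unop) = c • (y * f x.unop)
    rw [map_smul, mul_smul_comm]⟩
  have : SMulCommClass D Cᵐᵒᵖ D := ⟨fun a b y => by
    change a * (y * f b.unop) = (a * y) * f b.unop
    rw [mul_assoc]⟩
  have : SMulCommClass Dᵐᵒᵖ C D := ⟨fun a b y => by
    change (f b * y) * a.unop = f b * (y * a.unop)
    rw [mul_assoc]⟩
  refine (biTensorAction_rightFlat k C D (X := D) (Y := D)).of_addEquiv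
    (TensorProduct.congr (LinearEquiv.refl k D) (opLinearEquiv k)).toAddEquiv fun b z => ?_
  let T : BiTensor k D D →+ EnvAlg k D :=
    (TensorProduct.congr (LinearEquiv.refl k D) (opLinearEquiv k (M := D))).toAddEquiv.toAddMonoidHom
  change T z * envMap f b.unop = T (biTensorAction k D D C D b z)
  obtain ⟨b, rfl⟩ := op_surjective b
  rw [unop_op]
  induction b using TensorProduct.induction_on with
  | zero =>
    rw [MulOpposite.op_zero, map_zero, map_zero, mul_zero]
    exact (map_zero T).symm
  | add a b ha hb =>
    rw [MulOpposite.op_add, map_add, map_add, mul_add, ha, hb]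
    exact (map_add T _ _).symm
  | tmul a b =>
    induction z using BiTensor.induction_on with
    | zero => rw [map_zero, map_zero, map_zero, zero_mul]
    | add z w hz hw => rw [map_add, map_add, map_add, add_mul, hz, hw]
    | tmul x y =>
      rw [biTensorAction_tmul, envMap_tmul]
      exact Algebra.TensorProduct.tmul_mul_tmul _ _ _ _

/-- The enveloping algebra of a division subalgebra is a direct summand, as a left module. -/
theorem exists_env_retraction (f : C →ₐ[k] D) : ∃ π : EnvAlg k D →+ EnvAlg k C,
    (∀ a b, π (envMap f a * b) = a * π b) ∧ π 1 = 1 := by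
  let _ : Module C D := Module.compHom D f.toRingHom
  let _ : Module Cᵐᵒᵖ D := Module.compHom D (AlgHom.op f).toRingHom
  let i₁ : C →ₗ[C] D :=
    { toFun := f, map_add' := map_add f, map_smul' := fun a b => map_mul f a b }
  let i₂ : C →ₗ[Cᵐᵒᵖ] D :=
    { toFun := f, map_add' := map_add f, map_smul' := fun a b => map_mul f b a.unop }
  -- Two unrelated splittings of C ⊆ D, one left C-linear and one right C-linear; their tensor
  -- product is left C^e-linear.
  obtain ⟨p₁, h₁⟩ := LinearMap.exists_leftInverse_of_injective i₁
    (LinearMap.ker_eq_bot.2 f.toRingHom.injective)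
  obtain ⟨p₂, h₂⟩ := LinearMap.exists_leftInverse_of_injective i₂
    (LinearMap.ker_eq_bot.2 f.toRingHom.injective)
  have s₁ : ∀ (c : C) (d : D), p₁ (f c * d) = c * p₁ d := fun c d => map_smul p₁ c d
  have s₂ : ∀ (c : C) (d : D), p₂ (d * f c) = p₂ d * c := fun c d => map_smul p₂ (op c) d
  let q₁ : D →ₗ[k] C :=
    { toFun := p₁, map_add' := map_add p₁, map_smul' := fun c x => by
        rw [Algebra.smul_def, ← f.commutes, s₁, ← Algebra.smul_def]; rfl }
  let q₂ : Dᵐᵒᵖ →ₗ[k] Cᵐᵒᵖ :=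
    { toFun := fun x => op (p₂ x.unop)
      map_add' := fun x y => by simp
      map_smul' := fun c x => by
        rw [unop_smul, Algebra.smul_def, Algebra.commutes, ← f.commutes, s₂, ← Algebra.commutes,
          ← Algebra.smul_def]; rfl }
  refine ⟨(TensorProduct.map q₁ q₂).toAddMonoidHom, fun a b => ?_, ?_⟩
  · change TensorProduct.map q₁ q₂ _ = a * TensorProduct.map q₁ q₂ b
    induction a using TensorProduct.induction_on with
    | zero => rw [map_zero, zero_mul, zero_mul, map_zero]
    | add x y hx hy => rw [map_add, add_mul, map_add, hx, hy, add_mul]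
    | tmul x y =>
      induction b using TensorProduct.induction_on with
      | zero => rw [mul_zero, map_zero, mul_zero]
      | add x y hx hy => rw [mul_add, map_add, hx, hy, map_add, mul_add]
      | tmul c d =>
        rw [envMap_tmul, Algebra.TensorProduct.tmul_mul_tmul, TensorProduct.map_tmul,
          TensorProduct.map_tmul, Algebra.TensorProduct.tmul_mul_tmul]
        congr 1
        · exact s₁ x c
        · exact congrArg op (s₂ y.unop d.unop)
  · change TensorProduct.map q₁ q₂ (1 ⊗ₜ 1) = 1 ⊗ₜ 1
    rw [TensorProduct.map_tmul]
    congr 1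
    · change p₁ 1 = 1
      rw [← map_one f]
      exact LinearMap.congr_fun h₁ 1
    · change op (p₂ 1) = 1
      rw [← map_one f]
      exact congrArg op (LinearMap.congr_fun h₂ 1)

/-- The homological transcendence degree is monotone. -/
theorem htr_le_of_algHom (f : C →ₐ[k] D) : htr k C ≤ htr k D := by
  refine htr_le_htr fun n h => ?_
  let _ : Module (EnvAlg k C) (EnvAlg k D) := Module.compHom _ (envMap f).toRingHom
  have h1 : InjDimLT (EnvAlg k C) (EnvAlg k D) (n + 1) :=
    h.restrict (envMap_isRightFlatHom f) fun _ _ => rfl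
  obtain ⟨π, hπ, hπ1⟩ := exists_env_retraction f
  refine h1.of_retract
    { toFun := envMap f, map_add' := map_add _, map_smul' := fun a b => map_mul (envMap f) a b }
    { toFun := π, map_add' := map_add _, map_smul' := hπ } fun x => ?_
  change π (envMap f x) = x
  rw [← mul_one (envMap f x), hπ, hπ1, mul_one]

end Subalgebra

/-! ### Extensions of finite left dimension, part (b) -/

section FiniteExtension

/-- The `(D, C)`-bimodule `Hom_C(D, C)`. -/
def DualBimodule (C D : Type u) [Ring C] [Ring D] [Module C D] : Type u := D →ₗ[C] C

namespace DualBimodule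

section

variable (C D : Type u) [Ring C] [Ring D] [Module C D]

instance : AddCommGroup (DualBimodule C D) := inferInstanceAs (AddCommGroup (D →ₗ[C] C))

instance : FunLike (DualBimodule C D) D C := inferInstanceAs (FunLike (D →ₗ[C] C) D C)

instance : LinearMapClass (DualBimodule C D) C D C :=
  inferInstanceAs (LinearMapClass (D →ₗ[C] C) C D C)

instance : Module Cᵐᵒᵖ (DualBimodule C D) := inferInstanceAs (Module Cᵐᵒᵖ (D →ₗ[C] C))

instance {k : Type v} [Field k] [Algebra k C] : Module k (DualBimodule C D) :=
  inferInstanceAs (Module k (D →ₗ[C] C))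

instance [IsScalarTower C D D] : Module D (DualBimodule C D) where
  smul e f := LinearMap.comp (M₂ := D) (R₂ := C) (σ₁₂ := RingHom.id C) f
    { toFun := fun y => y * e
      map_add' := fun x y => add_mul x y e
      map_smul' := fun c x => smul_mul_assoc c x e }
  one_smul f := LinearMap.ext fun x => congrArg f (mul_one x)
  mul_smul a b f := LinearMap.ext fun x => congrArg f (mul_assoc x a b).symm
  smul_zero _ := LinearMap.zero_comp _
  smul_add _ _ _ := LinearMap.add_comp _ _ _
  add_smul a b f := LinearMap.ext fun x => (congrArg f (mul_add x a b)).trans (map_add f _ _)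
  zero_smul f := LinearMap.ext fun x => (congrArg f (mul_zero x)).trans (map_zero f)

end

variable {C D : Type u} [Ring C] [Ring D] [Module C D]

@[ext] theorem ext {f g : DualBimodule C D} (h : ∀ x, f x = g x) : f = g := LinearMap.ext h

theorem op_smul_apply (c : Cᵐᵒᵖ) (f : DualBimodule C D) (x : D) : (c • f) x = f x * c.unop := rfl

theorem smul_apply [IsScalarTower C D D] (e : D) (f : DualBimodule C D) (x : D) :
    (e • f) x = f (x * e) := rfl

theorem scalar_smul_apply {k : Type v} [Field k] [Algebra k C] (c : k) (f : DualBimodule C D)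
    (x : D) : (c • f) x = c • f x := rfl

theorem sum_apply {ι : Type*} (s : Finset ι) (f : ι → DualBimodule C D) (x : D) :
    (∑ i ∈ s, f i) x = ∑ i ∈ s, f i x :=
  LinearMap.sum_apply s f x

instance [IsScalarTower C D D] : SMulCommClass Cᵐᵒᵖ D (DualBimodule C D) :=
  ⟨fun _ _ _ => rfl⟩

variable {k : Type v} [Field k] [Algebra k C] [Algebra k D]

instance : IsScalarTower k Cᵐᵒᵖ (DualBimodule C D) :=
  ⟨fun a c f => ext fun x => by
    rw [op_smul_apply, scalar_smul_apply, op_smul_apply, unop_smul, mul_smul_comm]⟩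

instance [IsScalarTower C D D] [IsScalarTower k C D] : IsScalarTower k D (DualBimodule C D) :=
  ⟨fun a e f => ext fun x => by
    rw [smul_apply, scalar_smul_apply, smul_apply, mul_smul_comm, ← algebraMap_smul C, map_smul,
      algebraMap_smul]⟩

end DualBimodule

variable {k : Type v} [Field k] {C D : Type u} [DivisionRing C] [Algebra k C] [DivisionRing D]
  [Algebra k D] [Module C D] [IsScalarTower C D D] [IsScalarTower k C D]

instance : SMulCommClass C Dᵐᵒᵖ D := ⟨fun a b y => (smul_mul_assoc a y b.unop).symm⟩

variable (k C D) in
/-- The right action of the enveloping algebra of `D` on `D ⊗ Hom_C(D, C)`. -/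
noncomputable abbrev dualAction :
    (EnvAlg k D)ᵐᵒᵖ →+* Module.End (EnvAlg k C) (BiTensor k D (DualBimodule C D)) :=
  biTensorAction k D (DualBimodule C D) D C

/-- The map `(p ⊗ ξ) ↦ θ(p) ⊗ ξ(1)`. -/
noncomputable def dualEval (θ : DualBimodule C D) : Coind (dualAction k C D) (EnvAlg k C) :=
  Coind.ofLinearMap _ <| BiTensor.lift
    (AddMonoidHom.mk' (fun p : D => AddMonoidHom.mk' (fun ξ : DualBimodule C D =>
      (θ p ⊗ₜ[k] op (ξ 1) : EnvAlg k C))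
      (fun x y => by rw [← TensorProduct.tmul_add]; rfl))
      (fun p q => AddMonoidHom.ext fun ξ => by
        change (θ (p + q) ⊗ₜ[k] op (ξ 1) : EnvAlg k C) = θ p ⊗ₜ op (ξ 1) + θ q ⊗ₜ op (ξ 1)
        rw [map_add, TensorProduct.add_tmul]))
    (fun c x y => by
      change (θ (c • x) ⊗ₜ[k] op (y 1) : EnvAlg k C) = θ x ⊗ₜ op (c • y 1)
      rw [← algebraMap_smul C, map_smul, algebraMap_smul, TensorProduct.smul_tmul, op_smul])
    (fun s t x y => by
      change (θ (s • x) ⊗ₜ[k] op (y 1 * t.unop) : EnvAlg k C) = s ⊗ₜ t * (θ x ⊗ₜ op (y 1))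
      rw [map_smul, Algebra.TensorProduct.tmul_mul_tmul]
      rfl)

variable (k) in
/-- The additive map `c ⊗ c' ↦ ϖ(η c) ⊗ c' e`. -/
noncomputable def dualPairing (ϖ : DualBimodule C D →ₗ[D] D) (η : DualBimodule C D) (e : D) :
    EnvAlg k C →ₗ[k] EnvAlg k D :=
  TensorProduct.map
    { toFun := fun c => ϖ (op c • η)
      map_add' := fun x y => by rw [MulOpposite.op_add, add_smul, map_add]
      map_smul' := fun c x => by
        rw [op_smul, smul_assoc, ← algebraMap_smul D, map_smul, algebraMap_smul]; rfl }
    { toFun := fun c => op (c.unop • e)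
      map_add' := fun x y => by rw [MulOpposite.unop_add, add_smul, MulOpposite.op_add]
      map_smul' := fun c x => by rw [unop_smul, smul_assoc, op_smul]; rfl }

theorem dualPairing_tmul (ϖ : DualBimodule C D →ₗ[D] D) (η : DualBimodule C D) (e : D) (c : C)
    (c' : Cᵐᵒᵖ) : dualPairing k ϖ η e (c ⊗ₜ c') = ϖ (op c • η) ⊗ₜ op (c'.unop • e) := rfl

variable {ι : Type} [Fintype ι] (v : Module.Basis ι C D)

/-- The coordinates of a basis. -/
noncomputable def dualCoord (i : ι) : DualBimodule C D := v.coord i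

omit [IsScalarTower C D D] in
theorem sum_dualCoord_smul (x : D) : ∑ i, dualCoord v i x • v i = x := v.sum_repr x

omit [IsScalarTower C D D] in
theorem sum_op_smul_dualCoord (η : DualBimodule C D) : ∑ i, op (η (v i)) • dualCoord v i = η := by
  ext x
  rw [DualBimodule.sum_apply]
  conv_rhs => rw [← sum_dualCoord_smul v x, map_sum]
  exact Finset.sum_congr rfl fun i _ => (map_smul η _ _).symm

variable (ϖ : DualBimodule C D →ₗ[D] D)

/-- Left D-linearity of the retraction in the first factor: the scalars η_l(v_j a) are the
coordinates of a • η_l in the dual basis η_j. -/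
theorem sum_dualPairing_left (e a : D) (l : ι) (x : EnvAlg k C) :
    ∑ j, dualPairing k ϖ (dualCoord v j) e ((dualCoord v l (v j * a) ⊗ₜ 1) * x) =
      (a ⊗ₜ 1) * dualPairing k ϖ (dualCoord v l) e x := by
  induction x using TensorProduct.induction_on with
  | zero => simp
  | add x y hx hy => simp only [mul_add, map_add, Finset.sum_add_distrib, hx, hy]
  | tmul c c' =>
    simp only [Algebra.TensorProduct.tmul_mul_tmul, dualPairing_tmul, one_mul]
    rw [← TensorProduct.sum_tmul, ← map_sum]
    congr 1
    rw [← smul_eq_mul, ← map_smul]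
    congr 1
    rw [← sum_op_smul_dualCoord v (a • op c • dualCoord v l)]
    rfl

/-- The counterpart for the second factor: the scalars are the coordinates of v_m b in the basis
v_i. -/
theorem sum_dualPairing_right (η : DualBimodule C D) (b : D) (m : ι) (x : EnvAlg k C) :
    ∑ i, dualPairing k ϖ η (v i) ((1 ⊗ₜ op (dualCoord v i (v m * b))) * x) =
      (1 ⊗ₜ op b) * dualPairing k ϖ η (v m) x := by
  induction x using TensorProduct.induction_on with
  | zero => simp
  | add x y hx hy => simp only [mul_add, map_add, Finset.sum_add_distrib, hx, hy]
  | tmul c c' =>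
    simp only [Algebra.TensorProduct.tmul_mul_tmul, dualPairing_tmul, one_mul]
    rw [← TensorProduct.tmul_sum]
    congr 1
    rw [← op_mul, smul_mul_assoc, ← Finset.op_sum]
    congr 1
    simp only [unop_mul, unop_op, mul_smul]
    rw [← Finset.smul_sum, sum_dualCoord_smul]

theorem Coind.apply_smul_left (f : Coind (dualAction k C D) (EnvAlg k C)) (x a : D)
    (ξ : DualBimodule C D) : f (BiTensor.tmul k (x * a) ξ) =
      ∑ l, (dualCoord v l (x * a) ⊗ₜ 1) * f (BiTensor.tmul k (v l) ξ) := by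
  conv_lhs => rw [← sum_dualCoord_smul v (x * a)]
  simp only [← smul_eq_mul, ← map_smul, BiTensor.tmul_smul_tmul, one_smul]
  rw [← map_sum]
  exact congrArg f (TensorProduct.sum_tmul _ _ _)

theorem Coind.apply_smul_right (f : Coind (dualAction k C D) (EnvAlg k C)) (x : D)
    (ξ : DualBimodule C D) : f (BiTensor.tmul k x ξ) =
      ∑ m, (1 ⊗ₜ op (ξ (v m))) * f (BiTensor.tmul k x (dualCoord v m)) := by
  conv_lhs => rw [← sum_op_smul_dualCoord v ξ]
  simp only [← smul_eq_mul, ← map_smul, BiTensor.tmul_smul_tmul, one_smul]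
  rw [← map_sum]
  exact congrArg f (TensorProduct.tmul_sum _ _ _)

/-- The retraction of `Hom_{C ⊗ C°}(D ⊗ Hom_C(D, C), C ⊗ C°)` onto `D ⊗ D°`. -/
noncomputable def dualRetraction : Coind (dualAction k C D) (EnvAlg k C) →ₗ[EnvAlg k D] EnvAlg k D :=
  -- The coinduced module is Hom_C(D, C) ⊗ D: the function f corresponds to the sum of (η_j c) ⊗ (c'
  -- v_i), where f(v_j ⊗ η_i) = c ⊗ c'. Applying ϖ to the first factor gives the formula.
  let r : Coind (dualAction k C D) (EnvAlg k C) →+ EnvAlg k D :=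
    AddMonoidHom.mk' (fun f => ∑ i, ∑ j, dualPairing k ϖ (dualCoord v j) (v i)
      (f (BiTensor.tmul k (v j) (dualCoord v i))))
      (fun f g => by simp only [Coind.add_apply, map_add, Finset.sum_add_distrib])
  { r with
    map_smul' := env_induction r fun a b f => by
      change ∑ i, ∑ j, dualPairing k ϖ (dualCoord v j) (v i)
        (f (biTensorAction k D (DualBimodule C D) D C (op (a ⊗ₜ b))
          (BiTensor.tmul k (v j) (dualCoord v i)))) = (a ⊗ₜ b) * ∑ i, ∑ j, dualPairing k ϖ
            (dualCoord v j) (v i) (f (BiTensor.tmul k (v j) (dualCoord v i)))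
      have hab : (a ⊗ₜ b : EnvAlg k D) = (a ⊗ₜ 1) * (1 ⊗ₜ b) := by
        rw [Algebra.TensorProduct.tmul_mul_tmul, one_mul, mul_one]
      simp only [biTensorAction_tmul]
      have h1 : ∀ i j, f (BiTensor.tmul k (op a • v j) (b.unop • dualCoord v i)) =
          ∑ l, (dualCoord v l (v j * a) ⊗ₜ 1) *
            f (BiTensor.tmul k (v l) (b.unop • dualCoord v i)) :=
        fun i j => Coind.apply_smul_left v f (v j) a _
      simp only [h1, map_sum]
      have h2 : ∀ i, ∑ j, ∑ l, dualPairing k ϖ (dualCoord v j) (v i)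
          ((dualCoord v l (v j * a) ⊗ₜ 1) *
            f (BiTensor.tmul k (v l) (b.unop • dualCoord v i))) =
          (a ⊗ₜ 1) * ∑ l, dualPairing k ϖ (dualCoord v l) (v i)
            (f (BiTensor.tmul k (v l) (b.unop • dualCoord v i))) := fun i => by
        rw [Finset.sum_comm, Finset.mul_sum]
        exact Finset.sum_congr rfl fun l _ => sum_dualPairing_left v ϖ _ _ _ _
      simp only [h2]
      rw [← Finset.mul_sum, hab, mul_assoc]
      congr 1
      rw [Finset.sum_comm, Finset.sum_comm (s := Finset.univ) (t := Finset.univ)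
        (f := fun i j => dualPairing k ϖ (dualCoord v j) (v i)
          (f (BiTensor.tmul k (v j) (dualCoord v i)))), Finset.mul_sum]
      refine Finset.sum_congr rfl fun j _ => ?_
      have h3 : ∀ i, f (BiTensor.tmul k (v j) (b.unop • dualCoord v i)) =
          ∑ m, (1 ⊗ₜ op (dualCoord v i (v m * b.unop))) *
            f (BiTensor.tmul k (v j) (dualCoord v m)) :=
        fun i => Coind.apply_smul_right v f (v j) _
      simp only [h3, map_sum]
      rw [Finset.sum_comm, Finset.mul_sum]
      exact Finset.sum_congr rfl fun m _ => sum_dualPairing_right v ϖ _ _ _ _ }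

/-- The dual basis identities for θ and for 1 collapse the double sum to ϖ(θ) ⊗ 1. -/
theorem dualRetraction_dualEval (θ : DualBimodule C D) (h : ϖ θ = 1) :
    dualRetraction v ϖ (dualEval (k := k) θ) = 1 := by
  change ∑ i, ∑ j, dualPairing k ϖ (dualCoord v j) (v i)
    (θ (v j) ⊗ₜ op (dualCoord v i 1)) = 1
  simp only [dualPairing_tmul, ← TensorProduct.sum_tmul, ← map_sum, sum_op_smul_dualCoord, h]
  simp only [← TensorProduct.tmul_sum, ← Finset.op_sum, unop_op, sum_dualCoord_smul]
  rfl

variable (k C D) in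
/-- The homological transcendence degree does not grow in extensions of finite left dimension. -/
theorem htr_le_of_finite [Module.Finite C D] : htr k D ≤ htr k C := by
  refine htr_le_htr fun n h => ?_
  have h1 : InjDimLT (EnvAlg k D) (Coind (dualAction k C D) (EnvAlg k C)) (n + 1) :=
    Coind.injDimLT (biTensorAction_rightFlat k D C) h
  let v := Module.finBasis C D
  have hne : Nonempty (Fin (Module.finrank C D)) := ⟨⟨0, Module.finrank_pos⟩⟩
  let i₀ := hne.some
  let θ : DualBimodule C D := dualCoord v i₀
  have hθ : θ ≠ 0 := by
    intro h0
    have : θ (v i₀) = 0 := by rw [h0]; rfl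
    have h2 : θ (v i₀) = 1 := by
      change v.repr (v i₀) i₀ = 1
      simp
    exact one_ne_zero (h2.symm.trans this)
  -- Hom_C(D, C) is a nonzero left D-vector space, so the line Dθ is a direct summand; ϖ is the
  -- projection to it, normalized by ϖ(θ) = 1.
  obtain ⟨ϖ, hϖ⟩ := LinearMap.exists_leftInverse_of_injective
    (LinearMap.toSpanSingleton D (DualBimodule C D) θ)
    (LinearMap.ker_eq_bot.2 fun a b hab => smul_left_injective D hθ hab)
  have hϖ1 : ϖ θ = 1 := by
    have := LinearMap.congr_fun hϖ 1
    simpa using this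
  refine h1.of_retract (LinearMap.toSpanSingleton (EnvAlg k D) _ (dualEval θ))
    (dualRetraction v ϖ) fun x => ?_
  rw [LinearMap.toSpanSingleton_apply, map_smul, dualRetraction_dualEval v ϖ θ hϖ1, smul_eq_mul,
    mul_one]

end FiniteExtension

/-! ### Parts (a) and (b) for division subalgebras -/

section DivisionSubalgebra

variable {k : Type v} {D : Type u} [Field k] [DivisionRing D] [Algebra k D]

/-- A subalgebra closed under inversion is a division ring. -/
@[reducible]
def Subalgebra.divisionRing (C : Subalgebra k D) (hC : ∀ x ∈ C, x⁻¹ ∈ C) : DivisionRing C where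
  __ := (inferInstance : Ring C)
  inv x := ⟨(x : D)⁻¹, hC _ x.2⟩
  exists_pair_ne := ⟨0, 1, fun h => zero_ne_one (congrArg Subtype.val h)⟩
  mul_inv_cancel x hx := Subtype.ext (mul_inv_cancel₀ fun h => hx (Subtype.ext h))
  inv_zero := Subtype.ext inv_zero
  nnqsmul := _
  nnqsmul_def := fun _ _ => rfl
  qsmul := _
  qsmul_def := fun _ _ => rfl

theorem Subalgebra.htr_le (C : Subalgebra k D) (hC : ∀ x ∈ C, x⁻¹ ∈ C) : htr k C ≤ htr k D :=
  let _ := C.divisionRing hC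
  htr_le_of_algHom C.val

theorem Subalgebra.htr_le_of_finite (C : Subalgebra k D) (hC : ∀ x ∈ C, x⁻¹ ∈ C)
    (h : Module.Finite C D) : htr k D ≤ htr k C :=
  let _ := C.divisionRing hC
  _root_.htr_le_of_finite k C D

theorem Subalgebra.htr_eq_of_finite (C : Subalgebra k D) (hC : ∀ x ∈ C, x⁻¹ ∈ C)
    (h : Module.Finite C D ∨ Module.Finite C.op Dᵐᵒᵖ) : htr k C = htr k D := by
  refine le_antisymm (C.htr_le hC) ?_
  rcases h with h | h
  · exact C.htr_le_of_finite hC h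
  -- A finite right extension is a finite left extension of opposite algebras, and htr does not
  -- change on passing to opposites.
  · have h1 := C.op.htr_le_of_finite (fun x hx => hC _ hx) h
    have e : C.op ≃ₐ[k] (C)ᵐᵒᵖ :=
      { toFun := fun x => op ⟨unop x.1, x.2⟩
        invFun := fun x => ⟨op x.unop.1, x.unop.2⟩
        left_inv := fun _ => rfl
        right_inv := fun _ => rfl
        map_mul' := fun _ _ => rfl
        map_add' := fun _ _ => rfl
        commutes' := fun _ => rfl }
    rwa [htr_congr e, ← htr_op, ← htr_op] at h1

end DivisionSubalgebra

/-! ### Noetherian rings: htr equals the projective dimension of the bimodule -/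

section NoetherianProjDim

variable {A : Type u} [Ring A] [IsNoetherianRing A]

omit [IsNoetherianRing A] in
theorem exists_finite_free_ses (M : Type u) [AddCommGroup M] [Module A M] [Module.Finite A M] :
    ∃ (n : ℕ) (K : Submodule A (Fin n → A)) (g : (Fin n → A) →ₗ[A] M), IsSES A K.subtype g := by
  obtain ⟨n, g, hg⟩ := Module.Finite.exists_fin' A M
  exact ⟨n, LinearMap.ker g, g, Submodule.injective_subtype _,
    LinearMap.exact_subtype_ker_map g, hg⟩

omit [IsNoetherianRing A] in
theorem IsSES.projective_of_leftInverse {M₁ M₂ M₃ : Type u} [AddCommGroup M₁] [Module A M₁]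
    [AddCommGroup M₂] [Module A M₂] [AddCommGroup M₃] [Module A M₃] {f : M₁ →ₗ[A] M₂}
    {g : M₂ →ₗ[A] M₃} (h : IsSES A f g) [Module.Projective A M₂] (l : M₂ →ₗ[A] M₁)
    (hl : l ∘ₗ f = LinearMap.id) : Module.Projective A M₃ := by
  obtain ⟨s, hs⟩ := (((h.exact.split_tfae').out 1 0 :).1 ⟨h.surj, l, hl⟩).2
  exact Module.Projective.of_split s g hs

/-- Over a noetherian ring, the vanishing of the top `Ext` with values in the ring lowers the
projective dimension of a finitely generated module of finite projective dimension. -/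
theorem ProjDimLT.of_extZero_self {M : Type u} [AddCommGroup M] [Module A M] [Module.Finite A M]
    {d : ℕ} (h : ProjDimLT A M (d + 2)) (h' : ExtZero A M A (d + 1)) : ProjDimLT A M (d + 1) := by
  induction d generalizing M with
  | zero =>
    obtain ⟨n, K, g, hs⟩ := exists_finite_free_ses (A := A) M
    have hK : Module.Projective A K :=
      projDimLT_one_iff.1 ((hs.projDimLT_iff inferInstance 0).2 h)
    obtain ⟨m, q, hq⟩ := Module.Finite.exists_fin' A K
    obtain ⟨i, hi⟩ := Module.projective_lifting_property q LinearMap.id hq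
    -- K is a summand of A^m through `i`. Each component of `i` extends to A^n because Ext¹(M, A) =
    -- 0; composing with `q` retracts A^n onto K, so M is a summand of a free module.
    have hext : ∀ j, ∃ ψ : (Fin n → A) →ₗ[A] A, ψ ∘ₗ K.subtype = LinearMap.proj j ∘ₗ i :=
      fun j => hs.exists_extension h' _
    choose ψ hψ using hext
    refine projDimLT_one_iff.2 (hs.projective_of_leftInverse (q ∘ₗ LinearMap.pi ψ) ?_)
    have : LinearMap.pi ψ ∘ₗ K.subtype = i := by
      ext x j
      exact LinearMap.congr_fun (hψ j) x
    rw [LinearMap.comp_assoc, this, hi]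
  | succ d ih =>
    obtain ⟨n, K, g, hs⟩ := exists_finite_free_ses (A := A) M
    refine (hs.projDimLT_iff inferInstance d).1 (ih ((hs.projDimLT_iff inferInstance _).2 h) ?_)
    exact hs.extZero_left_contra (extZero_of_projective d) h'

end NoetherianProjDim

section HtrEq

variable {k : Type v} [Field k] {C : Type u} [DivisionRing C] [Algebra k C]

instance envModule_finite : Module.Finite (EnvAlg k C) C :=
  ⟨⟨{1}, by
    rw [eq_top_iff]
    intro c _
    have : c = (c ⊗ₜ[k] 1 : EnvAlg k C) • (1 : C) := by rw [env_smul]; simp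
    rw [this]
    exact Submodule.smul_mem _ _ (Submodule.subset_span (by simp))⟩⟩

theorem not_projDimLT_env_zero : ¬ ProjDimLT (EnvAlg k C) C 0 := by
  intro h
  have := (hasProjectiveDimensionLT_zero_iff_isZero _).1 h
  exact not_subsingleton C (ModuleCat.subsingleton_of_isZero this)

/-- If the enveloping algebra is noetherian, the homological transcendence degree is the projective
dimension of the algebra as a bimodule, provided the latter is finite. -/
theorem htr_eq_of_projDimLT [IsNoetherianRing (EnvAlg k C)] {d : ℕ}
    (h : ProjDimLT (EnvAlg k C) C (d + 1)) (h' : ¬ ProjDimLT (EnvAlg k C) C d) :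
    htr k C = d := by
  refine le_antisymm (htr_le_of_projDimLT h) ?_
  cases d with
  | zero =>
    have := htr_ne_bot (k := k) C
    generalize htr k C = x at *
    induction x with
    | bot => exact absurd rfl this
    | coe x => exact WithBot.coe_le_coe.2 bot_le
  | succ d =>
    by_contra hlt
    have hle : htr k C ≤ d := by
      have h2 := htr_ne_bot (k := k) C
      generalize htr k C = x at *
      induction x with
      | bot => exact absurd rfl h2
      | coe x =>
        have hx : ¬ (((d + 1 : ℕ) : ℕ∞) ≤ x) := fun hle => hlt (WithBot.coe_le_coe.2 hle)
        refine WithBot.coe_le_coe.2 ?_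
        exact ENat.lt_natCast_add_one_iff.1 (by simpa using hx)
    -- A smaller injective dimension would kill the top Ext of C into C^e and so lower the
    -- projective dimension.
    exact h' (h.of_extZero_self (extZero_of_injDimLT ((htr_le_iff C d).1 hle)))

end HtrEq

open SkewMonoidAlgebra (of single)

/-! ### Skew group algebras and induced modules -/

section SkewModules

section Monoid

variable {A : Type*} [Ring A] {Γ : Type*} [Monoid Γ] [MulSemiringAction Γ A]

/-- A semilinear action of a monoid on a module makes it a module over the skew monoid algebra. -/
@[reducible]
noncomputable def SkewMonoidAlgebra.moduleOfAction {V : Type*} [AddCommGroup V] [Module A V]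
    (ψ : Γ →* AddMonoid.End V)
    (h : ∀ (g : Γ) (a : A) (v : V), ψ g (a • v) = (g • a) • ψ g v) :
    Module (SkewMonoidAlgebra A Γ) V :=
  Module.compHom V (SkewMonoidAlgebra.liftNCRingHom (Module.toAddMonoidEnd A V) ψ
    fun {x y} => by
      ext v
      exact (h y x v).symm)

theorem SkewMonoidAlgebra.moduleOfAction_single_smul {V : Type*} [AddCommGroup V] [Module A V]
    (ψ : Γ →* AddMonoid.End V)
    (h : ∀ (g : Γ) (a : A) (v : V), ψ g (a • v) = (g • a) • ψ g v) (g : Γ) (a : A) (v : V) :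
    letI := SkewMonoidAlgebra.moduleOfAction ψ h
    (single g a) • v = a • ψ g v := by
  change (SkewMonoidAlgebra.liftNC (Module.toAddMonoidEnd A V : A →+ AddMonoid.End V) ψ
    (single g a) : AddMonoid.End V) v = _
  rw [SkewMonoidAlgebra.liftNC_single]
  rfl

theorem SkewMonoidAlgebra.moduleOfAction_isScalarTower {V : Type*} [AddCommGroup V] [Module A V]
    (ψ : Γ →* AddMonoid.End V)
    (h : ∀ (g : Γ) (a : A) (v : V), ψ g (a • v) = (g • a) • ψ g v) :
    letI := SkewMonoidAlgebra.moduleOfAction ψ h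
    IsScalarTower A (SkewMonoidAlgebra A Γ) V := by
  let _ := SkewMonoidAlgebra.moduleOfAction ψ h
  refine ⟨fun a x v => ?_⟩
  induction x using SkewMonoidAlgebra.induction_on with
  | zero => rw [smul_zero, zero_smul, smul_zero]
  | add x y hx hy => rw [smul_add, add_smul, hx, hy, add_smul, smul_add]
  | single g b =>
    rw [SkewMonoidAlgebra.smul_single, moduleOfAction_single_smul ψ h,
      moduleOfAction_single_smul ψ h, smul_eq_mul, mul_smul]

end Monoid

variable {A : Type u} [Ring A] {Γ : Type} [Group Γ] [MulSemiringAction Γ A]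

section

variable {V W : Type*} [AddCommGroup V] [Module A V] [Module (SkewMonoidAlgebra A Γ) V]
  [IsScalarTower A (SkewMonoidAlgebra A Γ) V] [AddCommGroup W] [Module A W]
  [Module (SkewMonoidAlgebra A Γ) W] [IsScalarTower A (SkewMonoidAlgebra A Γ) W]

theorem SkewMonoidAlgebra.single_smul (g : Γ) (a : A) (v : V) :
    (single g a : SkewMonoidAlgebra A Γ) • v = a • of A Γ g • v := by
  rw [← SkewMonoidAlgebra.smul_of, smul_assoc]

theorem SkewMonoidAlgebra.of_smul_smul (g : Γ) (a : A) (v : V) :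
    of A Γ g • a • v = (g • a) • of A Γ g • v := by
  have : a • v = (single 1 a : SkewMonoidAlgebra A Γ) • v := by
    rw [single_smul, map_one, one_smul]
  rw [this, ← mul_smul, SkewMonoidAlgebra.of_apply, SkewMonoidAlgebra.single_mul_single, mul_one,
    one_mul, single_smul]
  rfl

omit [Module A V] [IsScalarTower A (SkewMonoidAlgebra A Γ) V] in
theorem SkewMonoidAlgebra.of_smul_of_smul (g h : Γ) (v : V) :
    of A Γ g • of A Γ h • v = of A Γ (g * h) • v := by
  rw [← mul_smul, map_mul]

/-- Linearity over a skew group algebra. -/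
def SkewMonoidAlgebra.linearMap (f : V →ₗ[A] W) (hf : ∀ g v, f (of A Γ g • v) = of A Γ g • f v) :
    V →ₗ[SkewMonoidAlgebra A Γ] W where
  toFun := f
  map_add' := map_add f
  map_smul' x v := by
    rw [RingHom.id_apply]
    induction x using SkewMonoidAlgebra.induction_on with
    | zero => rw [zero_smul, zero_smul, map_zero]
    | add x y hx hy => rw [add_smul, map_add, hx, hy, add_smul]
    | single g a => rw [single_smul, single_smul, map_smul, hf]

/-- The underlying linear map over the coefficient ring. -/
noncomputable def SkewMonoidAlgebra.coeffLinearMap (f : V →ₗ[SkewMonoidAlgebra A Γ] W) : V →ₗ[A] W where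
  toFun := f
  map_add' := map_add f
  map_smul' a v := by
    have h : ∀ (U : Type _) [AddCommGroup U] [Module A U] [Module (SkewMonoidAlgebra A Γ) U]
        [IsScalarTower A (SkewMonoidAlgebra A Γ) U] (u : U),
        a • u = (single 1 a : SkewMonoidAlgebra A Γ) • u := fun U _ _ _ _ u => by
      rw [single_smul, map_one, one_smul]
    rw [h V v, map_smul, RingHom.id_apply, single_smul, map_one, one_smul]

end

variable (A) in
theorem SkewMonoidAlgebra.exists_coeffModule (N : Type u) [AddCommGroup N]
    [Module (SkewMonoidAlgebra A Γ) N] :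
    ∃ _ : Module A N, IsScalarTower A (SkewMonoidAlgebra A Γ) N := by
  let _ : Module A N := Module.compHom N
    (SkewMonoidAlgebra.singleOneRingHom : A →+* SkewMonoidAlgebra A Γ)
  have hN : ∀ (a : A) (x : N), a • x = (single 1 a : SkewMonoidAlgebra A Γ) • x :=
    fun _ _ => rfl
  refine ⟨inferInstance, ⟨fun a x n => ?_⟩⟩
  rw [hN, ← mul_smul]
  congr 1
  induction x using SkewMonoidAlgebra.induction_on with
  | zero => simp
  | add x y hx hy => rw [smul_add, hx, hy, mul_add]
  | single g b => rw [SkewMonoidAlgebra.smul_single, SkewMonoidAlgebra.single_mul_single]; simp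

/-- The skew group algebra is right free over its coefficient ring. -/
theorem SkewMonoidAlgebra.isRightFlatHom :
    IsRightFlatHom (SkewMonoidAlgebra.singleOneRingHom : A →+* SkewMonoidAlgebra A Γ) := by
  classical
  intro ι s p b h
  -- The group elements form a right basis: a g = g (g⁻¹ • a), which explains the twist by g⁻¹ in
  -- the coordinates.
  refine ⟨ULift Γ, s.biUnion fun i => (p i).support.map Equiv.ulift.symm.toEmbedding,
    fun g => of A Γ g.down, fun i g => g.down⁻¹ • (p i).coeff g.down, fun i hi => ?_, fun g _ => ?_⟩
  · conv_lhs => rw [← SkewMonoidAlgebra.sum_single (p i)]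
    rw [SkewMonoidAlgebra.sum_def', ← Finset.sum_subset (Finset.subset_biUnion_of_mem
      (fun i => (p i).support.map Equiv.ulift.symm.toEmbedding) hi), Finset.sum_map]
    · refine Finset.sum_congr rfl fun g _ => ?_
      change single g _ = single g 1 * single 1 (g⁻¹ • _)
      rw [SkewMonoidAlgebra.single_mul_single, mul_one, one_mul, smul_inv_smul]
      rfl
    · intro g _ hg
      have : (p i).coeff g.down = 0 := by
        by_contra h0
        exact hg (Finset.mem_map.2 ⟨g.down, SkewMonoidAlgebra.mem_support_iff.2 h0, rfl⟩)
      change single g.down 1 * single 1 (g.down⁻¹ • _) = 0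
      rw [this, smul_zero, SkewMonoidAlgebra.single_zero, mul_zero]
  · have := congrArg (fun z => z.coeff g.down) h
    have hc : ∀ i, (p i * single 1 (b i)).coeff g.down = (p i).coeff g.down * g.down • b i :=
      fun i => by rw [SkewMonoidAlgebra.coeff_mul_single_one]
    have hsum : (∑ i ∈ s, p i * single 1 (b i)).coeff g.down =
        ∑ i ∈ s, (p i).coeff g.down * g.down • b i := by
      simp only [← hc]
      exact _root_.map_sum ((Finsupp.applyAddHom g.down).comp
        (SkewMonoidAlgebra.coeffAddEquiv (k := A) (G := Γ)).toAddMonoidHom) (fun i => p i * single 1 (b i)) s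
    have h0 : ∑ i ∈ s, (p i).coeff g.down * g.down • b i = 0 := hsum.symm.trans this
    have := congrArg (g.down⁻¹ • ·) h0
    simpa [Finset.smul_sum, smul_mul', smul_inv_smul] using this

variable (Γ) in
/-- The module induced from the coefficient ring to the skew group algebra by a module over the
latter, with the diagonal action of the group. -/
def Induced (V : Type u) [AddCommGroup V] : Type u := Γ →₀ V

namespace Induced

section Basic

variable {A : Type u} [Ring A] {Γ : Type} {V : Type u} [AddCommGroup V] [Module A V]

noncomputable instance : AddCommGroup (Induced Γ V) := inferInstanceAs (AddCommGroup (Γ →₀ V))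

noncomputable instance instModule : Module A (Induced Γ V) := inferInstanceAs (Module A (Γ →₀ V))

variable (A) in
/-- The embedding of the component of index `g`. -/
noncomputable def ι (g : Γ) : V →ₗ[A] Induced Γ V := Finsupp.lsingle g

variable (A) in
/-- The projection to the component of index `g`. -/
noncomputable def π (g : Γ) : Induced Γ V →ₗ[A] V := Finsupp.lapply g

theorem π_ι_same (g : Γ) (v : V) : π A g (ι A g v) = v := Finsupp.single_eq_same

theorem π_ι_of_ne {g h : Γ} (hgh : g ≠ h) (v : V) : π A g (ι A h v) = 0 :=
  Finsupp.single_eq_of_ne hgh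

variable (A) in
theorem ext_π {x y : Induced Γ V} (h : ∀ g, π A g x = π A g y) : x = y := Finsupp.ext h

variable (A) in
theorem exists_finset (x : Induced Γ V) : ∃ s : Finset Γ, ∀ g ∉ s, π A g x = 0 :=
  ⟨Finsupp.support x, fun _ hg => Finsupp.notMem_support_iff.1 hg⟩

variable (A V) in
@[elab_as_elim]
theorem induction_on {p : Induced Γ V → Prop} (x : Induced Γ V) (zero : p 0)
    (ι : ∀ g v, p (ι A g v)) (add : ∀ x y, p x → p y → p (x + y)) : p x := by
  induction x using Finsupp.induction_linear with
  | zero => exact zero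
  | add x y hx hy => exact add x y hx hy
  | single g v => exact ι g v

variable (A) in
theorem hom_ext {Z : Type*} [AddCommMonoid Z] {F : Type*} [FunLike F (Induced Γ V) Z]
    [AddMonoidHomClass F (Induced Γ V) Z] {f f' : F} (h : ∀ g v, f (ι A g v) = f' (ι A g v)) :
    f = f' := by
  refine DFunLike.ext _ _ fun x => ?_
  induction x using Induced.induction_on A V with
  | zero => rw [map_zero, map_zero]
  | add x y hx hy => rw [map_add, map_add, hx, hy]
  | ι g v => exact h g v

variable (A) in
/-- Linear maps out of the induced module. -/
noncomputable def lift {Z : Type*} [AddCommGroup Z] [Module A Z] (f : Γ → V →ₗ[A] Z) :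
    Induced Γ V →ₗ[A] Z := Finsupp.lsum ℕ f

@[simp] theorem lift_ι {Z : Type*} [AddCommGroup Z] [Module A Z] (f : Γ → V →ₗ[A] Z) (g : Γ)
    (v : V) : lift A f (ι A g v) = f g v := by
  change Finsupp.lsum ℕ f (Finsupp.single g v) = f g v
  simp

/-- Over a noetherian coefficient ring, induced modules of injective modules are injective over the
coefficient ring. -/
theorem injective [IsNoetherianRing A] (hV : Module.Injective A V) :
    Module.Injective A (Induced Γ V) := by
  classical
  refine Module.Baer.injective fun J f => ?_
  obtain ⟨S, hS⟩ := IsNoetherian.noetherian J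
  -- J is finitely generated, so `f` involves only finitely many components; each of these extends
  -- separately.
  have hfin : ∃ s : Finset Γ, ∀ g ∉ s, ∀ x : J, π A g (f x) = 0 := by
    choose t ht using fun x : J => exists_finset A (f x)
    refine ⟨(Finset.univ : Finset S).biUnion fun x =>
      t ⟨x.1, hS ▸ Submodule.subset_span x.2⟩, fun g hg x => ?_⟩
    have key : ∀ (x : A) (hx : x ∈ Submodule.span A (S : Set A)), π A g (f ⟨x, hS ▸ hx⟩) = 0 := by
      intro x hx
      induction hx using Submodule.span_induction with
      | mem x hx =>
        refine ht _ _ fun hgt => hg (Finset.mem_biUnion.2 ⟨⟨x, hx⟩, Finset.mem_univ _, hgt⟩)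
      | zero => exact (congrArg (fun z => π A g (f z)) rfl).trans (by
          change π A g (f 0) = 0
          rw [map_zero, map_zero])
      | add x y hx hy h1 h2 =>
        have : (⟨x + y, hS ▸ Submodule.add_mem _ hx hy⟩ : J) =
          ⟨x, hS ▸ hx⟩ + ⟨y, hS ▸ hy⟩ := rfl
        rw [this, map_add, map_add, h1, h2, add_zero]
      | smul a x hx h1 =>
        have : (⟨a • x, hS ▸ Submodule.smul_mem _ a hx⟩ : J) = a • ⟨x, hS ▸ hx⟩ := rfl
        rw [this, map_smul, map_smul, h1, smul_zero]
    exact key x.1 (hS ▸ x.2)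
  obtain ⟨s, hs⟩ := hfin
  have hbaer : Module.Baer A V := Module.Baer.of_injective hV
  have h1 : ∀ g, ∃ F : A →ₗ[A] V, ∀ (x : A) (hx : x ∈ J), F x = π A g (f ⟨x, hx⟩) :=
    fun g => hbaer J (π A g ∘ₗ f)
  choose F hF using h1
  refine ⟨∑ g ∈ s, ι A g ∘ₗ F g, fun x hx => ext_π A fun g => ?_⟩
  simp only [LinearMap.sum_apply, LinearMap.comp_apply, map_sum]
  by_cases hg : g ∈ s
  · rw [Finset.sum_eq_single g (fun b _ hb => π_ι_of_ne hb.symm _) (fun h => absurd hg h),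
      π_ι_same, hF _ _ hx]
  · rw [hs g hg, Finset.sum_eq_zero]
    intro b hb
    exact π_ι_of_ne (fun (h : g = b) => hg (h ▸ hb)) _

end Basic

variable {V W : Type u} [AddCommGroup V] [Module A V] [Module (SkewMonoidAlgebra A Γ) V]
  [IsScalarTower A (SkewMonoidAlgebra A Γ) V] [AddCommGroup W] [Module A W]
  [Module (SkewMonoidAlgebra A Γ) W] [IsScalarTower A (SkewMonoidAlgebra A Γ) W]

variable (A) in
/-- The diagonal action of a group element. -/
noncomputable def actionMap (g : Γ) : Induced Γ V →+ Induced Γ V :=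
  Finsupp.liftAddHom fun h => (ι A (V := V) (g * h)).toAddMonoidHom.comp
    (DistribSMul.toAddMonoidHom V (of A Γ g))

omit [IsScalarTower A (SkewMonoidAlgebra A Γ) V] in
theorem actionMap_ι (g h : Γ) (v : V) : actionMap A g (ι A h v) = ι A (g * h) (of A Γ g • v) :=
  Finsupp.liftAddHom_apply_single _ _ _

variable (A) in
/-- The diagonal action of the group. -/
noncomputable def action : Γ →* AddMonoid.End (Induced Γ V) where
  toFun := actionMap A
  map_one' := hom_ext A (f := actionMap A 1) (f' := AddMonoidHom.id _) fun h v => by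
    rw [actionMap_ι, one_mul, map_one, one_smul, AddMonoidHom.id_apply]
  map_mul' g g' := hom_ext A (f := actionMap A (g * g'))
      (f' := (actionMap A g).comp (actionMap A g')) fun h v => by
    rw [AddMonoidHom.comp_apply, actionMap_ι, actionMap_ι, actionMap_ι, map_mul, mul_smul, mul_assoc]

omit [IsScalarTower A (SkewMonoidAlgebra A Γ) V] in
theorem action_ι (g h : Γ) (v : V) : action A g (ι A h v) = ι A (g * h) (of A Γ g • v) :=
  actionMap_ι _ _ _

theorem action_smul (g : Γ) (a : A) (x : Induced Γ V) :
    action A g (a • x) = (g • a) • action A g x := by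
  induction x using Induced.induction_on A V with
  | zero => simp
  | add x y hx hy => simp only [smul_add, map_add, hx, hy]
  | ι h v => rw [← map_smul, action_ι, action_ι, SkewMonoidAlgebra.of_smul_smul, map_smul]

noncomputable instance skewModule : Module (SkewMonoidAlgebra A Γ) (Induced Γ V) :=
  SkewMonoidAlgebra.moduleOfAction (action A) action_smul

instance isScalarTower : IsScalarTower A (SkewMonoidAlgebra A Γ) (Induced Γ V) :=
  SkewMonoidAlgebra.moduleOfAction_isScalarTower (action A) action_smul

theorem of_smul_ι (g h : Γ) (v : V) : of A Γ g • ι A h v = ι A (g * h) (of A Γ g • v) := by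
  rw [← action_ι, SkewMonoidAlgebra.of_apply]
  exact (SkewMonoidAlgebra.moduleOfAction_single_smul (action A) action_smul g 1 _).trans
    (one_smul _ _)

theorem π_of_smul (g h : Γ) (x : Induced Γ V) :
    π A (g * h) (of A Γ g • x) = of A Γ g • π A h x := by
  induction x using Induced.induction_on A V with
  | zero => simp
  | add x y hx hy => simp only [smul_add, map_add, hx, hy]
  | ι h' v =>
    rw [of_smul_ι]
    by_cases hh : h = h'
    · subst hh
      rw [π_ι_same, π_ι_same]
    · rw [π_ι_of_ne hh, π_ι_of_ne (fun h => hh (mul_left_cancel h)), smul_zero]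

/-- A linear map from the induced module, equivariant on generators. -/
noncomputable def skewLift (f : Γ → V →ₗ[A] W)
    (hf : ∀ g h v, f (g * h) (of A Γ g • v) = of A Γ g • f h v) :
    Induced Γ V →ₗ[SkewMonoidAlgebra A Γ] W :=
  SkewMonoidAlgebra.linearMap (lift A f) fun g x => by
    induction x using Induced.induction_on A V with
    | zero => simp
    | add x y hx hy => simp only [smul_add, map_add, hx, hy]
    | ι h v => rw [of_smul_ι, lift_ι, lift_ι, hf]

@[simp] theorem skewLift_ι (f : Γ → V →ₗ[A] W)
    (hf : ∀ g h v, f (g * h) (of A Γ g • v) = of A Γ g • f h v) (g : Γ) (v : V) :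
    skewLift f hf (ι A g v) = f g v := lift_ι f g v

/-- Extension of a linear map over the coefficient ring to the induced module. -/
noncomputable def extend (φ : V →ₗ[A] W) : Induced Γ V →ₗ[SkewMonoidAlgebra A Γ] W :=
  skewLift (fun g =>
    { toFun := fun v => of A Γ g • φ (of A Γ g⁻¹ • v)
      map_add' := fun x y => by simp only [smul_add, map_add]
      map_smul' := fun a x => by
        rw [SkewMonoidAlgebra.of_smul_smul, map_smul, SkewMonoidAlgebra.of_smul_smul,
          smul_inv_smul, RingHom.id_apply] }) fun g h v => by
    change of A Γ (g * h) • φ (of A Γ (g * h)⁻¹ • of A Γ g • v) =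
      of A Γ g • of A Γ h • φ (of A Γ h⁻¹ • v)
    rw [SkewMonoidAlgebra.of_smul_of_smul, SkewMonoidAlgebra.of_smul_of_smul, mul_inv_rev,
      inv_mul_cancel_right]

theorem extend_ι (φ : V →ₗ[A] W) (g : Γ) (v : V) :
    extend φ (ι A g v) = of A Γ g • φ (of A Γ g⁻¹ • v) := skewLift_ι _ _ _ _

variable (A Γ V) in
/-- The universal map exhibiting the induced module as a tensor product. -/
noncomputable def unit : V →ₗ[A] Coind (rightMulAction
    (SkewMonoidAlgebra.singleOneRingHom : A →+* SkewMonoidAlgebra A Γ)) (Induced Γ V) :=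
  (coindEquivRestrict _ fun a x => by
    change a • x = (single 1 a : SkewMonoidAlgebra A Γ) • x
    rw [SkewMonoidAlgebra.single_smul, map_one, one_smul]).symm.toLinearMap ∘ₗ ι A 1

theorem unit_apply (v : V) (p : SkewMonoidAlgebra A Γ) : unit A Γ V v p = p • ι A 1 v := rfl

/-- The untwisting isomorphism sends g ⊗ v to `ι A g (g v)`. It identifies extension of scalars from
`A` with the diagonal action on finitely supported functions. -/
theorem isTensor_unit : IsTensor (unit A Γ V) where
  span_eq_top := by
    rw [eq_top_iff]
    intro x _
    induction x using Induced.induction_on A V with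
    | zero => exact Submodule.zero_mem _
    | add x y hx hy => exact Submodule.add_mem _ (hx trivial) (hy trivial)
    | ι g v =>
      refine Submodule.subset_span ⟨of A Γ g⁻¹ • v, of A Γ g, ?_⟩
      rw [unit_apply, of_smul_ι, SkewMonoidAlgebra.of_smul_of_smul, mul_inv_cancel, mul_one, map_one,
        one_smul]
  exists_lift {N} _ _ h := by
    obtain ⟨_, _⟩ := SkewMonoidAlgebra.exists_coeffModule A (Γ := Γ) N
    have hN : ∀ (a : A) (x : N), a • x = (single 1 a : SkewMonoidAlgebra A Γ) • x := fun a x => by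
      rw [SkewMonoidAlgebra.single_smul, map_one, one_smul]
    let e := coindEquivRestrict (SkewMonoidAlgebra.singleOneRingHom : A →+* SkewMonoidAlgebra A Γ)
      (N := N) hN
    refine ⟨extend (e.toLinearMap ∘ₗ h), fun v p => ?_⟩
    rw [unit_apply, map_smul, extend_ι, map_one, inv_one, map_one, one_smul, one_smul]
    change p • (h v) 1 = _
    rw [← map_smul, smul_eq_mul, mul_one]

theorem projDimLT {n : ℕ} (h : ProjDimLT A V (n + 1)) :
    ProjDimLT (SkewMonoidAlgebra A Γ) (Induced Γ V) (n + 1) :=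
  (isTensor_unit (Γ := Γ)).projDimLT SkewMonoidAlgebra.isRightFlatHom h

theorem _root_.ExtZero.of_equiv {R : Type u} [Ring R] {M N N' : Type u} [AddCommGroup M]
    [Module R M] [AddCommGroup N] [Module R N] [AddCommGroup N'] [Module R N'] {n : ℕ}
    (h : ExtZero R M N n) (e : N ≃ₗ[R] N') : ExtZero R M N' n := by
  have : Subsingleton ((Abelian.extFunctorObj (ModuleCat.of R M) n).obj (ModuleCat.of R N)) := h
  exact (((Abelian.extFunctorObj (ModuleCat.of R M) n).mapIso
    e.toModuleIso).addCommGroupIsoToAddEquiv.toEquiv.symm).subsingleton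

theorem extZero {n : ℕ} (h : ExtZero A V W (n + 1)) :
    ExtZero (SkewMonoidAlgebra A Γ) (Induced Γ V) W (n + 1) :=
  (isTensor_unit (Γ := Γ)).extZero SkewMonoidAlgebra.isRightFlatHom <| h.of_equiv
    (coindEquivRestrict _ fun a x => by
      change a • x = (single 1 a : SkewMonoidAlgebra A Γ) • x
      rw [SkewMonoidAlgebra.single_smul, map_one, one_smul]).symm

/-- Functoriality of the induced module. -/
noncomputable def map (f : V →ₗ[SkewMonoidAlgebra A Γ] W) :
    Induced Γ V →ₗ[SkewMonoidAlgebra A Γ] Induced Γ W :=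
  skewLift (fun g => ι A g ∘ₗ SkewMonoidAlgebra.coeffLinearMap f) fun g h v => by
    rw [LinearMap.comp_apply, LinearMap.comp_apply, of_smul_ι]
    exact congrArg _ (map_smul f _ _)

theorem π_map (f : V →ₗ[SkewMonoidAlgebra A Γ] W) (g : Γ) (x : Induced Γ V) :
    π A g (map f x) = f (π A g x) := by
  induction x using Induced.induction_on A V with
  | zero => simp
  | add x y hx hy => simp only [map_add, hx, hy]
  | ι h v =>
    rw [map, skewLift_ι]
    by_cases hh : g = h
    · subst hh
      exact (π_ι_same _ _).trans (congrArg f (π_ι_same _ _).symm)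
    · exact (π_ι_of_ne hh _).trans (by rw [π_ι_of_ne hh, map_zero])

theorem map_ι (f : V →ₗ[SkewMonoidAlgebra A Γ] W) (g : Γ) (v : V) :
    map f (ι A g v) = ι A g (f v) := skewLift_ι _ _ _ _

theorem isSES_map {U : Type u} [AddCommGroup U] [Module A U] [Module (SkewMonoidAlgebra A Γ) U]
    [IsScalarTower A (SkewMonoidAlgebra A Γ) U] {f : U →ₗ[SkewMonoidAlgebra A Γ] V}
    {g : V →ₗ[SkewMonoidAlgebra A Γ] W} (h : IsSES (SkewMonoidAlgebra A Γ) f g) :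
    IsSES (SkewMonoidAlgebra A Γ) (map f) (map g) where
  inj x y hxy := ext_π A fun γ => h.inj (by rw [← π_map, hxy, π_map])
  exact x := by
    constructor
    · intro hx
      have h1 : ∀ γ, ∃ u, f u = π A γ x := fun γ => (h.exact _).1 (by rw [← π_map, hx, map_zero])
      choose u hu using h1
      obtain ⟨s, hs⟩ := exists_finset A x
      classical
      refine ⟨∑ γ ∈ s, ι A γ (u γ), ?_⟩
      rw [map_sum]
      refine ext_π A fun γ => ?_
      simp only [map_ι, map_sum, hu]
      by_cases hγ : γ ∈ s
      · rw [Finset.sum_eq_single γ (fun b _ hb => π_ι_of_ne hb.symm _) (fun h => absurd hγ h),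
          π_ι_same]
      · rw [hs γ hγ, Finset.sum_eq_zero]
        intro b hb
        exact π_ι_of_ne (fun (h : γ = b) => hγ (h ▸ hb)) _
    · rintro ⟨u, rfl⟩
      refine ext_π A fun γ => ?_
      rw [π_map, π_map, map_zero]
      exact (h.exact _).2 ⟨_, rfl⟩
  surj x := by
    induction x using Induced.induction_on A W with
    | zero => exact ⟨0, map_zero _⟩
    | add x y hx hy =>
      obtain ⟨a, rfl⟩ := hx
      obtain ⟨b, rfl⟩ := hy
      exact ⟨a + b, map_add _ _ _⟩
    | ι γ v =>
      obtain ⟨u, rfl⟩ := h.surj v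
      exact ⟨ι A γ u, map_ι _ _ _⟩

end Induced

end SkewModules

/-! ### Decomposing a homomorphism by vanishing of Ext -/

section ExtLift

open Abelian

variable {R : Type u} [Ring R] {M₁ M₂ M₃ N₁ N₂ N₃ : Type u} [AddCommGroup M₁] [Module R M₁]
  [AddCommGroup M₂] [Module R M₂] [AddCommGroup M₃] [Module R M₃] [AddCommGroup N₁] [Module R N₁]
  [AddCommGroup N₂] [Module R N₂] [AddCommGroup N₃] [Module R N₃]
  {f : M₁ →ₗ[R] M₂} {g : M₂ →ₗ[R] M₃} {i : N₁ →ₗ[R] N₂} {q : N₂ →ₗ[R] N₃}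

/-- A homomorphism `M₁ → N₃` is the sum of one extending to `M₂` and one lifting to `N₂`, if
`Ext²(M₃, N₁)` and `Ext¹(M₂, N₂)` vanish. -/
theorem IsSES.exists_extension_add_lift (h : IsSES R f g) (h' : IsSES R i q)
    (h₂ : ExtZero R M₃ N₁ 2) (h₁ : ExtZero R M₂ N₂ 1) (φ : M₁ →ₗ[R] N₃) :
    ∃ (φ' : M₂ →ₗ[R] N₃) (ψ : M₁ →ₗ[R] N₂), φ = φ' ∘ₗ f + q ∘ₗ ψ := by
  -- The pullback along φ of the second extension lies in Ext¹(M₁, N₁) and extends to a class on M₂,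
  -- since Ext²(M₃, N₁) = 0. That class comes from some φ' : M₂ → N₃, since Ext¹(M₂, N₂) = 0.
  obtain ⟨x, hx⟩ := Ext.contravariant_sequence_exact₁ h.shortExact (ModuleCat.of R N₁)
    ((Ext.mk₀ (ModuleCat.ofHom φ)).comp h'.shortExact.extClass (zero_add 1)) (add_comm 1 1)
    (h₂.elim _ _)
  obtain ⟨y, hy⟩ := Ext.covariant_sequence_exact₁ (ModuleCat.of R M₂) h'.shortExact x
    (h₁.elim _ _) (zero_add 1)
  obtain ⟨φ', rfl⟩ := Ext.homEquiv₀.symm.surjective y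
  -- The difference φ - φ' f has zero image under the connecting map, so it lifts to N₂.
  obtain ⟨z, hz⟩ := Ext.covariant_sequence_exact₃ (ModuleCat.of R M₁) h'.shortExact
    (Ext.mk₀ (ModuleCat.ofHom φ) + Ext.mk₀ (-(ModuleCat.ofHom f ≫ φ'))) (zero_add 1) (by
      rw [Ext.mk₀_neg, Ext.add_comp, Ext.neg_comp, ← hx, ← hy, ← sub_eq_add_neg, sub_eq_zero,
        ← Ext.mk₀_comp_mk₀, Ext.comp_assoc_of_second_deg_zero]
      rfl)
  obtain ⟨ψ, rfl⟩ := Ext.homEquiv₀.symm.surjective z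
  refine ⟨φ'.hom, ψ.hom, ?_⟩
  rw [← Ext.mk₀_add] at hz
  have : ψ ≫ ModuleCat.ofHom q = ModuleCat.ofHom φ + -(ModuleCat.ofHom f ≫ φ') :=
    (Ext.mk₀_bijective _ _).1 (by rw [← Ext.mk₀_comp_mk₀]; exact hz)
  have h2 : q ∘ₗ ψ.hom = φ + -(φ'.hom ∘ₗ f) := congrArg ModuleCat.Hom.hom this
  rw [h2]
  abel

end ExtLift

/-! ### Infinite cyclic groups: the shift resolution and the trace -/

section Cyclic

variable {A : Type u} [Ring A]

namespace Induced

section Twist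

variable {Γ : Type} [Group Γ] [MulSemiringAction Γ A]
variable {M V W : Type u} [AddCommGroup M] [Module A M] [Module (SkewMonoidAlgebra A Γ) M]
  [IsScalarTower A (SkewMonoidAlgebra A Γ) M] [AddCommGroup V] [Module A V]
  [Module (SkewMonoidAlgebra A Γ) V] [IsScalarTower A (SkewMonoidAlgebra A Γ) V] [AddCommGroup W]
  [Module A W] [Module (SkewMonoidAlgebra A Γ) W] [IsScalarTower A (SkewMonoidAlgebra A Γ) W]

/-- The conjugate by `g` of the component of index `g` of a linear map. -/
noncomputable def twist (θ : M →ₗ[A] Induced Γ V) (g : Γ) : M →ₗ[A] V where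
  toFun m := of A Γ g⁻¹ • π A g (θ (of A Γ g • m))
  map_add' x y := by simp only [smul_add, map_add]
  map_smul' a x := by
    rw [SkewMonoidAlgebra.of_smul_smul, map_smul, map_smul, SkewMonoidAlgebra.of_smul_smul,
      inv_smul_smul, RingHom.id_apply]

theorem twist_apply (θ : M →ₗ[A] Induced Γ V) (g : Γ) (m : M) :
    twist θ g m = of A Γ g⁻¹ • π A g (θ (of A Γ g • m)) := rfl

theorem exists_finset_twist [Module.Finite A M] (θ : M →ₗ[A] Induced Γ V) :
    ∃ s : Finset Γ, ∀ g ∉ s, twist θ g = 0 := by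
  classical
  obtain ⟨S, hS⟩ := Module.Finite.fg_top (R := A) (M := M)
  choose t ht using fun x : M => exists_finset A (θ x)
  refine ⟨S.biUnion t, fun g hg => ?_⟩
  have h0 : π A g ∘ₗ θ = 0 := by
    refine LinearMap.ext_on hS fun x hx => ht x g fun h => hg (Finset.mem_biUnion.2 ⟨x, hx, h⟩)
  ext m
  have := LinearMap.congr_fun h0 (of A Γ g • m)
  rw [twist_apply]
  exact (congrArg _ this).trans (smul_zero _)

theorem finite_support_twist [Module.Finite A M] (θ : M →ₗ[A] Induced Γ V) (m : M) :
    (Function.support fun g => twist θ g m).Finite := by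
  obtain ⟨s, hs⟩ := exists_finset_twist θ
  refine s.finite_toSet.subset fun g hg => ?_
  by_contra h
  exact hg (by simp only [hs g h, LinearMap.zero_apply])

/-- The sum of the twists is a trace of a map M → Induced V. For a map defined over the skew group
algebra, equivariance turns a change of the starting component into a reindexing of the sum, so the
trace is unchanged. -/
theorem finsum_twist_eq [Module.Finite A M] (Φ : Induced Γ M →ₗ[SkewMonoidAlgebra A Γ] Induced Γ V)
    (t : Γ) (m : M) :
    ∑ᶠ g, twist (SkewMonoidAlgebra.coeffLinearMap Φ ∘ₗ ι A t) g m =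
      ∑ᶠ g, twist (SkewMonoidAlgebra.coeffLinearMap Φ ∘ₗ ι A 1) g m := by
  rw [← finsum_comp_equiv (Equiv.mulLeft t)]
  refine finsum_congr fun g => ?_
  rw [twist_apply, twist_apply, Equiv.coe_mulLeft, LinearMap.comp_apply, LinearMap.comp_apply]
  have : ι A t (of A Γ (t * g) • m) = of A Γ t • ι A 1 (of A Γ g • m) := by
    rw [of_smul_ι, mul_one, SkewMonoidAlgebra.of_smul_of_smul]
  rw [this]
  have h2 : SkewMonoidAlgebra.coeffLinearMap Φ (of A Γ t • ι A 1 (of A Γ g • m)) =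
    of A Γ t • SkewMonoidAlgebra.coeffLinearMap Φ (ι A 1 (of A Γ g • m)) := map_smul Φ _ _
  rw [h2, π_of_smul, SkewMonoidAlgebra.of_smul_of_smul]
  congr 2
  group

theorem finsum_twist_ι (φ : M →ₗ[A] V) (m : M) :
    ∑ᶠ g, twist ((ι A 1 : V →ₗ[A] Induced Γ V) ∘ₗ φ) g m = φ m := by
  rw [finsum_eq_single _ 1 fun g hg => ?_]
  · rw [twist_apply, LinearMap.comp_apply, π_ι_same, inv_one, map_one, one_smul, one_smul]
  · rw [twist_apply, LinearMap.comp_apply, π_ι_of_ne hg, smul_zero]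

/-- Taking traces cancels the two terms in Φ, while `ι A 1 ∘ φ` has trace φ. Finite generation of
`M` makes the traces finite sums. -/
theorem eq_finsum_twist [Module.Finite A M] (φ : M →ₗ[A] V)
    (Φ : Induced Γ M →ₗ[SkewMonoidAlgebra A Γ] Induced Γ V) (ψ : M →ₗ[A] Induced Γ V) (t : Γ)
    (h : ∀ m, ι A 1 (φ m) = Φ (ι A t m) - Φ (ι A 1 m) + ψ m) (m : M) :
    φ m = ∑ᶠ g, twist ψ g m := by
  have h1 : (ι A 1 : V →ₗ[A] Induced Γ V) ∘ₗ φ + SkewMonoidAlgebra.coeffLinearMap Φ ∘ₗ ι A 1 =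
      SkewMonoidAlgebra.coeffLinearMap Φ ∘ₗ ι A t + ψ := by
    ext m
    change ι A 1 (φ m) + Φ (ι A 1 m) = Φ (ι A t m) + ψ m
    rw [h]
    abel
  have hadd : ∀ (θ θ' : M →ₗ[A] Induced Γ V),
      ∑ᶠ g, twist (θ + θ') g m = ∑ᶠ g, twist θ g m + ∑ᶠ g, twist θ' g m := fun θ θ' => by
    rw [← finsum_add_distrib (finite_support_twist θ m) (finite_support_twist θ' m)]
    refine finsum_congr fun g => ?_
    simp only [twist_apply, LinearMap.add_apply, map_add, smul_add]
  have h2 := hadd ((ι A 1 : V →ₗ[A] Induced Γ V) ∘ₗ φ)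
    (SkewMonoidAlgebra.coeffLinearMap Φ ∘ₗ ι A 1)
  rw [h1, hadd, finsum_twist_eq Φ t, finsum_twist_ι, add_comm] at h2
  exact (add_right_cancel h2).symm

-- An injective module over the skew group algebra stays injective over `A`, by flatness; so one
-- embedding serves for both rings.
omit [Module A V] [IsScalarTower A (SkewMonoidAlgebra A Γ) V] in
variable (V) in
theorem _root_.SkewMonoidAlgebra.exists_injective_ses : ∃ (I Q : Type u) (_ : AddCommGroup I)
    (_ : Module (SkewMonoidAlgebra A Γ) I) (_ : Module A I)
    (_ : IsScalarTower A (SkewMonoidAlgebra A Γ) I) (_ : AddCommGroup Q)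
    (_ : Module (SkewMonoidAlgebra A Γ) Q) (_ : Module A Q)
    (_ : IsScalarTower A (SkewMonoidAlgebra A Γ) Q) (i : V →ₗ[SkewMonoidAlgebra A Γ] I)
    (q : I →ₗ[SkewMonoidAlgebra A Γ] Q), Module.Injective A I ∧
    IsSES (SkewMonoidAlgebra A Γ) i q := by
  obtain ⟨I, Q, _, _, _, _, i, q, hI, hs⟩ := _root_.exists_injective_ses (SkewMonoidAlgebra A Γ) V
  obtain ⟨_, _⟩ := SkewMonoidAlgebra.exists_coeffModule A (Γ := Γ) I
  obtain ⟨_, _⟩ := SkewMonoidAlgebra.exists_coeffModule A (Γ := Γ) Q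
  refine ⟨I, Q, _, _, _, inferInstance, _, _, _, inferInstance, i, q, ?_, hs⟩
  refine injDimLT_one_iff.1 (InjDimLT.restrict (B := SkewMonoidAlgebra A Γ)
    SkewMonoidAlgebra.isRightFlatHom (fun a x => ?_) (injDimLT_one_iff.2 hI))
  change a • x = (single 1 a : SkewMonoidAlgebra A Γ) • x
  rw [SkewMonoidAlgebra.single_smul, map_one, one_smul]

variable (A M) in
/-- Right translation on the induced module. -/
noncomputable def shift (t : Γ) :
    Induced Γ M →ₗ[SkewMonoidAlgebra A Γ] Induced Γ M :=
  skewLift (fun g => ι A (g * t)) fun g h v => by rw [of_smul_ι, mul_assoc]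

theorem shift_ι (t g : Γ) (m : M) : shift A M t (ι A g m) = ι A (g * t) m := skewLift_ι _ _ _ _

theorem π_shift (t g : Γ) (x : Induced Γ M) : π A (g * t) (shift A M t x) = π A g x := by
  induction x using Induced.induction_on A M with
  | zero => simp
  | add x y hx hy => simp only [map_add, hx, hy]
  | ι h v =>
    rw [shift_ι]
    by_cases hh : g = h
    · subst hh
      rw [π_ι_same, π_ι_same]
    · rw [π_ι_of_ne hh, π_ι_of_ne (fun h => hh (mul_right_cancel h))]

variable (A Γ M) in
/-- The sum of the components. -/
noncomputable def total : Induced Γ M →ₗ[SkewMonoidAlgebra A Γ] M :=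
  skewLift (fun _ => LinearMap.id) fun _ _ _ => rfl

theorem total_ι (g : Γ) (m : M) : total A Γ M (ι A g m) = m := skewLift_ι _ _ _ _

end Twist

variable [MulSemiringAction (Multiplicative ℤ) A]
variable {M V : Type u} [AddCommGroup M] [Module A M]
  [Module (SkewMonoidAlgebra A (Multiplicative ℤ)) M]
  [IsScalarTower A (SkewMonoidAlgebra A (Multiplicative ℤ)) M] [AddCommGroup V] [Module A V]
  [Module (SkewMonoidAlgebra A (Multiplicative ℤ)) V]
  [IsScalarTower A (SkewMonoidAlgebra A (Multiplicative ℤ)) V]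

variable (A M) in
/-- The resolution of a module by induced modules. -/
theorem isSES_shift_sub_one : IsSES (SkewMonoidAlgebra A (Multiplicative ℤ))
    (shift A M (Multiplicative.ofAdd (1 : ℤ)) - LinearMap.id) (total A (Multiplicative ℤ) M) where
  inj := by
    rw [← LinearMap.ker_eq_bot, LinearMap.ker_eq_bot']
    intro x hx
    have hx' : shift A M (Multiplicative.ofAdd (1 : ℤ)) x = x := sub_eq_zero.1 hx
    have h1 : ∀ g, π A (g * Multiplicative.ofAdd (1 : ℤ)) x = π A g x := fun g => by
      conv_lhs => rw [← hx']
      exact π_shift _ _ _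
    -- A shift-invariant element has conjugacy-free constant components, so finite support forces it
    -- to vanish.
    have h2 : ∀ n : ℤ, π A (Multiplicative.ofAdd n) x = π A (Multiplicative.ofAdd 0) x := by
      intro n
      induction n using Int.induction_on with
      | zero => rfl
      | succ n ih => rw [← ih, ← h1 (Multiplicative.ofAdd (n : ℤ))]; rfl
      | pred n ih =>
        rw [← ih, ← h1]
        congr 2
        change (-(n : ℤ) - 1 + 1) = -n
        ring
    obtain ⟨s, hs⟩ := exists_finset A x
    obtain ⟨g, hg⟩ := Infinite.exists_notMem_finset s
    refine ext_π A fun g' => ?_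
    rw [map_zero]
    exact (h2 (Multiplicative.toAdd g')).trans ((h2 (Multiplicative.toAdd g)).symm.trans (hs g hg))
  exact x := by
    constructor
    · intro hx
      -- Modulo the image of shift - 1, every component can be moved to the component of index 1 by
      -- telescoping.
      have key : ∀ (n : ℤ) (m : M), ι A (Multiplicative.ofAdd n) m - ι A 1 m ∈
          LinearMap.range (shift A M (Multiplicative.ofAdd (1 : ℤ)) - LinearMap.id) := by
        intro n m
        have step : ∀ n : ℤ, ι A (Multiplicative.ofAdd (n + 1)) m - ι A (Multiplicative.ofAdd n) m ∈
            LinearMap.range (shift A M (Multiplicative.ofAdd (1 : ℤ)) - LinearMap.id) := by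
          intro n
          refine ⟨ι A (Multiplicative.ofAdd n) m, ?_⟩
          rw [LinearMap.sub_apply, shift_ι]
          rfl
        induction n using Int.induction_on with
        | zero =>
          convert Submodule.zero_mem _
          exact sub_self _
        | succ n ih =>
          have := Submodule.add_mem _ (step n) ih
          rwa [sub_add_sub_cancel] at this
        | pred n ih =>
          have := Submodule.sub_mem _ ih (step (-n - 1))
          rw [sub_add_cancel] at this
          convert this using 1
          abel
      have h2 : ∀ x : Induced (Multiplicative ℤ) M, x - ι A 1 (total A (Multiplicative ℤ) M x) ∈
          LinearMap.range (shift A M (Multiplicative.ofAdd (1 : ℤ)) - LinearMap.id) := by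
        intro x
        induction x using Induced.induction_on A M with
        | zero =>
          rw [map_zero, map_zero, sub_zero]
          exact Submodule.zero_mem _
        | add x y hx hy =>
          have := Submodule.add_mem _ hx hy
          rw [map_add, map_add]
          convert this using 1
          abel
        | ι g m =>
          rw [total_ι]
          exact key (Multiplicative.toAdd g) m
      have := h2 x
      rw [hx, map_zero, sub_zero] at this
      exact this
    · rintro ⟨y, rfl⟩
      rw [LinearMap.sub_apply, map_sub, sub_eq_zero]
      induction y using Induced.induction_on A M with
      | zero => simp
      | add x y hx hy => simp only [map_add, hx, hy]
      | ι g m =>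
        rw [shift_ι, total_ι]
        exact (total_ι _ _).symm
  surj m := ⟨ι A 1 m, total_ι _ _⟩

/-- The projective dimension over the skew Laurent polynomial ring exceeds that over the coefficient
ring at most by one. -/
theorem _root_.ProjDimLT.skewLaurent {n : ℕ} (h : ProjDimLT A M (n + 1)) :
    ProjDimLT (SkewMonoidAlgebra A (Multiplicative ℤ)) M (n + 2) :=
  (isSES_shift_sub_one A M).projDimLT_right (projDimLT h) ((projDimLT h).mono (by lia))

/-- Vanishing of Ext¹ extends the equivariant map induced by `ι A 1 ∘ φ` along shift - 1, that is,
writes it as Φ ∘ (shift - 1); its trace is then zero, and this trace is φ. -/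
theorem eq_zero_of_extZero_one [Module.Finite A M]
    (h : ExtZero (SkewMonoidAlgebra A (Multiplicative ℤ)) M (Induced (Multiplicative ℤ) V) 1)
    (φ : M →ₗ[A] V) : φ = 0 := by
  obtain ⟨Φ, hΦ⟩ := (isSES_shift_sub_one A M).exists_extension h (extend (ι A 1 ∘ₗ φ))
  ext m
  rw [eq_finsum_twist φ Φ 0 (Multiplicative.ofAdd (1 : ℤ)) (fun m => ?_) m]
  · simp [twist_apply]
  · have := LinearMap.congr_fun hΦ (ι A 1 m)
    rw [extend_ι] at this
    simp only [LinearMap.comp_apply, LinearMap.sub_apply, map_sub, shift_ι, inv_one, map_one,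
      one_smul, one_mul] at this
    rw [LinearMap.zero_apply, add_zero, ← this]
    rfl

/-- For φ : M → Q, write the equivariant extension of `ι A 1 ∘ φ` as Φ ∘ (shift - 1) + (map q) ∘ Ψ.
Traces give φ = q ∘ (trace of Ψ), which lifts φ to I. The noetherian hypothesis makes `Induced I`
injective over `A`. -/
theorem extZero_one_of_extZero_two [Module.Finite A M] [IsNoetherianRing A]
    (h : ExtZero (SkewMonoidAlgebra A (Multiplicative ℤ)) M (Induced (Multiplicative ℤ) V) 2)
    {I Q : Type u} [AddCommGroup I] [Module A I]
    [Module (SkewMonoidAlgebra A (Multiplicative ℤ)) I]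
    [IsScalarTower A (SkewMonoidAlgebra A (Multiplicative ℤ)) I] [AddCommGroup Q] [Module A Q]
    [Module (SkewMonoidAlgebra A (Multiplicative ℤ)) Q]
    [IsScalarTower A (SkewMonoidAlgebra A (Multiplicative ℤ)) Q]
    {i : V →ₗ[SkewMonoidAlgebra A (Multiplicative ℤ)] I}
    {q : I →ₗ[SkewMonoidAlgebra A (Multiplicative ℤ)] Q}
    (hs : IsSES (SkewMonoidAlgebra A (Multiplicative ℤ)) i q) (hI : Module.Injective A I) :
    ExtZero A M V 1 := by
  have hs' : IsSES A (SkewMonoidAlgebra.coeffLinearMap i) (SkewMonoidAlgebra.coeffLinearMap q) :=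
    ⟨hs.inj, hs.exact, hs.surj⟩
  refine hs'.extZero_one_of_lift (extZero_of_injective hI 0) fun φ => ?_
  obtain ⟨Φ, Ψ, hΦ⟩ := (isSES_shift_sub_one A M).exists_extension_add_lift (isSES_map hs) h
    (extZero (extZero_of_injective (injective hI) 0)) (extend (ι A 1 ∘ₗ φ))
  obtain ⟨s, hs⟩ := exists_finset_twist (SkewMonoidAlgebra.coeffLinearMap Ψ ∘ₗ ι A 1)
  refine ⟨∑ g ∈ s, twist (SkewMonoidAlgebra.coeffLinearMap Ψ ∘ₗ ι A 1) g, ?_⟩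
  ext m
  rw [eq_finsum_twist φ Φ (SkewMonoidAlgebra.coeffLinearMap (map q) ∘ₗ
    SkewMonoidAlgebra.coeffLinearMap Ψ ∘ₗ ι A 1) (Multiplicative.ofAdd (1 : ℤ)) (fun m => ?_) m]
  · have htw : ∀ g, twist (SkewMonoidAlgebra.coeffLinearMap (map q) ∘ₗ
        SkewMonoidAlgebra.coeffLinearMap Ψ ∘ₗ ι A 1) g m =
        q (twist (SkewMonoidAlgebra.coeffLinearMap Ψ ∘ₗ ι A 1) g m) := fun g => by
      rw [twist_apply, twist_apply]
      refine Eq.trans ?_ (map_smul q _ _).symm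
      exact congrArg (of A (Multiplicative ℤ) g⁻¹ • ·) (π_map q g _)
    rw [finsum_eq_sum_of_support_subset (s := s) _ fun g hg => ?_]
    · rw [LinearMap.comp_apply, LinearMap.sum_apply, map_sum]
      exact Finset.sum_congr rfl fun g _ => (htw g).symm
    · by_contra h0
      refine hg ?_
      simp only [htw, hs g h0, LinearMap.zero_apply, map_zero]
  · have := LinearMap.congr_fun hΦ (ι A 1 m)
    rw [extend_ι] at this
    simp only [LinearMap.comp_apply, LinearMap.sub_apply, map_sub, shift_ι, inv_one, map_one,
      one_smul, one_mul, LinearMap.add_apply] at this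
    rw [this]
    rfl

/-- Vanishing of `Ext` over the skew Laurent polynomial ring with values in an induced module implies
vanishing of `Ext` over the coefficient ring in one degree less. -/
theorem extZero_of_extZero_induced [Module.Finite A M] [IsNoetherianRing A] {d : ℕ}
    (h : ExtZero (SkewMonoidAlgebra A (Multiplicative ℤ)) M (Induced (Multiplicative ℤ) V) (d + 2)) :
    ExtZero A M V (d + 1) := by
  induction d generalizing V with
  | zero =>
    obtain ⟨I, Q, _, _, _, _, _, _, _, _, i, q, hI, hs⟩ :=
      SkewMonoidAlgebra.exists_injective_ses (A := A) (Γ := Multiplicative ℤ) V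
    exact extZero_one_of_extZero_two h hs hI
  | succ d ih =>
    obtain ⟨I, Q, _, _, _, _, _, _, _, _, i, q, hI, hs⟩ :=
      SkewMonoidAlgebra.exists_injective_ses (A := A) (Γ := Multiplicative ℤ) V
    have hs' : IsSES A (SkewMonoidAlgebra.coeffLinearMap i) (SkewMonoidAlgebra.coeffLinearMap q) :=
      ⟨hs.inj, hs.exact, hs.surj⟩
    -- These groups vanish by injectivity of `Induced I` over `A`; the shift resolution then kills
    -- Ext(M, Induced I) in degrees from 2 on, which allows the shift from V to Q.
    have hM : ∀ n, ExtZero (SkewMonoidAlgebra A (Multiplicative ℤ)) (Induced (Multiplicative ℤ) M)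
        (Induced (Multiplicative ℤ) I) (n + 1) :=
      fun n => extZero (extZero_of_injective (injective hI) n)
    exact hs'.extZero_succ (extZero_of_injective hI _) <| ih <| (isSES_map hs).extZero_right
      ((isSES_shift_sub_one A M).extZero_succ_contra (hM (d + 1)) (hM d)) h

end Induced

end Cyclic

/-! ### Skew Laurent series as a divisible torsion-free module over the skew polynomial ring -/

section LaurentExpansion

/-- Sequences indexed by the integers that vanish in sufficiently negative degrees. -/
def laurentSeq (C : Type u) [Ring C] : Submodule C (ℤ → C) where
  carrier := {v | ∃ N, ∀ i < N, v i = 0}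
  zero_mem' := ⟨0, fun _ _ => rfl⟩
  add_mem' := by
    rintro v w ⟨N, hN⟩ ⟨M, hM⟩
    refine ⟨min N M, fun i hi => ?_⟩
    rw [Pi.add_apply, hN i (hi.trans_le (min_le_left _ _)),
      hM i (hi.trans_le (min_le_right _ _)), add_zero]
  smul_mem' := by
    rintro c v ⟨N, hN⟩
    exact ⟨N, fun i hi => by rw [Pi.smul_apply, hN i hi, smul_zero]⟩

/-- The value at j depends only on earlier values, so well-founded recursion produces the sequence.
-/
theorem exists_causal_fixedPoint {C : Type*} [Zero C] (Φ : (ℕ → C) → ℕ → C)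
    (hΦ : ∀ g g' j, (∀ i < j, g i = g' i) → Φ g j = Φ g' j) : ∃ g, ∀ j, g j = Φ g j := by
  classical
  let step : (j : ℕ) → ((i : ℕ) → i < j → C) → C :=
    fun j ih => Φ (fun i => if h : i < j then ih i h else 0) j
  refine ⟨fun j => WellFounded.fix Nat.lt_wfRel.wf step j, fun j => ?_⟩
  refine (WellFounded.fix_eq _ _ _).trans (hΦ _ _ _ fun i hi => ?_)
  rw [dif_pos hi]

variable {C : Type u} [DivisionRing C] (α : C ≃+* C)

/-- The shift of Laurent sequences, twisted by an automorphism. -/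
def laurentShift (n : ℕ) : laurentSeq C →+ laurentSeq C where
  toFun v := ⟨fun i => (α ^ n) (v.1 (i - n)), by
    obtain ⟨N, hN⟩ := v.2
    exact ⟨N + n, fun i hi => (congrArg _ (hN _ (by lia))).trans (map_zero _)⟩⟩
  map_zero' := Subtype.ext (funext fun i => map_zero _)
  map_add' v w := Subtype.ext (funext fun i => map_add _ _ _)

/-- The powers of the twisted shift. -/
def laurentShiftHom : Multiplicative ℕ →* AddMonoid.End (laurentSeq C) where
  toFun n := laurentShift α n.toAdd
  map_one' := by
    refine AddMonoidHom.ext fun v => Subtype.ext (funext fun i => ?_)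
    change (α ^ 0) (v.1 (i - (0 : ℕ))) = v.1 i
    simp
  map_mul' m n := by
    refine AddMonoidHom.ext fun v => Subtype.ext (funext fun i => ?_)
    change (α ^ (m.toAdd + n.toAdd)) (v.1 (i - (m.toAdd + n.toAdd : ℕ))) =
      (α ^ m.toAdd) ((α ^ n.toAdd) (v.1 (i - m.toAdd - n.toAdd)))
    rw [pow_add, Nat.cast_add, sub_sub]
    rfl

variable [MulSemiringAction (Multiplicative ℕ) C]

/-- The Laurent sequences as a module over the skew polynomial ring. -/
@[reducible]
noncomputable def laurentModule (hα : ∀ (n : ℕ) (c : C), Multiplicative.ofAdd n • c = (α ^ n) c) :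
    Module (SkewPolynomial C) (laurentSeq C) :=
  SkewMonoidAlgebra.moduleOfAction (laurentShiftHom α) fun n c v =>
    Subtype.ext (funext fun i => by
      change (α ^ n.toAdd) (c * v.1 (i - n.toAdd)) = (n • c) * (α ^ n.toAdd) (v.1 (i - n.toAdd))
      rw [map_mul]
      exact congrArg (· * _) (hα n.toAdd c).symm)

variable {α} (hα : ∀ (n : ℕ) (c : C), Multiplicative.ofAdd n • c = (α ^ n) c)

include hα

theorem monomial_smul_laurent (n : ℕ) (c : C) (v : laurentSeq C) (i : ℤ) :
    letI := laurentModule α hα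
    ((single (Multiplicative.ofAdd n) c : SkewPolynomial C) • v).1 i =
      c * (α ^ n) (v.1 (i - n)) := by
  let _ := laurentModule α hα
  have h := SkewMonoidAlgebra.moduleOfAction_single_smul (A := C) (laurentShiftHom α)
    (fun n c v => Subtype.ext (funext fun i => by
      change (α ^ n.toAdd) (c * v.1 (i - n.toAdd)) = (n • c) * (α ^ n.toAdd) (v.1 (i - n.toAdd))
      rw [map_mul]
      exact congrArg (· * _) (hα n.toAdd c).symm)) (Multiplicative.ofAdd n) c v
  exact congrFun (congrArg Subtype.val h) i

theorem smul_laurent_apply (s : SkewPolynomial C) (v : laurentSeq C) (i : ℤ) :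
    letI := laurentModule α hα
    (s • v).1 i = ∑ n ∈ s.support, s.coeff n * (α ^ n) (v.1 (i - n)) := by
  let _ := laurentModule α hα
  rw [← SkewPolynomial.sum_def s fun n c => c * (α ^ n) (v.1 (i - n))]
  induction s using SkewMonoidAlgebra.induction_on with
  | zero =>
    rw [zero_smul]
    rfl
  | add s t hs ht =>
    rw [add_smul, SkewPolynomial.sum_add_index _ _ _ (fun n => zero_mul _)
      (fun n _ _ => add_mul _ _ _), ← hs, ← ht]
    rfl
  | single n c =>
    refine (monomial_smul_laurent hα n.toAdd c v i).trans ?_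
    exact (SkewPolynomial.sum_monomial_index (n := n.toAdd) (b := c)
      (h := fun n c => c * (α ^ n) (v.1 (i - n))) (zero_mul _)).symm

omit [MulSemiringAction (Multiplicative ℕ) C] hα in
theorem exists_leading (s : SkewPolynomial C) (hs : s ≠ 0) :
    ∃ m ∈ s.support, ∀ n ∈ s.support, m ≤ n := by
  have : s.support.Nonempty := Finset.nonempty_iff_ne_empty.2 fun h =>
    hs (SkewPolynomial.support_eq_empty.1 h)
  exact ⟨s.support.min' this, Finset.min'_mem _ _, fun n hn => Finset.min'_le _ _ hn⟩

/-- The product of the lowest terms of `s` and of `v` is the only contribution in its degree and is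
nonzero. -/
theorem laurent_smul_eq_zero (s : SkewPolynomial C) (hs : s ≠ 0) (v : laurentSeq C)
    (h : letI := laurentModule α hα; s • v = 0) : v = 0 := by
  let _ := laurentModule α hα
  obtain ⟨m, hm, hmin⟩ := exists_leading s hs
  obtain ⟨N, hN⟩ := v.2
  by_contra hv
  have hex : ∃ i, v.1 i ≠ 0 := by
    by_contra! h0
    exact hv (Subtype.ext (funext h0))
  obtain ⟨j, hj, hleast⟩ := Int.exists_least_of_bdd (P := fun i => v.1 i ≠ 0)
    ⟨N, fun i hi => by
      by_contra! hlt
      exact hi (hN i hlt)⟩ hex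
  have h1 := smul_laurent_apply hα s v (m + j)
  rw [h, Finset.sum_eq_single_of_mem m hm] at h1
  · rw [add_sub_cancel_left] at h1
    have h2 : s.coeff m * (α ^ m) (v.1 j) = 0 := h1.symm
    rcases mul_eq_zero.1 h2 with h3 | h3
    · exact SkewPolynomial.mem_support_iff.1 hm h3
    · exact hj ((map_eq_zero_iff _ (α ^ m).injective).1 h3)
  · intro n hn hne
    have : v.1 (m + j - n) = 0 := by
      by_contra h0
      have := hleast _ h0
      have := hmin n hn
      lia
    rw [this, map_zero, mul_zero]

theorem exists_laurent_smul_eq (s : SkewPolynomial C) (hs : s ≠ 0) (w : laurentSeq C) :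
    ∃ v : laurentSeq C, letI := laurentModule α hα; s • v = w := by
  let _ := laurentModule α hα
  obtain ⟨m, hm, hmin⟩ := exists_leading s hs
  obtain ⟨N, hN⟩ := w.2
  -- A quotient of a series starting in degree N by one of order m starts in degree N - m. The
  -- unknown g j is its coefficient in degree N - m + j, and the equation in degree N + j can be
  -- solved for it, since all other terms involve earlier unknowns.
  let ext : (ℕ → C) → ℤ → C := fun g i => if i < N - m then 0 else g (i - (N - m)).toNat
  obtain ⟨g, hg⟩ := exists_causal_fixedPoint (fun g j => (α ^ m).symm ((s.coeff m)⁻¹ *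
      (w.1 (N + j) - ∑ n ∈ s.support.erase m, s.coeff n * (α ^ n) (ext g (N + j - n)))))
    fun g g' j hgg' => by
      refine congrArg (fun z => (α ^ m).symm ((s.coeff m)⁻¹ * (w.1 (N + j) - z)))
        (Finset.sum_congr rfl fun n hn => congrArg (fun z => s.coeff n * (α ^ n) z) ?_)
      simp only [ext]
      have := hmin n (Finset.mem_of_mem_erase hn)
      have := Finset.ne_of_mem_erase hn
      split_ifs with hlt
      · rfl
      · exact hgg' _ (by lia)
  refine ⟨⟨ext g, N - m, fun i hi => if_pos hi⟩, Subtype.ext (funext fun i => ?_)⟩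
  rw [smul_laurent_apply hα]
  change ∑ n ∈ s.support, s.coeff n * (α ^ n) (ext g (i - n)) = w.1 i
  by_cases hi : i < N
  · rw [hN i hi]
    refine Finset.sum_eq_zero fun n hn => ?_
    have : ext g (i - n) = 0 := if_pos (by have := hmin n hn; lia)
    rw [this, map_zero, mul_zero]
  · obtain ⟨j, rfl⟩ : ∃ j : ℕ, i = N + j := ⟨(i - N).toNat, by lia⟩
    rw [← Finset.add_sum_erase _ _ hm]
    have h1 : ext g (N + j - m) = g j := by
      refine (if_neg (by lia)).trans (congrArg g ?_)
      lia
    have h2 := congrArg (α ^ m) (hg j)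
    rw [RingEquiv.apply_symm_apply] at h2
    rw [h1, h2, mul_inv_cancel_left₀ (SkewPolynomial.mem_support_iff.1 hm)]
    abel

end LaurentExpansion

/-! ### Left fractions and expansion in skew Laurent series -/

section Fractions

variable {R D L : Type*} [Ring R] [DivisionRing D] [AddCommGroup L] [Module R L] {F : R →+* D}

theorem IsQuotientDivisionRing.ne_zero (hF : IsQuotientDivisionRing F) {s : R} (hs : s ≠ 0) :
    F s ≠ 0 := (map_ne_zero_iff F hF.1).2 hs

theorem IsQuotientDivisionRing.exists_mul_eq (hF : IsQuotientDivisionRing F) (d : D) :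
    ∃ s ≠ 0, ∃ a, F s * d = F a := by
  obtain ⟨a, s, hs, rfl⟩ := hF.2 d
  exact ⟨s, hs, a, mul_inv_cancel_left₀ (hF.ne_zero hs) _⟩

theorem IsQuotientDivisionRing.mul_ne_zero (hF : IsQuotientDivisionRing F) {s t : R} (hs : s ≠ 0)
    (ht : t ≠ 0) : s * t ≠ 0 := fun h => by
  have := congrArg F h
  rw [map_mul, map_zero] at this
  exact (_root_.mul_ne_zero (hF.ne_zero hs) (hF.ne_zero ht)) this

/-- The Ore condition, obtained by writing F(t) F(s)⁻¹ as a left fraction. -/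
theorem IsQuotientDivisionRing.exists_mul_eq_mul (hF : IsQuotientDivisionRing F) {s : R}
    (t : R) (hs : s ≠ 0) : ∃ u ≠ 0, ∃ u', u * t = u' * s := by
  obtain ⟨u, hu, u', h⟩ := hF.exists_mul_eq (F t * (F s)⁻¹)
  refine ⟨u, hu, u', hF.1 ?_⟩
  rw [map_mul, map_mul, ← h, mul_assoc, mul_assoc, inv_mul_cancel₀ (hF.ne_zero hs), mul_one]

/-- The quotient division ring maps to every torsion-free divisible module with a marked element. -/
theorem IsQuotientDivisionRing.exists_expansion (hF : IsQuotientDivisionRing F)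
    (hinj : ∀ (s : R) (v : L), s ≠ 0 → s • v = 0 → v = 0)
    (hsurj : ∀ (s : R) (w : L), s ≠ 0 → ∃ v, s • v = w) (e : L) :
    ∃ l : D →+ L, l 1 = e ∧ (∀ r d, l (F r * d) = r • l d) ∧
      ∀ (ρ : L →+ L) (r : R), (∀ (s : R) v, ρ (s • v) = s • ρ v) → ρ e = r • e →
        ∀ d, l (d * F r) = ρ (l d) := by
  have hcancel : ∀ (s : R) (v w : L), s ≠ 0 → s • v = s • w → v = w := fun s v w hs h =>
    sub_eq_zero.1 (hinj s _ hs (by rw [smul_sub, h, sub_self]))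
  -- The element d = s⁻¹ a must go to the solution of s v = a e; the Ore condition makes this
  -- independent of the fraction chosen.
  have hex : ∀ d : D, ∃ v : L, ∀ s a, F s * d = F a → s • v = a • e := by
    intro d
    obtain ⟨s₀, hs₀, a₀, h₀⟩ := hF.exists_mul_eq d
    obtain ⟨v, hv⟩ := hsurj s₀ (a₀ • e) hs₀
    refine ⟨v, fun s a h => ?_⟩
    obtain ⟨u, hu, u', huu⟩ := hF.exists_mul_eq_mul s hs₀
    refine hcancel u _ _ hu ?_
    rw [← mul_smul, huu, mul_smul, hv, ← mul_smul, ← mul_smul]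
    congr 1
    refine hF.1 ?_
    rw [map_mul, ← h₀, ← mul_assoc, ← map_mul, ← huu, map_mul, mul_assoc, h, map_mul]
  choose l hl using hex
  have huniq : ∀ d v s a, s ≠ 0 → F s * d = F a → s • v = a • e → l d = v :=
    fun d v s a hs h hv => hcancel s _ _ hs (by rw [hl d s a h, hv])
  refine ⟨AddMonoidHom.mk' l fun d d' => ?_, ?_, fun r d => ?_, fun ρ r hρ he d => ?_⟩
  · obtain ⟨s, hs, a, h⟩ := hF.exists_mul_eq d
    obtain ⟨u, hu, b, h'⟩ := hF.exists_mul_eq (F s * d')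
    refine huniq _ _ (u * s) (u * a + b) (hF.mul_ne_zero hu hs) ?_ ?_
    · rw [map_mul, map_add, ← h', map_mul, ← h, mul_add, mul_assoc, mul_assoc]
    · rw [smul_add, hl d (u * s) (u * a) (by rw [map_mul, map_mul, mul_assoc, h]),
        hl d' (u * s) b (by rw [map_mul, mul_assoc, h']), add_smul]
  · exact huniq 1 e 1 1 (fun h => one_ne_zero ((map_one F).symm.trans (by rw [h, map_zero])))
      (mul_one _) rfl
  · obtain ⟨s, hs, a, h⟩ := hF.exists_mul_eq (F r * d)
    refine huniq _ _ s a hs h ?_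
    exact (mul_smul _ _ _).symm.trans (hl d (s * r) a (by rw [map_mul, mul_assoc, h]))
  -- With d = s⁻¹ a, both sides solve s v = a r e, because ρ commutes with the action of `R`.
  · obtain ⟨s, hs, a, h⟩ := hF.exists_mul_eq d
    refine huniq _ _ s (a * r) hs (by rw [← mul_assoc, h, map_mul]) ?_
    change s • ρ (l d) = _
    rw [← hρ, hl d s a h, hρ, he, mul_smul]

end Fractions

/-- An expansion of the elements of `D` as skew Laurent series in `x` with coefficients in `C`. -/
structure LaurentExpansion {C D : Type u} [Ring C] [Ring D] (f : C →+* D) (α : C ≃+* C) (x : D) where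
  /-- The sequence of coefficients. -/
  coeff : D →+ ℤ → C
  exists_bound : ∀ d, ∃ N, ∀ i < N, coeff d i = 0
  coeff_one : coeff 1 = Pi.single 0 1
  coeff_mul_left : ∀ c d i, coeff (f c * d) i = c * coeff d i
  coeff_mul_right : ∀ d c i, coeff (d * f c) i = coeff d i * (α ^ i) c
  coeff_x_mul : ∀ d i, coeff (x * d) i = α (coeff d (i - 1))
  coeff_mul_x : ∀ d i, coeff (d * x) i = coeff d (i - 1)

section Expansion

variable {C D : Type u} [DivisionRing C] [DivisionRing D] [MulSemiringAction (Multiplicative ℕ) C]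
  {α : C ≃+* C} {f : C →+* D} {F : SkewPolynomial C →+* D}

/-- The expansion is the orbit map through the series 1. Right multiplications by elements of C and
by x are operators on series commuting with the left action of the skew polynomial ring, so the map
respects them as well. -/
theorem exists_laurentExpansion (hα : ∀ (n : ℕ) (c : C), Multiplicative.ofAdd n • c = (α ^ n) c)
    (hF : IsQuotientDivisionRing F) (hf : ∀ c, F (SkewPolynomial.C c) = f c) :
    Nonempty (LaurentExpansion f α (F SkewPolynomial.X)) := by
  let _ := laurentModule α hα
  have hmon := fun n c v i => monomial_smul_laurent hα n c v i
  have hC : ∀ (c : C) (v : laurentSeq C) i, (SkewPolynomial.C c • v).1 i = c * v.1 i := by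
    intro c v i
    refine (hmon 0 c v i).trans ?_
    rw [Nat.cast_zero, sub_zero, pow_zero]
    rfl
  have hX : ∀ (v : laurentSeq C) i, ((SkewPolynomial.X : SkewPolynomial C) • v).1 i =
      α (v.1 (i - 1)) := by
    intro v i
    refine (hmon 1 1 v i).trans ?_
    rw [Nat.cast_one, pow_one, one_mul]
  let e : laurentSeq C := ⟨Pi.single 0 1, 0, fun i hi => Pi.single_eq_of_ne hi.ne _⟩
  obtain ⟨l, h1, hl, hr⟩ := hF.exists_expansion (L := laurentSeq C)
    (fun s v hs h => laurent_smul_eq_zero hα s hs v h)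
    (fun s w hs => exists_laurent_smul_eq hα s hs w) e
  have hR : ∀ c, ∃ ρ : laurentSeq C →+ laurentSeq C, (∀ v i, (ρ v).1 i = v.1 i * (α ^ i) c) := by
    intro c
    refine ⟨{ toFun := fun v => ⟨fun i => v.1 i * (α ^ i) c, ?_⟩, map_zero' := ?_, map_add' := ?_ },
      fun v i => rfl⟩
    · obtain ⟨N, hN⟩ := v.2
      exact ⟨N, fun i hi => (congrArg (· * _) (hN i hi)).trans (zero_mul _)⟩
    · exact Subtype.ext (funext fun i => zero_mul _)
    · exact fun v w => Subtype.ext (funext fun i => add_mul _ _ _)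
  have hS : ∃ ρ : laurentSeq C →+ laurentSeq C, (∀ v i, (ρ v).1 i = v.1 (i - 1)) := by
    refine ⟨{ toFun := fun v => ⟨fun i => v.1 (i - 1), ?_⟩, map_zero' := ?_, map_add' := ?_ },
      fun v i => rfl⟩
    · obtain ⟨N, hN⟩ := v.2
      exact ⟨N, fun i hi => hN _ (by lia)⟩
    · rfl
    · exact fun v w => rfl
  have hlin : ∀ ρ : laurentSeq C →+ laurentSeq C,
      (∀ n c v, ρ ((single (Multiplicative.ofAdd n) c : SkewPolynomial C) • v) =
        (single (Multiplicative.ofAdd n) c : SkewPolynomial C) • ρ v) →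
      ∀ (s : SkewPolynomial C) v, ρ (s • v) = s • ρ v := by
    intro ρ h s v
    induction s using SkewMonoidAlgebra.induction_on with
    | zero => rw [zero_smul, zero_smul, map_zero]
    | add s t hs ht => rw [add_smul, map_add, hs, ht, add_smul]
    | single n c => exact h n.toAdd c v
  refine ⟨{
    coeff := (laurentSeq C).subtype.toAddMonoidHom.comp l
    exists_bound := fun d => (l d).2
    coeff_one := congrArg Subtype.val h1
    coeff_mul_left := fun c d i => ?_
    coeff_mul_right := fun d c i => ?_
    coeff_x_mul := fun d i => ?_
    coeff_mul_x := fun d i => ?_ }⟩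
  · change (l (f c * d)).1 i = c * (l d).1 i
    rw [← hf, hl, hC]
  · obtain ⟨ρ, hρ⟩ := hR c
    change (l (d * f c)).1 i = (l d).1 i * (α ^ i) c
    rw [← hf, hr ρ (SkewPolynomial.C c) (hlin ρ fun n c' v => ?_) ?_, hρ]
    · refine Subtype.ext (funext fun i => ?_)
      rw [hρ, hC]
      by_cases hi : i = 0
      · subst hi
        simp [e]
      · have : e.1 i = 0 := Pi.single_eq_of_ne hi _
        rw [this, zero_mul, mul_zero]
    · refine Subtype.ext (funext fun i => ?_)
      rw [hρ]
      refine (congrArg (· * _) (hmon n c' v i)).trans ((hmon n c' (ρ v) i).trans ?_).symm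
      have hpow : (α ^ n) ((α ^ (i - n)) c) = (α ^ i) c := by
        rw [← zpow_natCast, ← RingAut.mul_apply, ← zpow_add, add_sub_cancel]
      rw [hρ, map_mul, hpow, mul_assoc]
  · change (l (F SkewPolynomial.X * d)).1 i = α ((l d).1 (i - 1))
    rw [hl, hX]
  · obtain ⟨ρ, hρ⟩ := hS
    change (l (d * F SkewPolynomial.X)).1 i = (l d).1 (i - 1)
    rw [hr ρ SkewPolynomial.X (hlin ρ fun n c' v => ?_) ?_, hρ]
    · refine Subtype.ext (funext fun i => ?_)
      rw [hρ, hX]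
      by_cases hi : i - 1 = 0
      · rw [hi]
        simp [e]
      · have : e.1 (i - 1) = 0 := Pi.single_eq_of_ne hi _
        rw [this, map_zero]
    · refine Subtype.ext (funext fun i => ?_)
      rw [hρ]
      refine (hmon n c' v (i - 1)).trans ((hmon n c' (ρ v) i).trans ?_).symm
      rw [hρ, sub_right_comm]

end Expansion

/-! ### The skew Laurent ring over C^e as a direct summand of D^e -/

theorem SkewMonoidAlgebra.coeff_mul_single_of_group {A Γ : Type*} [Ring A] [Group Γ]
    [MulSemiringAction Γ A] (r : SkewMonoidAlgebra A Γ) (g : Γ) (a : A) (h : Γ) :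
    (r * single g a).coeff h = r.coeff (h * g⁻¹) * (h * g⁻¹) • a := by
  classical
  induction r using SkewMonoidAlgebra.induction_on with
  | zero => rw [zero_mul]; simp
  | add r s hr hs => rw [add_mul, coeff_add, coeff_add, Finsupp.add_apply, hr, hs, Finsupp.add_apply, add_mul]
  | single g' b =>
    rw [single_mul_single, coeff_single_apply, coeff_single_apply]
    by_cases hg : g' * g = h
    · subst hg
      simp
    · rw [if_neg hg, if_neg (fun h' => hg (by rw [h', inv_mul_cancel_right])), zero_mul]

/-- The skew Laurent polynomial ring over a ring acted upon by an automorphism and its powers. -/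
abbrev SkewLaurent (A : Type u) [Ring A] : Type u := SkewMonoidAlgebra A (Multiplicative ℤ)

section SkewExtension

variable {k : Type v} [Field k] {C D : Type u} [DivisionRing C] [Algebra k C] [DivisionRing D]
  [Algebra k D]

/-- The map `d ⊗ e ↦ p(d) ⊗ q(e)` of enveloping algebras. -/
noncomputable def envPair (p q : D →ₗ[k] C) : EnvAlg k D →ₗ[k] EnvAlg k C :=
  TensorProduct.map p ((opLinearEquiv k).toLinearMap ∘ₗ q ∘ₗ (opLinearEquiv k).symm.toLinearMap)

theorem envPair_tmul (p q : D →ₗ[k] C) (a : D) (b : Dᵐᵒᵖ) :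
    envPair p q (a ⊗ₜ b) = p a ⊗ₜ op (q b.unop) := rfl

variable {f : C →ₐ[k] D} {α : C ≃+* C} {x : D}

section Conjugation

variable (hx : x ≠ 0) (hxf : ∀ c, x * f c = f (α c) * x)

include hx hxf

theorem inv_mul_eq_mul_inv (c : C) : x⁻¹ * f c = f (α.symm c) * x⁻¹ := by
  rw [eq_mul_inv_iff_mul_eq₀ hx, mul_assoc, inv_mul_eq_iff_eq_mul₀ hx, hxf, RingEquiv.apply_symm_apply]

theorem zpow_mul_eq_mul_zpow (n : ℤ) (c : C) : x ^ n * f c = f ((α ^ n) c) * x ^ n := by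
  induction n using Int.induction_on generalizing c with
  | zero => simp
  | succ n ih =>
    rw [zpow_add_one₀ hx, mul_assoc, hxf, ← mul_assoc, ih, mul_assoc, zpow_add_one]
    rfl
  | pred n ih =>
    rw [zpow_sub_one₀ hx, mul_assoc, inv_mul_eq_mul_inv hx hxf, ← mul_assoc, ih, mul_assoc,
      zpow_sub_one]
    rfl

end Conjugation

namespace LaurentExpansion

variable (L : LaurentExpansion (f : C →+* D) α x)

theorem coeff_zpow_mul (hx : x ≠ 0) (n : ℤ) (d : D) (i : ℤ) :
    L.coeff (x ^ n * d) i = (α ^ n) (L.coeff d (i - n)) := by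
  induction n using Int.induction_on generalizing d i with
  | zero => simp
  | succ n ih =>
    rw [zpow_add_one₀ hx, mul_assoc, ih, L.coeff_x_mul, zpow_add_one, sub_sub]
    rfl
  | pred n ih =>
    have h1 : L.coeff (x⁻¹ * d) (i - -(n : ℤ)) = α⁻¹ (L.coeff d (i - (-n - 1))) := by
      have := L.coeff_x_mul (x⁻¹ * d) (i - (-n - 1))
      rw [mul_inv_cancel_left₀ hx] at this
      rw [this, ← RingAut.mul_apply, inv_mul_cancel, sub_sub, sub_add_cancel]
      rfl
    rw [zpow_sub_one₀ hx, mul_assoc, ih, h1, zpow_sub_one]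
    rfl

theorem coeff_mul_zpow (hx : x ≠ 0) (n : ℤ) (d : D) (i : ℤ) :
    L.coeff (d * x ^ n) i = L.coeff d (i - n) := by
  induction n using Int.induction_on generalizing d i with
  | zero => simp
  | succ n ih =>
    rw [zpow_add_one₀ hx, ← mul_assoc, L.coeff_mul_x, ih]
    exact congrArg (L.coeff d) (by ring)
  | pred n ih =>
    have h1 := L.coeff_mul_x (d * x ^ (-(n : ℤ)) * x⁻¹) (i + 1)
    rw [inv_mul_cancel_right₀ hx, ih, add_sub_cancel_right] at h1
    rw [zpow_sub_one₀ hx, ← mul_assoc, ← h1]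
    exact congrArg (L.coeff d) (by ring)

/-- A coefficient, as a linear map. -/
def coeffₗ (n : ℤ) : D →ₗ[k] C where
  toFun d := L.coeff d n
  map_add' d e := by rw [map_add]; rfl
  map_smul' c d := by
    rw [Algebra.smul_def, ← f.commutes, RingHom.id_apply, Algebra.smul_def]
    exact L.coeff_mul_left _ _ _

theorem coeffₗ_apply (n : ℤ) (d : D) : L.coeffₗ n d = L.coeff d n := rfl

/-- A coefficient of the expansion with coefficients on the right, as a linear map. -/
def rightCoeff (n : ℤ) : D →ₗ[k] C where
  -- The index is reversed: since c x^{-n} = x^{-n} α^n(c), this is the coefficient of x^{-n} when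
  -- coefficients stand on the right.
  toFun d := (α ^ n) (L.coeff d (-n))
  map_add' d e := by rw [map_add, Pi.add_apply, map_add]
  map_smul' c d := by
    have : c • d = d * f (algebraMap k C c) := by
      rw [f.commutes, Algebra.smul_def, Algebra.commutes]
    rw [this, RingHom.id_apply, Algebra.smul_def, Algebra.commutes]
    refine (congrArg (α ^ n) (L.coeff_mul_right _ _ _)).trans ?_
    rw [map_mul, ← RingAut.mul_apply, ← zpow_add, add_neg_cancel, zpow_zero]
    rfl

theorem rightCoeff_apply (n : ℤ) (d : D) : L.rightCoeff n d = (α ^ n) (L.coeff d (-n)) := rfl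

end LaurentExpansion

/-- The element `xⁿ ⊗ x⁻ⁿ` of the enveloping algebra. -/
noncomputable def zpowEnv (k : Type v) [Field k] [Algebra k D] (hx : x ≠ 0) :
    Multiplicative ℤ →* EnvAlg k D where
  toFun n := (x ^ n.toAdd) ⊗ₜ op (x ^ (-n.toAdd))
  map_one' := by
    change ((x ^ (0 : ℤ)) ⊗ₜ op (x ^ (-0 : ℤ)) : EnvAlg k D) = 1
    simp [Algebra.TensorProduct.one_def]
  map_mul' m n := by
    change ((x ^ (m.toAdd + n.toAdd)) ⊗ₜ op (x ^ (-(m.toAdd + n.toAdd))) : EnvAlg k D) = _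
    rw [Algebra.TensorProduct.tmul_mul_tmul, zpow_add₀ hx, ← op_mul, ← zpow_add₀ hx (-n.toAdd),
      neg_add_rev]

variable [MulSemiringAction (Multiplicative ℤ) (EnvAlg k C)]

/-- The homomorphism from the skew Laurent polynomial ring over the enveloping algebra of `C` to the
enveloping algebra of `D`. -/
noncomputable def skewEnvHom (hx : x ≠ 0) (hxf : ∀ c, x * f c = f (α c) * x)
    (hσ : ∀ (n : ℤ) (c : C) (d : Cᵐᵒᵖ), Multiplicative.ofAdd n • (c ⊗ₜ[k] d : EnvAlg k C) =
      (α ^ n) c ⊗ₜ op ((α ^ n) d.unop)) :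
    SkewLaurent (EnvAlg k C) →+* EnvAlg k D :=
  SkewMonoidAlgebra.liftNCRingHom (envMap f : EnvAlg k C →+* EnvAlg k D) (zpowEnv k hx)
    fun {a n} => by
      change envMap f (n • a) * (x ^ n.toAdd) ⊗ₜ op (x ^ (-n.toAdd)) =
        (x ^ n.toAdd) ⊗ₜ op (x ^ (-n.toAdd)) * envMap f a
      induction a using TensorProduct.induction_on with
      | zero => rw [smul_zero, map_zero, zero_mul, mul_zero]
      | add a b ha hb => rw [smul_add, map_add, add_mul, ha, hb, map_add, mul_add]
      | tmul c d =>
        have h1 := hσ n.toAdd c d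
        rw [ofAdd_toAdd] at h1
        rw [h1, envMap_tmul, envMap_tmul, Algebra.TensorProduct.tmul_mul_tmul,
          Algebra.TensorProduct.tmul_mul_tmul, ← zpow_mul_eq_mul_zpow hx hxf, ← op_mul, ← op_mul,
          unop_op]
        congr 2
        have := zpow_mul_eq_mul_zpow hx hxf (-n.toAdd) ((α ^ n.toAdd) d.unop)
        rw [this, ← RingAut.mul_apply, ← zpow_add, neg_add_cancel, zpow_zero]
        rfl

variable (hx : x ≠ 0) (hxf : ∀ c, x * f c = f (α c) * x)
  (hσ : ∀ (n : ℤ) (c : C) (d : Cᵐᵒᵖ), Multiplicative.ofAdd n • (c ⊗ₜ[k] d : EnvAlg k C) =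
    (α ^ n) c ⊗ₜ op ((α ^ n) d.unop))

theorem skewEnvHom_single (n : ℤ) (a : EnvAlg k C) :
    skewEnvHom hx hxf hσ (single (Multiplicative.ofAdd n) a) =
      envMap f a * (x ^ n) ⊗ₜ op (x ^ (-n)) :=
  SkewMonoidAlgebra.liftNC_single _ _ _ _

section Retraction

variable (L : LaurentExpansion (f : C →+* D) α x)

/-- A component of the retraction of the enveloping algebra of `D`. -/
noncomputable def retractionCoeff (n : ℤ) : EnvAlg k D →ₗ[k] EnvAlg k C :=
  envPair (L.coeffₗ n) (L.rightCoeff n)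

/-- The component of degree n pairs x^n in the left factor with x^{-n} in the right factor;
multiplication by x^g ⊗ x^{-g} shifts both exponents consistently. -/
theorem retractionCoeff_mul (n g : ℤ) (a : EnvAlg k C) (b : EnvAlg k D) :
    retractionCoeff L n (skewEnvHom hx hxf hσ (single (Multiplicative.ofAdd g) a) * b) =
      a * Multiplicative.ofAdd g • retractionCoeff L (n - g) b := by
  rw [skewEnvHom_single]
  induction a using TensorProduct.induction_on with
  | zero => simp
  | add a a' ha ha' => rw [map_add, add_mul, add_mul, map_add, ha, ha', add_mul]
  | tmul c c' =>
    induction b using TensorProduct.induction_on with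
    | zero => simp
    | add b b' hb hb' => rw [mul_add, map_add, hb, hb', map_add, smul_add, mul_add]
    | tmul d e =>
      rw [envMap_tmul, Algebra.TensorProduct.tmul_mul_tmul, Algebra.TensorProduct.tmul_mul_tmul,
        retractionCoeff, retractionCoeff, envPair_tmul, envPair_tmul, hσ,
        Algebra.TensorProduct.tmul_mul_tmul, L.coeffₗ_apply, L.coeffₗ_apply, L.rightCoeff_apply,
        L.rightCoeff_apply, mul_assoc (f c)]
      congr 1
      · refine (L.coeff_mul_left _ _ _).trans ?_
        rw [L.coeff_zpow_mul hx]
      · rw [unop_mul, unop_mul, unop_op, unop_op, unop_op]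
        rw [← mul_assoc]
        have h1 := L.coeff_mul_right (e.unop * x ^ (-g)) c'.unop (-n)
        refine (congrArg (fun z => op ((α ^ n) z)) h1).trans ?_
        rw [L.coeff_mul_zpow hx, map_mul, ← RingAut.mul_apply, ← zpow_add, add_neg_cancel, zpow_zero,
          ← RingAut.mul_apply, ← zpow_add, add_sub_cancel, op_mul]
        rw [show -n - -g = -(n - g) by ring]
        rfl

-- Both expansions are bounded below, but the second is read at -n. Hence the left factor kills very
-- negative n and the right factor very positive n.
omit [MulSemiringAction (Multiplicative ℤ) (EnvAlg k C)] in
theorem exists_bound_retractionCoeff (b : EnvAlg k D) :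
    ∃ N, ∀ n : ℤ, N < |n| → retractionCoeff L n b = 0 := by
  induction b using TensorProduct.induction_on with
  | zero => exact ⟨0, fun n _ => map_zero _⟩
  | add b b' hb hb' =>
    obtain ⟨N, hN⟩ := hb
    obtain ⟨N', hN'⟩ := hb'
    exact ⟨max N N', fun n hn => by
      rw [map_add, hN n ((le_max_left _ _).trans_lt hn), hN' n ((le_max_right _ _).trans_lt hn),
        add_zero]⟩
  | tmul d e =>
    obtain ⟨N, hN⟩ := L.exists_bound d
    obtain ⟨N', hN'⟩ := L.exists_bound e.unop
    refine ⟨max |N| |N'|, fun n hn => ?_⟩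
    rw [retractionCoeff, envPair_tmul, L.coeffₗ_apply, L.rightCoeff_apply]
    have h1 := (le_max_left _ _).trans_lt hn
    have h2 := (le_max_right _ _).trans_lt hn
    rcases le_or_gt 0 n with h0 | h0
    · rw [abs_of_nonneg h0] at h2
      rw [hN' (-n) (by have := neg_abs_le N'; lia), map_zero, op_zero, TensorProduct.tmul_zero]
    · rw [abs_of_neg h0] at h1
      rw [hN n (by have := neg_abs_le N; lia), TensorProduct.zero_tmul]

omit [MulSemiringAction (Multiplicative ℤ) (EnvAlg k C)] in
theorem retractionCoeff_one (n : ℤ) : retractionCoeff L n 1 = if n = 0 then 1 else 0 := by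
  change retractionCoeff L n (1 ⊗ₜ 1) = _
  rw [retractionCoeff, envPair_tmul, L.coeffₗ_apply, L.rightCoeff_apply, unop_one, L.coeff_one]
  split_ifs with h
  · subst h
    rw [neg_zero, Pi.single_eq_same, zpow_zero]
    rfl
  · rw [Pi.single_eq_of_ne h, TensorProduct.zero_tmul]

end Retraction

end SkewExtension

section GradedRetraction

variable {A B : Type u} [Ring A] [Ring B] [MulSemiringAction (Multiplicative ℤ) A]
  (φ : SkewMonoidAlgebra A (Multiplicative ℤ) →+* B) (γ : ℤ → B →+ A)
  (hmul : ∀ (n g : ℤ) a b, γ n (φ (single (Multiplicative.ofAdd g) a) * b) =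
    a * Multiplicative.ofAdd g • γ (n - g) b)
  (hbound : ∀ b, ∃ N, ∀ n : ℤ, N < |n| → γ n b = 0)
  (hone : ∀ n, γ n 1 = if n = 0 then 1 else 0)
  [Module (SkewMonoidAlgebra A (Multiplicative ℤ)) A]
  [IsScalarTower A (SkewMonoidAlgebra A (Multiplicative ℤ)) A]
  (hA : ∀ g (a : A), of A (Multiplicative ℤ) g • a = g • a)
  [Module (SkewMonoidAlgebra A (Multiplicative ℤ)) B]
  (hB : ∀ g (b : B), g • b = φ g * b)

include hmul hbound hone hA hB

/-- The maps γ_n assemble into a linear map to `Induced A`, which is the skew Laurent ring itself as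
a left module. It sends 1 to the generator, so the map sending the generator to 1 is a section. -/
theorem Induced.exists_retraction_of_coeff :
    ∃ (i : Induced (Multiplicative ℤ) A →ₗ[SkewMonoidAlgebra A (Multiplicative ℤ)] B)
      (r : B →ₗ[SkewMonoidAlgebra A (Multiplicative ℤ)] Induced (Multiplicative ℤ) A),
      ∀ y, r (i y) = y := by
  have hfin : ∀ b : B, (Function.support fun g : Multiplicative ℤ => γ g.toAdd b).Finite :=
    fun b => by
      obtain ⟨N, hN⟩ := hbound b
      refine Set.Finite.subset (Set.finite_Icc (-N) N : Set.Finite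
        (Set.Icc (-N) N : Set ℤ)) fun (g : ℤ) hg => ?_
      have h1 : ¬ N < |g| := fun h => hg (hN _ h)
      exact abs_le.1 (not_lt.1 h1)
  let r₀ : B → Induced (Multiplicative ℤ) A := fun b => Finsupp.ofSupportFinite _ (hfin b)
  have hr₀ : ∀ b g, Induced.π A g (r₀ b) = γ g.toAdd b := fun b g => rfl
  let r₁ : B →+ Induced (Multiplicative ℤ) A := AddMonoidHom.mk' r₀
    fun b b' => Induced.ext_π A fun g => by rw [map_add, hr₀, hr₀, hr₀, map_add]
  let r : B →ₗ[SkewMonoidAlgebra A (Multiplicative ℤ)] Induced (Multiplicative ℤ) A :=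
    { r₁ with
      map_smul' := fun y b => by
        change r₁ (y • b) = y • r₁ b
        induction y using SkewMonoidAlgebra.induction_on with
        | zero => rw [zero_smul, zero_smul, map_zero]
        | add y y' hy hy' => rw [add_smul, map_add, hy, hy', add_smul]
        | single g a =>
          refine Induced.ext_π A fun h => ?_
          have h1 := Induced.π_of_smul (A := A) g (g⁻¹ * h) (r₁ b)
          rw [mul_inv_cancel_left, hA] at h1
          rw [SkewMonoidAlgebra.single_smul (V := Induced (Multiplicative ℤ) A),
            (Induced.π A h).map_smul, h1, hB]
          refine (hmul h.toAdd g.toAdd a b).trans ?_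
          rw [ofAdd_toAdd, smul_eq_mul]
          congr 2
          change _ = γ (g⁻¹ * h).toAdd b
          rw [toAdd_mul, toAdd_inv, neg_add_eq_sub] }
  obtain ⟨_, _⟩ := SkewMonoidAlgebra.exists_coeffModule A (Γ := Multiplicative ℤ) B
  let i : Induced (Multiplicative ℤ) A →ₗ[SkewMonoidAlgebra A (Multiplicative ℤ)] B :=
    Induced.extend (LinearMap.toSpanSingleton A B 1)
  refine ⟨i, r, fun y => ?_⟩
  have hgen : ∀ (g : Multiplicative ℤ) (a : A), Induced.ι A g a =
      (single g a : SkewMonoidAlgebra A (Multiplicative ℤ)) •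
        Induced.ι A 1 (1 : A) := fun g a => by
    rw [SkewMonoidAlgebra.single_smul, Induced.of_smul_ι, hA, smul_one, mul_one, ← map_smul,
      smul_eq_mul, mul_one]
  have h1 : i (Induced.ι A 1 1) = 1 := by
    change Induced.extend _ _ = _
    rw [Induced.extend_ι, inv_one, map_one, one_smul, one_smul, LinearMap.toSpanSingleton_apply,
      one_smul]
  have h2 : r 1 = Induced.ι A 1 1 := by
    refine Induced.ext_π A fun g => ?_
    refine (hone g.toAdd).trans ?_
    split_ifs with hg
    · obtain rfl : g = 1 := hg
      rw [Induced.π_ι_same]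
    · rw [Induced.π_ι_of_ne fun h => hg (by rw [h]; rfl)]
  induction y using Induced.induction_on A A with
  | zero => rw [map_zero, map_zero]
  | add y y' hy hy' => rw [map_add, map_add, hy, hy']
  | ι g a => rw [hgen, map_smul, map_smul, h1, h2]

end GradedRetraction

/-! ### Right flatness of D^e over the skew Laurent ring -/

section FlatnessCriterion

variable {A B : Type u} [Ring A] [Ring B] [MulSemiringAction (Multiplicative ℤ) A]
  {φ : SkewMonoidAlgebra A (Multiplicative ℤ) →+* B} {κ : Type u} {γ : κ → ℤ → B →+ A}

theorem coeff_mul_eq_of_coeff (hmul : ∀ j (n g : ℤ) a p,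
      γ j n (p * φ (single (Multiplicative.ofAdd g) a)) =
        γ j (n - g) p * Multiplicative.ofAdd (n - g) • a) {j : κ} {p : B}
    {y : SkewMonoidAlgebra A (Multiplicative ℤ)}
    (hy : ∀ n, y.coeff (Multiplicative.ofAdd n) = γ j n p)
    (z : SkewMonoidAlgebra A (Multiplicative ℤ)) (n : ℤ) :
    (y * z).coeff (Multiplicative.ofAdd n) = γ j n (p * φ z) := by
  induction z using SkewMonoidAlgebra.induction_on with
  | zero => simp
  | add z z' hz hz' =>
    rw [mul_add, SkewMonoidAlgebra.coeff_add, Finsupp.add_apply, hz, hz', map_add, mul_add, map_add]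
  | single g a =>
    obtain ⟨m, rfl⟩ := Multiplicative.ofAdd.surjective g
    rw [SkewMonoidAlgebra.coeff_mul_single_of_group, hmul, ← hy, ← ofAdd_neg, ← ofAdd_add,
      sub_eq_add_neg]

/-- After left multiplication by `v`, a finite family has coordinates over the skew Laurent ring
with respect to the `q j`. The maps γ compute these coordinates, so a relation holds coordinatewise;
multiplying back by `w` gives the equational criterion. -/
theorem isRightFlatHom_of_coeff (q : κ → B) (hmul : ∀ j (n g : ℤ) a p,
      γ j n (p * φ (single (Multiplicative.ofAdd g) a)) =
        γ j (n - g) p * Multiplicative.ofAdd (n - g) • a)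
    (h : ∀ {ι : Type u} (s : Finset ι) (p : ι → B), ∃ v w : B, w * v = 1 ∧ ∀ i ∈ s,
      ∃ r : κ →₀ SkewMonoidAlgebra A (Multiplicative ℤ),
        (∀ j n, (r j).coeff (Multiplicative.ofAdd n) = γ j n (v * p i)) ∧
        v * p i = r.sum fun j y => q j * φ y) : IsRightFlatHom φ := by
  classical
  intro ι s p b hb
  obtain ⟨v, w, hwv, hr⟩ := h s p
  choose! r hr hq using hr
  refine ⟨κ, s.biUnion fun i => (r i).support, fun j => w * q j, fun i j => r i j,
    fun i hi => ?_, fun j _ => ?_⟩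
  · have h1 := hq i hi
    rw [Finsupp.sum_of_support_subset _ (Finset.subset_biUnion_of_mem (fun i => (r i).support) hi) _
      (fun _ _ => by rw [map_zero, mul_zero])] at h1
    calc p i = w * (v * p i) := by rw [← mul_assoc, hwv, one_mul]
      _ = _ := by
        rw [h1, Finset.mul_sum]
        exact Finset.sum_congr rfl fun j _ => (mul_assoc _ _ _).symm
  · have key : ∀ n, (∑ i ∈ s, r i j * b i).coeff (Multiplicative.ofAdd n) = 0 := fun n => by
      have h2 : ∑ i ∈ s, (r i j * b i).coeff (Multiplicative.ofAdd n) = 0 := by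
        rw [Finset.sum_congr rfl fun i hi => coeff_mul_eq_of_coeff hmul (hr i hi j) (b i) n,
          ← map_sum]
        refine (congrArg (γ j n) ?_).trans (map_zero _)
        rw [Finset.sum_congr rfl fun i _ => mul_assoc v (p i) (φ (b i)), ← Finset.mul_sum]
        exact (congrArg (v * ·) hb).trans (mul_zero _)
      refine Eq.trans ?_ h2
      exact map_sum (AddMonoidHom.mk' (fun y : SkewMonoidAlgebra A (Multiplicative ℤ) =>
        y.coeff (Multiplicative.ofAdd n)) fun y z => by
          rw [SkewMonoidAlgebra.coeff_add, Finsupp.add_apply]) _ _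
    ext g
    exact key g.toAdd

end FlatnessCriterion

section Flatness

variable {k : Type v} [Field k] {C D : Type u} [DivisionRing C] [Algebra k C] [DivisionRing D]
  [Algebra k D] {R : Type*} [Ring R] {F : R →+* D} {f : C →ₐ[k] D} {α : C ≃+* C} {x : D}
  [MulSemiringAction (Multiplicative ℤ) (EnvAlg k C)]

variable (hx : x ≠ 0) (hxf : ∀ c, x * f c = f (α c) * x)
  (hσ : ∀ (n : ℤ) (c : C) (d : Cᵐᵒᵖ), Multiplicative.ofAdd n • (c ⊗ₜ[k] d : EnvAlg k C) =
    (α ^ n) c ⊗ₜ op ((α ^ n) d.unop))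

/-- The homogeneous coefficient of an element of the enveloping algebra of `D` attached to a linear
form on `D`. -/
noncomputable def rightCoordinate (L : LaurentExpansion (f : C →+* D) α x) (θ : D →ₗ[k] C) (n : ℤ) :
    EnvAlg k D →ₗ[k] EnvAlg k C :=
  envPair (L.coeffₗ n) (θ ∘ₗ LinearMap.mulLeft k (x ^ n))

omit [MulSemiringAction (Multiplicative ℤ) (EnvAlg k C)] in
theorem rightCoordinate_tmul (L : LaurentExpansion (f : C →+* D) α x) (θ : D →ₗ[k] C) (n : ℤ)
    (d : D) (e : Dᵐᵒᵖ) :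
    rightCoordinate L θ n (d ⊗ₜ e) = L.coeff d n ⊗ₜ op (θ (x ^ n * e.unop)) := rfl

theorem rightCoordinate_mul (L : LaurentExpansion (f : C →+* D) α x) (θ : D →ₗ[k] C)
    (hθ : ∀ c d, θ (f c * d) = c * θ d) (n g : ℤ) (a : EnvAlg k C) (p : EnvAlg k D) :
    rightCoordinate L θ n (p * skewEnvHom hx hxf hσ (single (Multiplicative.ofAdd g) a)) =
      rightCoordinate L θ (n - g) p * Multiplicative.ofAdd (n - g) • a := by
  rw [skewEnvHom_single]
  induction a using TensorProduct.induction_on with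
  | zero => simp
  | add a a' ha ha' => rw [map_add, add_mul, mul_add, map_add, ha, ha', smul_add, mul_add]
  | tmul c c' =>
    induction p using TensorProduct.induction_on with
    | zero => simp
    | add b b' hb hb' => rw [add_mul, map_add, hb, hb', map_add, add_mul]
    | tmul d e =>
      rw [envMap_tmul, Algebra.TensorProduct.tmul_mul_tmul, Algebra.TensorProduct.tmul_mul_tmul,
        rightCoordinate_tmul, rightCoordinate_tmul, hσ, Algebra.TensorProduct.tmul_mul_tmul,
        ← mul_assoc, L.coeff_mul_zpow hx]
      refine congrArg₂ _ (L.coeff_mul_right _ _ _) ?_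
      rw [← op_mul, unop_mul, unop_op, ← mul_assoc, ← mul_assoc, ← zpow_add₀ hx,
        ← sub_eq_add_neg, zpow_mul_eq_mul_zpow hx hxf, mul_assoc, hθ,
        op_mul]

variable (k) in
/-- The elements of the enveloping algebra of `D` with a left factor in the image of `F`. -/
def leftIntegral (F : R →+* D) : AddSubmonoid (EnvAlg k D) :=
  AddSubmonoid.closure {z | ∃ a d, z = F a ⊗ₜ d}

theorem mul_mem_leftIntegral (u : R) {z : EnvAlg k D} (hz : z ∈ leftIntegral k F) :
    (F u ⊗ₜ 1) * z ∈ leftIntegral k F := by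
  induction hz using AddSubmonoid.closure_induction with
  | zero => rw [mul_zero]; exact zero_mem _
  | add z w _ _ hz hw => rw [mul_add]; exact add_mem hz hw
  | mem z hz =>
    obtain ⟨a, d, rfl⟩ := hz
    exact AddSubmonoid.subset_closure ⟨u * a, d, by
      rw [Algebra.TensorProduct.tmul_mul_tmul, map_mul, one_mul]⟩

theorem mul_mem_leftIntegral_of_eq {s t u u' : R} (h : u * t = u' * s) {z : EnvAlg k D}
    (hz : (F s ⊗ₜ 1) * z ∈ leftIntegral k F) : (F (u * t) ⊗ₜ 1) * z ∈ leftIntegral k F := by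
  have h1 : (F (u' * s) ⊗ₜ 1 : EnvAlg k D) = (F u' ⊗ₜ 1) * (F s ⊗ₜ 1) := by
    rw [Algebra.TensorProduct.tmul_mul_tmul, map_mul, one_mul]
  rw [h, h1, mul_assoc]
  exact mul_mem_leftIntegral _ hz

/-- Common left denominators for the first factor, by the Ore condition. -/
theorem IsQuotientDivisionRing.exists_mul_mem_leftIntegral (hF : IsQuotientDivisionRing F)
    (p : EnvAlg k D) : ∃ s ≠ 0, (F s ⊗ₜ 1) * p ∈ leftIntegral k F := by
  induction p using TensorProduct.induction_on with
  | zero =>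
    obtain ⟨s, hs, -⟩ := hF.exists_mul_eq 0
    exact ⟨s, hs, by rw [mul_zero]; exact zero_mem _⟩
  | tmul d e =>
    obtain ⟨s, hs, a, h⟩ := hF.exists_mul_eq d
    exact ⟨s, hs, AddSubmonoid.subset_closure ⟨a, e, by
      rw [Algebra.TensorProduct.tmul_mul_tmul, h, one_mul]⟩⟩
  | add p p' hp hp' =>
    obtain ⟨s, hs, h⟩ := hp
    obtain ⟨t, ht, h'⟩ := hp'
    obtain ⟨u, hu, u', hut⟩ := hF.exists_mul_eq_mul t hs
    refine ⟨u * t, hF.mul_ne_zero hu ht, ?_⟩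
    rw [mul_add]
    exact add_mem (mul_mem_leftIntegral_of_eq hut h) (mul_mem_leftIntegral_of_eq rfl h')

theorem IsQuotientDivisionRing.exists_forall_mul_mem_leftIntegral (hF : IsQuotientDivisionRing F)
    {ι : Type*} (S : Finset ι) (p : ι → EnvAlg k D) :
    ∃ s ≠ 0, ∀ i ∈ S, (F s ⊗ₜ 1) * p i ∈ leftIntegral k F := by
  classical
  induction S using Finset.induction_on with
  | empty =>
    obtain ⟨s, hs, -⟩ := hF.exists_mul_eq 0
    exact ⟨s, hs, fun i hi => absurd hi (Finset.notMem_empty i)⟩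
  | insert j S _ ih =>
    obtain ⟨s, hs, h⟩ := ih
    obtain ⟨t, ht, h'⟩ := hF.exists_mul_mem_leftIntegral (p j)
    obtain ⟨u, hu, u', hut⟩ := hF.exists_mul_eq_mul t hs
    refine ⟨u * t, hF.mul_ne_zero hu ht, fun i hi => ?_⟩
    rcases Finset.mem_insert.1 hi with rfl | hi
    · exact mul_mem_leftIntegral_of_eq rfl h'
    · exact mul_mem_leftIntegral_of_eq hut (h i hi)

/-- The coefficients of the elements of `D` on the left of powers of `x`. -/
theorem exists_coordinates_of_mem_leftIntegral (L : LaurentExpansion (f : C →+* D) α x)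
    (hR : ∀ a, F a ∈ AddSubmonoid.closure {d | ∃ (c : C) (n : ℕ), d = f c * x ^ n})
    [Module C D] (hD : ∀ (c : C) (d : D), c • d = f c * d) {κ : Type*} (b : Module.Basis κ C D)
    (θ : κ → D →ₗ[k] C) (hθ : ∀ j d, θ j d = b.repr d j) {z : EnvAlg k D}
    (hz : z ∈ leftIntegral k F) :
    ∃ r : κ →₀ SkewLaurent (EnvAlg k C),
        (∀ j n, (r j).coeff (Multiplicative.ofAdd n) = rightCoordinate L (θ j) n z) ∧
        z = r.sum fun j y => (1 ⊗ₜ op (b j)) * skewEnvHom hx hxf hσ y := by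
  classical
  have hadd : ∀ z w : EnvAlg k D,
      (∃ r : κ →₀ SkewLaurent (EnvAlg k C),
        (∀ j n, (r j).coeff (Multiplicative.ofAdd n) = rightCoordinate L (θ j) n z) ∧
        z = r.sum fun j y => (1 ⊗ₜ op (b j)) * skewEnvHom hx hxf hσ y) →
      (∃ r : κ →₀ SkewLaurent (EnvAlg k C),
        (∀ j n, (r j).coeff (Multiplicative.ofAdd n) = rightCoordinate L (θ j) n w) ∧
        w = r.sum fun j y => (1 ⊗ₜ op (b j)) * skewEnvHom hx hxf hσ y) →
      ∃ r : κ →₀ SkewLaurent (EnvAlg k C),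
        (∀ j n, (r j).coeff (Multiplicative.ofAdd n) = rightCoordinate L (θ j) n (z + w)) ∧
        z + w = r.sum fun j y => (1 ⊗ₜ op (b j)) * skewEnvHom hx hxf hσ y := by
    rintro z w ⟨r, hr, hr'⟩ ⟨r', h, h'⟩
    refine ⟨r + r', fun j n => ?_, ?_⟩
    · rw [Finsupp.add_apply, SkewMonoidAlgebra.coeff_add, Finsupp.add_apply, hr, h, map_add]
    · rw [Finsupp.sum_add_index' (fun j => by rw [map_zero, mul_zero])
        (fun j y y' => by rw [map_add, mul_add]), ← hr', ← h']
  have hzero : ∃ r : κ →₀ SkewLaurent (EnvAlg k C),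
        (∀ j n, (r j).coeff (Multiplicative.ofAdd n) =
          rightCoordinate L (θ j) n (0 : EnvAlg k D)) ∧
        (0 : EnvAlg k D) = r.sum fun j y => (1 ⊗ₜ op (b j)) * skewEnvHom hx hxf hσ y :=
    ⟨0, fun j n => by simp, by simp⟩
  induction hz using AddSubmonoid.closure_induction with
  | zero => exact hzero
  | add z w _ _ hz hw => exact hadd z w hz hw
  | mem z hz =>
    obtain ⟨a, d, rfl⟩ := hz
    have ha := hR a
    generalize F a = z at ha ⊢
    induction ha using AddSubmonoid.closure_induction with
    | zero => rw [TensorProduct.zero_tmul]; exact hzero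
    | add z w _ _ hz hw => rw [TensorProduct.add_tmul]; exact hadd _ _ hz hw
    | mem z hz =>
      obtain ⟨c, m, rfl⟩ := hz
      -- With x^m d = Σ y_j b_j, one has c x^m ⊗ d = Σ_j (1 ⊗ b_j)(c ⊗ y_j)(x^m ⊗ x^{-m}), the
      -- second factors being multiplied in the opposite algebra.
      refine ⟨(b.repr (x ^ (m : ℤ) * d.unop)).mapRange
        (fun y => single (Multiplicative.ofAdd (m : ℤ)) (c ⊗ₜ op y)) (by simp), fun j n => ?_, ?_⟩
      · rw [Finsupp.mapRange_apply, SkewMonoidAlgebra.coeff_single_apply, rightCoordinate_tmul]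
        have h1 : L.coeff (f c * x ^ m) n = if (m : ℤ) = n then c else 0 := by
          have h2 := L.coeff_mul_zpow hx m (f c * 1) n
          rw [mul_one, zpow_natCast] at h2
          rw [h2]
          have h3 := L.coeff_mul_left c 1 (n - m)
          rw [mul_one, L.coeff_one] at h3
          refine h3.trans ?_
          split_ifs with h
          · rw [h, sub_self, Pi.single_eq_same, mul_one]
          · rw [Pi.single_eq_of_ne (by lia), mul_zero]
        rw [h1, hθ]
        by_cases h : (m : ℤ) = n
        · subst h
          rw [if_pos rfl, if_pos rfl]
        · rw [if_neg h, if_neg fun h' => h (Multiplicative.ofAdd.injective h'),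
            TensorProduct.zero_tmul]
      · rw [Finsupp.sum_mapRange_index fun j => by rw [map_zero, mul_zero]]
        have h1 : ∀ j (y : C), (1 ⊗ₜ op (b j) : EnvAlg k D) * skewEnvHom hx hxf hσ
            (single (Multiplicative.ofAdd (m : ℤ)) (c ⊗ₜ op y)) =
            (f c * x ^ m) ⊗ₜ op (x ^ (-(m : ℤ)) * (y • b j)) := fun j y => by
          rw [skewEnvHom_single, envMap_tmul, Algebra.TensorProduct.tmul_mul_tmul,
            Algebra.TensorProduct.tmul_mul_tmul, one_mul, zpow_natCast, ← op_mul, ← op_mul, unop_op,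
            hD, mul_assoc]
        simp only [h1]
        have h2 : d = op (x ^ (-(m : ℤ)) * (x ^ (m : ℤ) * d.unop)) := by
          rw [← mul_assoc, ← zpow_add₀ hx, neg_add_cancel, zpow_zero, one_mul, op_unop]
        conv_lhs => rw [h2, ← b.linearCombination_repr (x ^ (m : ℤ) * d.unop),
          Finsupp.linearCombination_apply, Finsupp.mul_sum]
        rw [Finsupp.sum, Finsupp.sum, Finset.op_sum, TensorProduct.tmul_sum]

/-- Elements whose first factors are skew polynomials have coordinates along 1 ⊗ b_j, for a left
C-basis b_j of `D`. Clearing a common left denominator brings any finite family into this form. -/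
theorem skewEnvHom_isRightFlatHom (L : LaurentExpansion (f : C →+* D) α x)
    (hF : IsQuotientDivisionRing F)
    (hR : ∀ a, F a ∈ AddSubmonoid.closure {d | ∃ (c : C) (n : ℕ), d = f c * x ^ n}) :
    IsRightFlatHom (A := SkewLaurent (EnvAlg k C)) (B := EnvAlg k D)
      (skewEnvHom hx hxf hσ) := by
  let _ : Module C D := Module.compHom D (f : C →+* D)
  have hD : ∀ (c : C) (d : D), c • d = f c * d := fun c d => rfl
  have : IsScalarTower k C D := ⟨fun a c d => by rw [hD, hD, map_smul, smul_mul_assoc]⟩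
  let b := Module.Free.chooseBasis C D
  let θ : Module.Free.ChooseBasisIndex C D → D →ₗ[k] C := fun j => (b.coord j).restrictScalars k
  refine isRightFlatHom_of_coeff (fun j => 1 ⊗ₜ op (b j))
    (γ := fun j n => (rightCoordinate L (θ j) n).toAddMonoidHom) (fun j n g a p => ?_) fun s p => ?_
  · refine rightCoordinate_mul hx hxf hσ L (θ j) (fun c d => ?_) n g a p
    exact (b.coord j).map_smul c d
  · obtain ⟨t, ht, h⟩ := hF.exists_forall_mul_mem_leftIntegral s p
    refine ⟨F t ⊗ₜ 1, (F t)⁻¹ ⊗ₜ 1, ?_, fun i hi => ?_⟩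
    · rw [Algebra.TensorProduct.tmul_mul_tmul, inv_mul_cancel₀ (hF.ne_zero ht), one_mul]
      rfl
    · exact exists_coordinates_of_mem_leftIntegral hx hxf hσ L hR hD b θ (fun j d => rfl) (h i hi)

end Flatness

theorem SkewMonoidAlgebra.smul_map_of_single {A B Γ C D : Type*} [Ring A] [Ring B] [Monoid Γ]
    [MulSemiringAction Γ A] [AddCommGroup C] [AddCommGroup D] [Module (SkewMonoidAlgebra A Γ) C]
    [Module B D] (φ : SkewMonoidAlgebra A Γ →+* B) (j : C →+ D)
    (h : ∀ g a c, φ (single g a) • j c = j ((single g a : SkewMonoidAlgebra A Γ) • c))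
    (y : SkewMonoidAlgebra A Γ) (c : C) : φ y • j c = j (y • c) := by
  induction y using SkewMonoidAlgebra.induction_on with
  | zero => rw [map_zero, zero_smul, zero_smul, map_zero]
  | add y z hy hz => rw [map_add, add_smul, hy, hz, add_smul, map_add]
  | single g a => exact h g a c

/-! ### D as the extension of scalars of C from the skew Laurent ring to D^e -/

section SkewBimodule

variable {k : Type v} [Field k] {C D : Type u} [DivisionRing C] [Algebra k C] [DivisionRing D]
  [Algebra k D] {R : Type*} [Ring R] {F : R →+* D} {f : C →ₐ[k] D} {x : D}

/-- An element of a bimodule that commutes with `C` and `x` commutes with the elements of `D`. -/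
theorem IsQuotientDivisionRing.smul_comm_of_generators {N : Type*} [AddCommGroup N]
    [Module (EnvAlg k D) N] (hF : IsQuotientDivisionRing F)
    (hR : ∀ a, F a ∈ AddSubmonoid.closure {d | ∃ (c : C) (n : ℕ), d = f c * x ^ n}) (n₀ : N)
    (hf : ∀ c, (1 ⊗ₜ op (f c) : EnvAlg k D) • n₀ = (f c ⊗ₜ 1 : EnvAlg k D) • n₀)
    (hx : (1 ⊗ₜ op x : EnvAlg k D) • n₀ = (x ⊗ₜ 1 : EnvAlg k D) • n₀) (e : D) :
    (1 ⊗ₜ op e : EnvAlg k D) • n₀ = (e ⊗ₜ 1 : EnvAlg k D) • n₀ := by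
  have hmul : ∀ a b : D, (1 ⊗ₜ op a : EnvAlg k D) • n₀ = (a ⊗ₜ 1 : EnvAlg k D) • n₀ →
      (1 ⊗ₜ op b : EnvAlg k D) • n₀ = (b ⊗ₜ 1 : EnvAlg k D) • n₀ →
      (1 ⊗ₜ op (a * b) : EnvAlg k D) • n₀ = ((a * b) ⊗ₜ 1 : EnvAlg k D) • n₀ := by
    intro a b ha hb
    have h1 : (1 ⊗ₜ op (a * b) : EnvAlg k D) = (1 ⊗ₜ op b) * (1 ⊗ₜ op a) := by
      rw [Algebra.TensorProduct.tmul_mul_tmul, one_mul, op_mul]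
    have h2 : (1 ⊗ₜ op b : EnvAlg k D) * (a ⊗ₜ 1) = (a ⊗ₜ 1) * (1 ⊗ₜ op b) := by
      rw [Algebra.TensorProduct.tmul_mul_tmul, Algebra.TensorProduct.tmul_mul_tmul, one_mul, mul_one,
        one_mul, mul_one]
    have h3 : ((a * b) ⊗ₜ 1 : EnvAlg k D) = (a ⊗ₜ 1) * (b ⊗ₜ 1) := by
      rw [Algebra.TensorProduct.tmul_mul_tmul, one_mul]
    rw [h1, mul_smul, ha, ← mul_smul, h2, mul_smul, hb, ← mul_smul, h3]
  -- Multiply the relation on both sides by a⁻¹.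
  have hinv : ∀ a : D, a ≠ 0 → (1 ⊗ₜ op a : EnvAlg k D) • n₀ = (a ⊗ₜ 1 : EnvAlg k D) • n₀ →
      (1 ⊗ₜ op a⁻¹ : EnvAlg k D) • n₀ = (a⁻¹ ⊗ₜ 1 : EnvAlg k D) • n₀ := by
    intro a ha h
    have h1 := congrArg ((a⁻¹ ⊗ₜ op a⁻¹ : EnvAlg k D) • ·) h
    simp only [← mul_smul, Algebra.TensorProduct.tmul_mul_tmul, ← op_mul, mul_inv_cancel₀ ha,
      inv_mul_cancel₀ ha, mul_one] at h1
    exact h1.symm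
  have hone : (1 ⊗ₜ op 1 : EnvAlg k D) • n₀ = ((1 : D) ⊗ₜ 1 : EnvAlg k D) • n₀ := rfl
  have hint : ∀ a, (1 ⊗ₜ op (F a) : EnvAlg k D) • n₀ = (F a ⊗ₜ 1 : EnvAlg k D) • n₀ := by
    intro a
    have ha := hR a
    generalize F a = z at ha ⊢
    induction ha using AddSubmonoid.closure_induction with
    | zero => rw [MulOpposite.op_zero, TensorProduct.tmul_zero, TensorProduct.zero_tmul]
    | add z w _ _ hz hw =>
      rw [MulOpposite.op_add, TensorProduct.tmul_add, TensorProduct.add_tmul, add_smul, hz, hw,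
        add_smul]
    | mem z hz =>
      obtain ⟨c, m, rfl⟩ := hz
      refine hmul _ _ (hf c) ?_
      induction m with
      | zero => simpa only [pow_zero] using hone
      | succ m ih => rw [pow_succ]; exact hmul _ _ ih hx
  obtain ⟨a, s, hs, rfl⟩ := hF.2 e
  exact hmul _ _ (hinv _ (hF.ne_zero hs) (hint s)) (hint a)

variable {G : Type u} [Ring G] [Module G C] (φ : G →+* EnvAlg k D)

variable (hφ : ∀ (y : G) (c : C), φ y • f c = f (y • c))

/-- The map exhibiting `D` as the extension of scalars of `C`. -/
noncomputable def extensionUnit : C →ₗ[G] Coind (rightMulAction φ) D where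
  toFun c := Coind.ofLinearMap (rightMulAction φ) (LinearMap.toSpanSingleton (EnvAlg k D) D (f c))
  map_add' c c' := Coind.ext fun p => by
    change p • f (c + c') = p • f c + p • f c'
    rw [map_add, smul_add]
  map_smul' y c := Coind.ext fun p => by
    change p • f (y • c) = (p * φ y) • f c
    rw [mul_smul, hφ]

theorem extensionUnit_apply (c : C) (p : EnvAlg k D) : extensionUnit φ hφ c p = p • f c := rfl

/-- A balanced map h is determined by n₀ = h 1 1. This element commutes with C, and with x because x
⊗ x⁻¹ fixes 1, hence with all of `D`; so e ↦ e n₀ is a bimodule map. -/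
theorem isTensor_extensionUnit (hF : IsQuotientDivisionRing F)
    (hR : ∀ a, F a ∈ AddSubmonoid.closure {d | ∃ (c : C) (n : ℕ), d = f c * x ^ n}) (hx : x ≠ 0)
    (hleft : ∀ c, ∃ y, φ y = f c ⊗ₜ 1) (hright : ∀ c, ∃ y, φ y = 1 ⊗ₜ op (f c))
    (hconj : ∃ y, φ y = x ⊗ₜ op x⁻¹) :
    IsTensor (extensionUnit φ hφ) where
  span_eq_top := by
    rw [eq_top_iff]
    intro e _
    refine Submodule.subset_span ⟨1, (e ⊗ₜ 1 : EnvAlg k D), ?_⟩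
    rw [extensionUnit_apply, env_smul, map_one, mul_one, unop_one, mul_one]
  exists_lift {N} _ _ h := by
    have hlin : ∀ c (p : EnvAlg k D), h c p = p • h c 1 := fun c p => by
      have := (h c).toLinearMap.map_smul p 1
      rwa [smul_eq_mul, mul_one] at this
    have key : ∀ y c, φ y • f 1 = f c → h c 1 = φ y • h 1 1 := fun y c hy => by
      rw [hφ] at hy
      rw [← f.toRingHom.injective hy, map_smul, Coind.smul_apply, ← hlin]
      change h 1 (1 * φ y) = _
      rw [one_mul]
    have hf : ∀ c, h c 1 = (f c ⊗ₜ 1 : EnvAlg k D) • h 1 1 := fun c => by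
      obtain ⟨y, hy⟩ := hleft c
      rw [← hy]
      exact key y c (by rw [hy, env_smul, map_one, mul_one, unop_one, mul_one])
    have hf' : ∀ c, h c 1 = (1 ⊗ₜ op (f c) : EnvAlg k D) • h 1 1 := fun c => by
      obtain ⟨y, hy⟩ := hright c
      rw [← hy]
      exact key y c (by rw [hy, env_smul, map_one, mul_one, unop_op, one_mul])
    have hx1 : (1 ⊗ₜ op x : EnvAlg k D) • h 1 1 = (x ⊗ₜ 1 : EnvAlg k D) • h 1 1 := by
      obtain ⟨y, hy⟩ := hconj
      have h1 := key y 1 (by rw [hy, env_smul, map_one, mul_one, unop_op, mul_inv_cancel₀ hx])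
      conv_lhs => rw [h1, hy, ← mul_smul, Algebra.TensorProduct.tmul_mul_tmul, one_mul, ← op_mul,
        inv_mul_cancel₀ hx]
      rfl
    have hcomm := hF.smul_comm_of_generators hR (h 1 1) (fun c => (hf' c).symm.trans (hf c)) hx1
    let g : D →+ N := AddMonoidHom.mk' (fun e => (e ⊗ₜ 1 : EnvAlg k D) • h 1 1) fun a b => by
      rw [TensorProduct.add_tmul, add_smul]
    have hg : ∀ (a : D) (b : Dᵐᵒᵖ) (e : D), g ((a ⊗ₜ b : EnvAlg k D) • e) =
        (a ⊗ₜ b : EnvAlg k D) • g e := fun a b e => by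
      change (((a ⊗ₜ[k] b : EnvAlg k D) • e) ⊗ₜ 1 : EnvAlg k D) • h 1 1 =
        (a ⊗ₜ[k] b : EnvAlg k D) • (e ⊗ₜ 1 : EnvAlg k D) • h 1 1
      have h1 : ((a * e * b.unop) ⊗ₜ 1 : EnvAlg k D) = ((a * e) ⊗ₜ 1) * (b.unop ⊗ₜ 1) := by
        rw [Algebra.TensorProduct.tmul_mul_tmul, one_mul]
      rw [env_smul, h1, mul_smul, ← hcomm, ← mul_smul, ← mul_smul,
        Algebra.TensorProduct.tmul_mul_tmul, Algebra.TensorProduct.tmul_mul_tmul, one_mul, mul_one,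
        mul_one, op_unop]
    refine ⟨{ g with map_smul' := env_induction g hg }, fun c p => ?_⟩
    change g (extensionUnit φ hφ c p) = _
    rw [extensionUnit_apply, env_induction g hg, hlin, hf]
    rfl

include hφ in
theorem projDimLT_env_of_extension (hF : IsQuotientDivisionRing F)
    (hR : ∀ a, F a ∈ AddSubmonoid.closure {d | ∃ (c : C) (n : ℕ), d = f c * x ^ n}) (hx : x ≠ 0)
    (hleft : ∀ c, ∃ y, φ y = f c ⊗ₜ 1) (hright : ∀ c, ∃ y, φ y = 1 ⊗ₜ op (f c))
    (hconj : ∃ y, φ y = x ⊗ₜ op x⁻¹) (hflat : IsRightFlatHom φ) {n : ℕ}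
    (h : ProjDimLT G C (n + 1)) : ProjDimLT (EnvAlg k D) D (n + 1) :=
  (isTensor_extensionUnit φ hφ hF hR hx hleft hright hconj).projDimLT hflat h

end SkewBimodule

/-! ### Lower bound for the injective dimension -/

section Bounds

variable {A B : Type u} [Ring A] [Ring B] [MulSemiringAction (Multiplicative ℤ) A]
  {φ : SkewMonoidAlgebra A (Multiplicative ℤ) →+* B}
  {M : Type u} [AddCommGroup M] [Module A M] [Module (SkewMonoidAlgebra A (Multiplicative ℤ)) M]
  [IsScalarTower A (SkewMonoidAlgebra A (Multiplicative ℤ)) M]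

/-- If `B` had injective dimension at most d, so would its summand `Induced A` over the skew Laurent
ring S. Then Ext^{d+1}_S(M, Induced A) = 0, hence Ext^d_A(M, A) = 0, which contradicts that `M` has
projective dimension exactly d. -/
theorem not_injDimLT_of_skewLaurent [IsNoetherianRing A] [Module.Finite A M]
    (hφ : IsRightFlatHom φ) (γ : ℤ → B →+ A)
    (hmul : ∀ (n g : ℤ) a b, γ n (φ (single (Multiplicative.ofAdd g) a) * b) =
      a * Multiplicative.ofAdd g • γ (n - g) b)
    (hbound : ∀ b, ∃ N, ∀ n : ℤ, N < |n| → γ n b = 0)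
    (hone : ∀ n, γ n 1 = if n = 0 then 1 else 0) {d : ℕ} (h : ProjDimLT A M (d + 1))
    (h' : ¬ ProjDimLT A M d) : ¬ InjDimLT B B (d + 1) := by
  intro hB
  let ψ : Multiplicative ℤ →* AddMonoid.End A := DistribMulAction.toAddMonoidEnd _ A
  have hψ : ∀ (g : Multiplicative ℤ) (a v : A), ψ g (a • v) = (g • a) • ψ g v :=
    fun g a v => smul_mul' g a v
  let _ : Module (SkewMonoidAlgebra A (Multiplicative ℤ)) A :=
    SkewMonoidAlgebra.moduleOfAction ψ hψ
  have _ : IsScalarTower A (SkewMonoidAlgebra A (Multiplicative ℤ)) A :=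
    SkewMonoidAlgebra.moduleOfAction_isScalarTower ψ hψ
  let _ : Module (SkewMonoidAlgebra A (Multiplicative ℤ)) B := Module.compHom B φ
  have hA : ∀ g (a : A), of A (Multiplicative ℤ) g • a = g • a := fun g a =>
    (SkewMonoidAlgebra.moduleOfAction_single_smul ψ hψ g 1 a).trans (one_smul _ _)
  obtain ⟨i, r, hr⟩ := Induced.exists_retraction_of_coeff φ γ hmul hbound hone hA fun _ _ => rfl
  have h1 : InjDimLT (SkewMonoidAlgebra A (Multiplicative ℤ)) (Induced (Multiplicative ℤ) A)
      (d + 1) := (hB.restrict hφ fun _ _ => rfl).of_retract i r hr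
  have h2 := extZero_of_injDimLT (M := M) h1
  cases d with
  | zero =>
    -- For d = 0 there are no nonzero maps M → A, whereas a nonzero projective module has nonzero
    -- coordinate functions.
    have h3 := Induced.eq_zero_of_extZero_one h2
    have h4 : Module.Projective A M := projDimLT_one_iff.1 h
    obtain ⟨s, hs⟩ := (Module.projective_def'.1 h4)
    have h5 : Subsingleton M := subsingleton_of_forall_eq 0 fun m => by
      have h6 : s m = 0 := Finsupp.ext fun j => LinearMap.congr_fun (h3 (Finsupp.lapply j ∘ₗ s)) m
      have h7 := LinearMap.congr_fun hs m
      rw [LinearMap.comp_apply, h6, map_zero] at h7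
      exact h7.symm
    exact h' ((hasProjectiveDimensionLT_zero_iff_isZero _).2 (ModuleCat.isZero_of_subsingleton _))
  | succ d => exact h' (ProjDimLT.of_extZero_self h (Induced.extZero_of_extZero_induced h2))

end Bounds

/-! ### Skew polynomial extensions raise htr by one, part (c) -/

section SkewExtension

variable {k : Type v} [Field k] {C D : Type u} [DivisionRing C] [Algebra k C] [DivisionRing D]
  [Algebra k D] {R : Type*} [Ring R] {F : R →+* D} {f : C →ₐ[k] D} {α : C ≃ₐ[k] C} {x : D}

theorem env_addMonoidHom_ext {X : Type*} [AddCommMonoid X] {p q : EnvAlg k C →+ X}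
    (h : ∀ a b, p (a ⊗ₜ b) = q (a ⊗ₜ b)) (a : EnvAlg k C) : p a = q a := by
  induction a using TensorProduct.induction_on with
  | zero => rw [map_zero, map_zero]
  | add a b ha hb => rw [map_add, map_add, ha, hb]
  | tmul a b => exact h a b

theorem envMap_smul_map (f : C →ₐ[k] D) (a : EnvAlg k C) (c : C) : envMap f a • f c = f (a • c) := by
  refine env_addMonoidHom_ext
    (p := ((smulAddHom (EnvAlg k D) D).flip (f c)).comp (envMap f : EnvAlg k C →+ EnvAlg k D))
    (q := (f : C →+ D).comp ((smulAddHom (EnvAlg k C) C).flip c)) (fun a b => ?_) a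
  change envMap f (a ⊗ₜ b) • f c = f ((a ⊗ₜ[k] b : EnvAlg k C) • c)
  rw [envMap_tmul, env_smul, env_smul, map_mul, map_mul, unop_op]

theorem congr_op_zpow_tmul (α : C ≃ₐ[k] C) (n : ℤ) (c : C) (d : Cᵐᵒᵖ) :
    ((Algebra.TensorProduct.congr α (AlgEquiv.op α) ^ n : EnvAlg k C ≃ₐ[k] EnvAlg k C))
      (c ⊗ₜ[k] d) = ((α : C ≃+* C) ^ n) c ⊗ₜ MulOpposite.op (((α : C ≃+* C) ^ n) d.unop) := by
  induction n using Int.induction_on generalizing c d with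
  | zero => rfl
  | succ n ih =>
    rw [zpow_add_one, zpow_add_one, AlgEquiv.mul_apply, RingAut.mul_apply, RingAut.mul_apply]
    exact ih _ _
  | pred n ih =>
    rw [zpow_sub_one, zpow_sub_one, AlgEquiv.mul_apply, RingAut.mul_apply, RingAut.mul_apply]
    exact ih _ _

section Action

variable [MulSemiringAction (Multiplicative ℤ) (EnvAlg k C)]
  [Module (SkewLaurent (EnvAlg k C)) C]

theorem skewEnvHom_smul {α : C ≃+* C} (hx : x ≠ 0) (hxf : ∀ c, x * f c = f (α c) * x)
    (hσ : ∀ (n : ℤ) (c : C) (d : Cᵐᵒᵖ), Multiplicative.ofAdd n • (c ⊗ₜ[k] d : EnvAlg k C) =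
      (α ^ n) c ⊗ₜ op ((α ^ n) d.unop))
    (hC : ∀ (n : ℤ) (a : EnvAlg k C) (c : C),
      (single (Multiplicative.ofAdd n) a : SkewLaurent (EnvAlg k C)) • c =
        a • (α ^ n) c) (y : SkewLaurent (EnvAlg k C)) (c : C) :
    skewEnvHom hx hxf hσ y • f c = f (y • c) :=
  SkewMonoidAlgebra.smul_map_of_single (skewEnvHom hx hxf hσ) (f : C →+ D) (fun g a c => by
      obtain ⟨n, rfl⟩ := Multiplicative.ofAdd.surjective g
      rw [hC, skewEnvHom_single, mul_smul]
      change _ • _ • f c = f _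
      rw [env_smul, unop_op, zpow_mul_eq_mul_zpow hx hxf, mul_assoc,
        ← zpow_add₀ hx, add_neg_cancel, zpow_zero, mul_one]
      exact envMap_smul_map f a _) y c

/-- The upper bound comes from D = D^e ⊗_S C and the shift resolution of C over the skew Laurent
ring S; the lower bound from the splitting of S off D^e. -/
theorem projDimLT_env_and_htr_eq_of_action {α : C ≃+* C} (L : LaurentExpansion (f : C →+* D) α x)
    (hF : IsQuotientDivisionRing F)
    (hR : ∀ a, F a ∈ AddSubmonoid.closure {d | ∃ (c : C) (n : ℕ), d = f c * x ^ n})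
    (hxf : ∀ c, x * f c = f (α c) * x) (hx : x ≠ 0)
    (hσ : ∀ (n : ℤ) (c : C) (d : Cᵐᵒᵖ), Multiplicative.ofAdd n • (c ⊗ₜ[k] d : EnvAlg k C) =
      (α ^ n) c ⊗ₜ op ((α ^ n) d.unop))
    [IsScalarTower (EnvAlg k C) (SkewLaurent (EnvAlg k C)) C]
    (hC : ∀ (n : ℤ) (a : EnvAlg k C) (c : C),
      (single (Multiplicative.ofAdd n) a : SkewLaurent (EnvAlg k C)) • c =
        a • (α ^ n) c) [IsNoetherianRing (EnvAlg k C)] {d : ℕ}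
    (h : ProjDimLT (EnvAlg k C) C (d + 1)) (h' : ¬ ProjDimLT (EnvAlg k C) C d) :
    ProjDimLT (EnvAlg k D) D (d + 2) ∧ htr k D = ((d + 1 : ℕ) : ℕ∞) := by
  have hflat := skewEnvHom_isRightFlatHom hx hxf hσ L hF hR
  have hsingle := skewEnvHom_single hx hxf hσ
  have hone : ((x ^ (0 : ℤ)) ⊗ₜ op (x ^ (-0 : ℤ)) : EnvAlg k D) = 1 := by
    rw [neg_zero, zpow_zero]
    rfl
  have hleft : ∀ c, ∃ y, skewEnvHom hx hxf hσ y = f c ⊗ₜ 1 := fun c =>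
    ⟨single (Multiplicative.ofAdd 0) (c ⊗ₜ 1), by
      rw [hsingle, hone, mul_one, envMap_tmul, unop_one, map_one, op_one]⟩
  have hright : ∀ c, ∃ y, skewEnvHom hx hxf hσ y = 1 ⊗ₜ op (f c) := fun c =>
    ⟨single (Multiplicative.ofAdd 0) (1 ⊗ₜ op c), by
      rw [hsingle, hone, mul_one, envMap_tmul, unop_op, map_one]⟩
  have hconj : ∃ y, skewEnvHom hx hxf hσ y = x ⊗ₜ op x⁻¹ :=
    ⟨single (Multiplicative.ofAdd 1) 1, by
      rw [hsingle, map_one, one_mul, zpow_one, zpow_neg_one]⟩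
  have hpd : ProjDimLT (EnvAlg k D) D (d + 2) := projDimLT_env_of_extension
    (G := SkewLaurent (EnvAlg k C)) (skewEnvHom hx hxf hσ) (skewEnvHom_smul hx hxf hσ hC) hF hR hx
    hleft hright hconj hflat h.skewLaurent
  refine ⟨hpd, le_antisymm (htr_le_of_projDimLT hpd) ?_⟩
  by_contra hlt
  have hle : htr k D ≤ d := by
    have h2 := htr_ne_bot (k := k) D
    generalize htr k D = y at *
    induction y with
    | bot => exact absurd rfl h2
    | coe y =>
      have hy : ¬ (((d + 1 : ℕ) : ℕ∞) ≤ y) := fun hle => hlt (WithBot.coe_le_coe.2 hle)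
      refine WithBot.coe_le_coe.2 ?_
      exact ENat.lt_natCast_add_one_iff.1 (by simpa using hy)
  exact not_injDimLT_of_skewLaurent hflat (fun n => (retractionCoeff L n).toAddMonoidHom)
    (retractionCoeff_mul hx hxf hσ L) (exists_bound_retractionCoeff L) (retractionCoeff_one L) h h'
    ((htr_le_iff D d).1 hle)

end Action

/-- Passing to the quotient division ring of a skew polynomial ring raises by one the projective
dimension of the algebra as a bimodule and the homological transcendence degree. -/
theorem projDimLT_env_and_htr_eq_of_laurentExpansion
    (L : LaurentExpansion (f : C →+* D) (α : C ≃+* C) x) (hF : IsQuotientDivisionRing F)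
    (hR : ∀ a, F a ∈ AddSubmonoid.closure {d | ∃ (c : C) (n : ℕ), d = f c * x ^ n})
    (hxf : ∀ c, x * f c = f (α c) * x) [IsNoetherianRing (EnvAlg k C)] {d : ℕ}
    (h : ProjDimLT (EnvAlg k C) C (d + 1)) (h' : ¬ ProjDimLT (EnvAlg k C) C d) :
    ProjDimLT (EnvAlg k D) D (d + 2) ∧ htr k D = ((d + 1 : ℕ) : ℕ∞) := by
  have hx : x ≠ 0 := by
    rintro rfl
    have h1 := L.coeff_x_mul 1 1
    rw [zero_mul, map_zero, L.coeff_one, sub_self, Pi.single_eq_same, map_one] at h1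
    exact zero_ne_one h1
  -- The generator acts on C^e by α ⊗ α and on C by α, matching conjugation by x inside D^e and D.
  let _ : MulSemiringAction (Multiplicative ℤ) (EnvAlg k C) :=
    MulSemiringAction.compHom (EnvAlg k C) (zpowersHom (EnvAlg k C ≃ₐ[k] EnvAlg k C)
      (Algebra.TensorProduct.congr α (AlgEquiv.op α)))
  have hσ : ∀ (n : ℤ) (c : C) (d : Cᵐᵒᵖ), Multiplicative.ofAdd n • (c ⊗ₜ[k] d : EnvAlg k C) =
      ((α : C ≃+* C) ^ n) c ⊗ₜ op (((α : C ≃+* C) ^ n) d.unop) := fun n c d =>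
    congr_op_zpow_tmul α n c d
  let ψ : Multiplicative ℤ →* AddMonoid.End C :=
    (DistribMulAction.toAddMonoidEnd (RingAut C) C).comp (zpowersHom (RingAut C) (α : C ≃+* C))
  have hψ : ∀ (g : Multiplicative ℤ) (a : EnvAlg k C) (c : C), ψ g (a • c) = (g • a) • ψ g c := by
    intro g a c
    refine env_addMonoidHom_ext (p := (ψ g).comp ((smulAddHom (EnvAlg k C) C).flip c))
      (q := ((smulAddHom (EnvAlg k C) C).flip (ψ g c)).comp
        (DistribMulAction.toAddMonoidEnd _ (EnvAlg k C) g)) (fun a b => ?_) a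
    · change ψ g ((a ⊗ₜ[k] b : EnvAlg k C) • c) = (g • (a ⊗ₜ[k] b : EnvAlg k C)) • ψ g c
      have h1 := hσ g.toAdd a b
      rw [ofAdd_toAdd] at h1
      rw [h1, env_smul, env_smul, unop_op]
      exact (map_mul ((α : C ≃+* C) ^ g.toAdd) _ _).trans (congrArg (· * _) (map_mul _ _ _))
  let _ : Module (SkewLaurent (EnvAlg k C)) C :=
    SkewMonoidAlgebra.moduleOfAction ψ hψ
  have _ : IsScalarTower (EnvAlg k C) (SkewLaurent (EnvAlg k C)) C :=
    SkewMonoidAlgebra.moduleOfAction_isScalarTower ψ hψ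
  have hC : ∀ (n : ℤ) (a : EnvAlg k C) (c : C),
      (single (Multiplicative.ofAdd n) a : SkewLaurent (EnvAlg k C)) • c =
        a • ((α : C ≃+* C) ^ n) c := fun n a c =>
    SkewMonoidAlgebra.moduleOfAction_single_smul ψ hψ _ a c
  exact projDimLT_env_and_htr_eq_of_action L hF hR hxf hx hσ hC h h'

end SkewExtension

section SkewPolynomialExtension

variable {k : Type v} [Field k]

/-- Finite global dimension enters the argument through the exact finite projective dimension of the
bimodule C. -/
theorem exists_projDimLT_env_of_globalDim_lt_top {C : Type u} [DivisionRing C] [Algebra k C]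
    (h : globalDim (EnvAlg k C) < ⊤) :
    ∃ d, ProjDimLT (EnvAlg k C) C (d + 1) ∧ ¬ ProjDimLT (EnvAlg k C) C d := by
  classical
  have h1 : ∃ n, ProjDimLT (EnvAlg k C) C n := by
    have h2 := (le_iSup (fun M : ModuleCat.{u} (EnvAlg k C) => projectiveDimension M)
      (ModuleCat.of (EnvAlg k C) C)).trans_lt h
    obtain ⟨n, hn⟩ := (projectiveDimension_ne_top_iff _).1 h2.ne
    exact ⟨n + 1, hn⟩
  have h2 := Nat.find_spec h1
  have h3 : Nat.find h1 ≠ 0 := fun h0 => not_projDimLT_env_zero (k := k) (C := C) (h0 ▸ h2)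
  obtain ⟨d, hd⟩ := Nat.exists_eq_succ_of_ne_zero h3
  rw [hd] at h2
  exact ⟨d, h2, Nat.find_min h1 (by lia)⟩

theorem projDimLT_env_and_htr_eq_of_skewPolynomial {C D : Type u} [DivisionRing C] [Algebra k C]
    [DivisionRing D] [Algebra k D] (α : C ≃ₐ[k] C) (f : C →ₐ[k] D)
    (hF : letI := skewAction α
      ∃ F : SkewPolynomial C →+* D, (∀ c, F (SkewPolynomial.C c) = f c) ∧ IsQuotientDivisionRing F)
    [IsNoetherianRing (EnvAlg k C)] {d : ℕ}
    (h : ProjDimLT (EnvAlg k C) C (d + 1)) (h' : ¬ ProjDimLT (EnvAlg k C) C d) :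
    ProjDimLT (EnvAlg k D) D (d + 2) ∧ htr k D = ((d + 1 : ℕ) : ℕ∞) := by
  let _ := skewAction α
  obtain ⟨F, hFf, hF⟩ := hF
  have hα : ∀ (n : ℕ) (c : C), Multiplicative.ofAdd n • c = ((α : C ≃+* C) ^ n) c := fun n c => by
    change (powersHom (C ≃ₐ[k] C) α (Multiplicative.ofAdd n)) c = _
    rw [powersHom_apply, toAdd_ofAdd]
    induction n generalizing c with
    | zero => rfl
    | succ n ih =>
      rw [pow_succ, pow_succ, AlgEquiv.mul_apply, RingAut.mul_apply]
      exact ih _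
  obtain ⟨L⟩ := exists_laurentExpansion hα hF (f := (f : C →+* D)) hFf
  refine projDimLT_env_and_htr_eq_of_laurentExpansion L hF (fun a => ?_) (fun c => ?_) h h'
  · induction a using SkewPolynomial.induction with
    | h0 => rw [map_zero]; exact zero_mem _
    | ha n c q _ _ hq =>
      rw [map_add]
      refine add_mem (AddSubmonoid.subset_closure ⟨c, n, ?_⟩) hq
      rw [← SkewPolynomial.C_mul_X_pow_eq_monomial, map_mul, map_pow, hFf]
  · rw [← hFf, ← map_mul, skewAction_X_mul, map_mul, hFf]

theorem Subalgebra.htr_eq_of_isQuotientOfSkewPolynomial {D : Type u} [DivisionRing D] [Algebra k D]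
    (C : Subalgebra k D) (hC : ∀ x ∈ C, x⁻¹ ∈ C) (hn : IsNoetherianRing (EnvAlg k C))
    (hg : globalDim (EnvAlg k C) < ⊤) (α : C ≃ₐ[k] C) (hα : IsQuotientOfSkewPolynomial C α) :
    htr k D = htr k C + 1 := by
  let _ := C.divisionRing hC
  obtain ⟨d, h, h'⟩ := exists_projDimLT_env_of_globalDim_lt_top hg
  have h1 : htr k C = d := htr_eq_of_projDimLT h h'
  rw [h1, (projDimLT_env_and_htr_eq_of_skewPolynomial α C.val hα h h').2]
  rfl

end SkewPolynomialExtension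

/-! ### Multilinearization of polynomial identities -/

section Multilinearization

variable {k : Type*} [Field k] {A : Type*} [Ring A] [Algebra k A]

/-- The lists mapped to a given list by a function on a finite type. -/
def listFiber {ι : Type*} [Fintype ι] [DecidableEq ι] (g : ι → ℕ) : List ℕ → Finset (List ι)
  | [] => {[]}
  | i :: w => ((Finset.univ.filter (g · = i)) ×ˢ listFiber g w).image fun z => z.1 :: z.2

theorem mem_listFiber {ι : Type*} [Fintype ι] [DecidableEq ι] (g : ι → ℕ) (w : List ℕ)
    (l : List ι) : l ∈ listFiber g w ↔ l.map g = w := by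
  induction w generalizing l with
  | nil => simp [listFiber]
  | cons i w ih =>
    cases l with
    | nil => simp [listFiber]
    | cons j l => simp [listFiber, ih]

theorem prod_map_sum_fiber {ι : Type*} [Fintype ι] [DecidableEq ι] (g : ι → ℕ) (y : ι → A)
    (w : List ℕ) :
    (w.map fun i => ∑ j with g j = i, y j).prod = ∑ l ∈ listFiber g w, (l.map y).prod := by
  induction w with
  | nil => simp [listFiber]
  | cons i w ih =>
    rw [List.map_cons, List.prod_cons, ih, listFiber, Finset.sum_image, Finset.sum_mul_sum,
      Finset.sum_product]
    · simp
    · rintro ⟨a, b⟩ _ ⟨c, d⟩ _ h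
      simpa using h

/-- The part of an identity consisting of the words in which all the letters occur is an identity. -/
theorem sum_filter_full_eq_zero {n : ℕ} (J : Finset (List (Fin n))) (q : List (Fin n) → k)
    (h : ∀ y : Fin n → A, ∑ l ∈ J, q l • (l.map y).prod = 0) (y : Fin n → A) :
    ∑ l ∈ J with ∀ i, i ∈ l, q l • (l.map y).prod = 0 := by
  have key : ∀ (T : Finset (Fin n)) (y : Fin n → A),
      ∑ l ∈ J with ∀ i ∈ T, i ∈ l, q l • (l.map y).prod = 0 := by
    intro T
    induction T using Finset.induction_on with
    | empty => simpa using h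
    | insert i T _ ih =>
      intro y
      have h1 : ∀ l : List (Fin n), i ∉ l → l.map (Function.update y i 0) = l.map y := fun l hl =>
        List.map_congr_left fun j hj => Function.update_of_ne (by rintro rfl; exact hl hj) _ _
      have h2 : ∀ l : List (Fin n), i ∈ l → (l.map (Function.update y i 0)).prod = 0 := fun l hl =>
        List.prod_eq_zero (List.mem_map.2 ⟨i, hl, Function.update_self _ _ _⟩)
      -- Subtracting the value at y_i = 0 keeps exactly the words that contain i.
      have h3 : ∑ l ∈ J with ∀ i ∈ T, i ∈ l, (if i ∈ l then q l • (l.map y).prod else 0) = 0 := by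
        have h4 := congrArg₂ (· - ·) (ih y) (ih (Function.update y i 0))
        simp only [← Finset.sum_sub_distrib, sub_zero] at h4
        refine (Finset.sum_congr rfl fun l _ => ?_).trans h4
        split_ifs with hl
        · rw [h2 l hl, smul_zero, sub_zero]
        · rw [h1 l hl, sub_self]
      rw [← Finset.sum_filter, Finset.filter_filter] at h3
      refine Eq.trans (Finset.sum_congr (Finset.filter_congr fun l _ => ?_) fun _ _ => rfl) h3
      rw [Finset.forall_mem_insert, and_comm]
  simpa using key Finset.univ y

theorem IsPIAlgebra.exists_finsupp (h : IsPIAlgebra k A) : ∃ f : List ℕ →₀ k, f ≠ 0 ∧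
    ∀ a : ℕ → A, ∑ w ∈ f.support, f w • (w.map a).prod = 0 := by
  obtain ⟨p, hp, h⟩ := h
  let e := FreeAlgebra.equivMonoidAlgebraFreeMonoid (R := k) (X := ℕ)
  refine ⟨(e p).coeff, fun h0 => hp ?_, fun a => ?_⟩
  · refine e.injective ?_
    rw [map_zero]
    exact MonoidAlgebra.coeff_injective h0
  · have h1 : FreeAlgebra.lift k a =
        (MonoidAlgebra.lift k A (FreeMonoid ℕ) (FreeMonoid.lift a)).comp e.toAlgHom := by
      ext i
      change FreeAlgebra.lift k a (FreeAlgebra.ι k i) = MonoidAlgebra.lift k A (FreeMonoid ℕ)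
        (FreeMonoid.lift a) (FreeAlgebra.lift k _ (FreeAlgebra.ι k i))
      simp
    have h2 := h a
    rw [h1] at h2
    refine Eq.trans (Finset.sum_congr rfl fun w _ => ?_)
      ((MonoidAlgebra.lift_apply (FreeMonoid.lift a) (e p)).symm.trans h2)
    exact congrArg _ (FreeMonoid.lift_apply a w).symm

/-- A PI algebra satisfies a multilinear identity. -/
theorem IsPIAlgebra.exists_multilinear (h : IsPIAlgebra k A) :
    ∃ (n : ℕ) (c : Equiv.Perm (Fin n) → k), c 1 ≠ 0 ∧
      ∀ y : Fin n → A, ∑ σ, c σ • (List.ofFn (y ∘ σ)).prod = 0 := by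
  classical
  obtain ⟨f, hf, h⟩ := h.exists_finsupp
  obtain ⟨w, hw, hmax⟩ := f.support.exists_max_image List.length (Finsupp.support_nonempty_iff.2 hf)
  let n := w.length
  -- Here `w` is a word of maximal length in the identity. There is one new variable per position of
  -- `w`, and each old letter is replaced by the sum of the new variables at its positions.
  let g : Fin n → ℕ := w.get
  have hg : List.ofFn g = w := List.ofFn_get w
  let J : Finset (List (Fin n)) := f.support.biUnion (listFiber g)
  have hJ : ∀ l, l ∈ J ↔ f (l.map g) ≠ 0 := fun l => by simp [J, mem_listFiber]
  have h1 : ∀ y : Fin n → A, ∑ l ∈ J, f (l.map g) • (l.map y).prod = 0 := fun y => by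
    rw [← h fun i => ∑ j with g j = i, y j, Finset.sum_biUnion]
    · refine Finset.sum_congr rfl fun v _ => ?_
      rw [prod_map_sum_fiber, Finset.smul_sum]
      exact Finset.sum_congr rfl fun l hl => by rw [(mem_listFiber g v l).1 hl]
    · intro v _ v' _ hv
      refine Finset.disjoint_left.2 fun l hl hl' => hv ?_
      rw [← (mem_listFiber g v l).1 hl, ← (mem_listFiber g v' l).1 hl']
  have h2 := sum_filter_full_eq_zero J _ h1
  refine ⟨n, fun σ => f ((List.ofFn σ).map g), ?_, fun y => ?_⟩
  · have : (List.ofFn (1 : Equiv.Perm (Fin n))).map g = w := by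
      rw [List.map_ofFn, ← hg]
      rfl
    change f ((List.ofFn (1 : Equiv.Perm (Fin n))).map g) ≠ 0
    rw [this]
    exact Finsupp.mem_support_iff.1 hw
  · rw [← h2 y]
    have h3 : ∑ σ : Equiv.Perm (Fin n), f ((List.ofFn σ).map g) • (List.ofFn (y ∘ σ)).prod =
        ∑ l ∈ Finset.univ.image fun σ : Equiv.Perm (Fin n) => List.ofFn σ,
          f (l.map g) • (l.map y).prod := by
      rw [Finset.sum_image]
      · exact Finset.sum_congr rfl fun σ _ => congrArg (fun l => _ • List.prod l)
          List.map_ofFn.symm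
      · intro σ _ τ _ h
        exact DFunLike.coe_injective (List.ofFn_injective h)
    rw [h3]
    refine (Finset.sum_subset (fun l hl => ?_) fun l hl hl' => ?_).symm
    -- A word containing all n letters has length at least n, and at most n by maximality of `w`; so
    -- it is a permutation. The identity permutation carries the coefficient of `w`, which is
    -- nonzero.
    · obtain ⟨hl, hfull⟩ := Finset.mem_filter.1 hl
      have hlen : l.length ≤ n := by
        have := hmax _ (Finsupp.mem_support_iff.2 ((hJ l).1 hl))
        rwa [List.length_map] at this
      have hperm : l.length = n := by
        refine le_antisymm hlen ?_
        have h4 : (Finset.univ : Finset (Fin n)) ⊆ l.toFinset := fun i _ =>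
          List.mem_toFinset.2 (hfull i)
        simpa using (Finset.card_le_card h4).trans l.toFinset_card_le
      obtain ⟨τ, rfl⟩ : ∃ τ : Fin n → Fin n, l = List.ofFn τ :=
        ⟨fun i => l.get (i.cast hperm.symm), by
          conv_lhs => rw [← List.ofFn_get l]
          exact List.ofFn_congr hperm _⟩
      have hτ : Function.Surjective τ := fun i => (List.mem_ofFn' _ _).1 (hfull i)
      exact Finset.mem_image.2 ⟨Equiv.ofBijective τ (Finite.surjective_iff_bijective.1 hτ),
        Finset.mem_univ _, rfl⟩
    · obtain ⟨σ, -, rfl⟩ := Finset.mem_image.1 hl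
      have h5 : List.ofFn σ ∉ J := fun h => hl' (Finset.mem_filter.2 ⟨h, fun i =>
        (List.mem_ofFn' _ _).2 (σ.surjective i)⟩)
      rw [hJ, not_not] at h5
      rw [h5, zero_smul]

end Multilinearization

/-! ### Shift operators that violate a multilinear identity -/

section Staircase

variable {L V : Type*} [Semiring L] [AddCommMonoid V] [Module L V]

theorem prod_ofFn_apply_last {m : ℕ} (T : Fin m → Module.End L V) (v : Fin (m + 1) → V)
    (h : ∀ i, T i (v i.succ) = v i.castSucc) : (List.ofFn T).prod (v (Fin.last m)) = v 0 := by
  induction m with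
  | zero => simp
  | succ m ih =>
    rw [List.ofFn_succ, List.prod_cons, Module.End.mul_apply]
    have := ih (fun i => T i.succ) (fun i => v i.succ) fun i => h i.succ
    rw [Fin.succ_last] at this
    rw [this]
    exact h 0

theorem prod_ofFn_apply_last_eq_zero {m : ℕ} (T : Fin m → Module.End L V) (v : Fin (m + 1) → V)
    (i : Fin m) (hi : T i (v i.succ) = 0) (h : ∀ j, i < j → T j (v j.succ) = v j.castSucc) :
    (List.ofFn T).prod (v (Fin.last m)) = 0 := by
  induction m with
  | zero => exact i.elim0
  | succ m ih =>
    rw [List.ofFn_succ, List.prod_cons, Module.End.mul_apply]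
    induction i using Fin.cases with
    | zero =>
      have := prod_ofFn_apply_last (fun i => T i.succ) (fun i => v i.succ)
        fun j => h j.succ (Fin.succ_pos j)
      rw [Fin.succ_last] at this
      rw [this]
      exact hi
    | succ i =>
      have := ih (fun i => T i.succ) (fun i => v i.succ) i hi
        fun j hj => h j.succ (Fin.succ_lt_succ_iff.2 hj)
      rw [Fin.succ_last] at this
      rw [this, map_zero]

/-- A multilinear polynomial does not vanish on a family of operators that shifts the vectors of a
family one by one. -/
theorem sum_prod_shift_apply_last {n : ℕ} {c : Equiv.Perm (Fin n) → L} {v : Fin (n + 1) → V}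
    {T : Fin n → Module.End L V} (hT : ∀ i j, T i (v j.succ) = if i = j then v j.castSucc else 0) :
    ∑ σ, c σ • (List.ofFn (T ∘ σ)).prod (v (Fin.last n)) = c 1 • v 0 := by
  rw [Finset.sum_eq_single_of_mem 1 (Finset.mem_univ _) fun σ _ hσ => ?_]
  · exact congrArg _ (prod_ofFn_apply_last _ v fun i => (hT i i).trans (if_pos rfl))
  · obtain ⟨i, hi⟩ : ∃ i, σ i ≠ i := by
      by_contra! h
      exact hσ (Equiv.ext h)
    -- Operators act from the right, so all factors beyond the largest moved index shift the vector
    -- as intended; the factor at that index then annihilates it.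
    obtain ⟨i, hi, hmax⟩ := (Finset.univ.filter fun i => σ i ≠ i).exists_max_image id
      ⟨i, Finset.mem_filter.2 ⟨Finset.mem_univ _, hi⟩⟩
    rw [prod_ofFn_apply_last_eq_zero (T ∘ σ) v i, smul_zero]
    · exact (hT _ _).trans (if_neg (Finset.mem_filter.1 hi).2)
    · intro j hj
      have : σ j = j := by
        by_contra h
        exact (hmax j (Finset.mem_filter.2 ⟨Finset.mem_univ _, h⟩)).not_gt hj
      exact (hT _ _).trans (if_pos this)

end Staircase

/-- A multilinear map that vanishes on a set vanishes on its span. -/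
theorem MultilinearMap.eq_zero_of_mem_span {L M N ι : Type*} [Finite ι] [Field L] [AddCommGroup M]
    [Module L M] [AddCommGroup N] [Module L N] (Q : MultilinearMap L (fun _ : ι => M) N) {S : Set M}
    (h : ∀ y, (∀ i, y i ∈ S) → Q y = 0) {T : ι → M} (hT : ∀ i, T i ∈ Submodule.span L S) :
    Q T = 0 := by
  obtain ⟨b, hb, hspan, hli⟩ := exists_linearIndependent L S
  have hW : ∀ i, T i ∈ Submodule.span L (Set.range ((↑) : b → M)) := fun i => by
    rw [Subtype.range_coe, hspan]
    exact hT i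
  have hzero : (Q.compLinearMap fun _ => (Submodule.span L (Set.range ((↑) : b → M))).subtype) = 0 :=
    Module.Basis.ext_multilinear (fun _ => Module.Basis.span hli) fun v => by
      rw [MultilinearMap.compLinearMap_apply]
      refine h _ fun i => ?_
      rw [Submodule.subtype_apply, Module.Basis.span_apply]
      exact hb (v i).2
  exact DFunLike.congr_fun hzero fun i => ⟨T i, hW i⟩

/-! ### Density over a maximal subfield and finiteness over the center -/

section Density

variable {D L : Type u} [DivisionRing D] [Field L] [Module L D] {j : L →+* D}

/-- Left multiplication as an endomorphism over a subfield acting on the right. -/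
def leftMulEnd (hj : ∀ (l : L) (d : D), l • d = d * j l) : D →+* Module.End L D where
  toFun a := { toFun := fun d => a * d
               map_add' := mul_add a
               map_smul' := fun l d => by rw [hj, RingHom.id_apply, hj, mul_assoc] }
  map_one' := LinearMap.ext one_mul
  map_mul' a b := LinearMap.ext fun d => mul_assoc a b d
  map_zero' := LinearMap.ext zero_mul
  map_add' a b := LinearMap.ext fun d => add_mul a b d

variable (hj : ∀ (l : L) (d : D), l • d = d * j l)

theorem leftMulEnd_apply (a d : D) : leftMulEnd hj a d = a * d := rfl

/-- Left multiplications by elements linearly independent over the center are linearly independent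
over any subfield acting on the right. -/
theorem eq_zero_of_forall_sum_mul_mul_eq_zero {k : Type*} [Field k] [Algebra k D] {ι : Type*} (d : ι → D)
    (hd : LinearIndependent (Subalgebra.center k D) d) (s : Finset ι) (l : ι → D)
    (h : ∀ x, ∑ i ∈ s, d i * x * l i = 0) : ∀ i ∈ s, l i = 0 := by
  classical
  induction s using Finset.induction_on generalizing l with
  | empty => exact fun i hi => absurd hi (Finset.notMem_empty i)
  | insert a s ha ih =>
    suffices h0 : l a = 0 by
      intro i hi
      rcases Finset.mem_insert.1 hi with rfl | hi
      · exact h0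
      · refine ih l (fun x => ?_) i hi
        have := h x
        rwa [Finset.sum_insert ha, h0, mul_zero, zero_add] at this
    -- Normalize the coefficient at a to 1. Comparing the relation at xy with the relation at x
    -- times y eliminates that term, so by induction all the coefficients are central; then x = 1
    -- contradicts independence over the center.
    by_contra h0
    have h1 : ∀ x, ∑ i ∈ insert a s, d i * x * (l i * (l a)⁻¹) = 0 := fun x => by
      have := congrArg (· * (l a)⁻¹) (h x)
      simpa only [Finset.sum_mul, zero_mul, mul_assoc] using this
    have h2 : ∀ y, ∀ i ∈ s, y * (l i * (l a)⁻¹) - l i * (l a)⁻¹ * y = 0 := fun y =>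
      ih _ fun x => by
        have h3 := h1 (x * y)
        have h4 := congrArg (· * y) (h1 x)
        rw [Finset.sum_insert ha, mul_inv_cancel₀ h0, mul_one] at h3
        simp only [Finset.sum_insert ha, mul_inv_cancel₀ h0, mul_one, add_mul, zero_mul] at h4
        have h5 : ∑ i ∈ s, d i * x * (y * (l i * (l a)⁻¹) - l i * (l a)⁻¹ * y) =
            (d a * (x * y) + ∑ i ∈ s, d i * (x * y) * (l i * (l a)⁻¹)) -
            (d a * x * y + (∑ i ∈ s, d i * x * (l i * (l a)⁻¹)) * y) := by
          rw [← mul_assoc (d a), add_sub_add_left_eq_sub, Finset.sum_mul, ← Finset.sum_sub_distrib]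
          exact Finset.sum_congr rfl fun i _ => by rw [mul_sub]; simp only [mul_assoc]
        rw [h5, h3, h4, sub_zero]
    have h6 : ∀ i ∈ insert a s, l i * (l a)⁻¹ ∈ Subalgebra.center k D := fun i hi => by
      rcases Finset.mem_insert.1 hi with rfl | hi
      · rw [mul_inv_cancel₀ h0]
        exact one_mem _
      · exact Subalgebra.mem_center_iff.2 fun y => sub_eq_zero.1 (h2 y i hi)
    have h7 := linearIndependent_iff'.1 hd (insert a s)
      (fun i => if hi : i ∈ insert a s then ⟨_, h6 i hi⟩ else 0) (by
        rw [← h1 1]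
        refine Finset.sum_congr rfl fun i hi => ?_
        rw [dif_pos hi, Subalgebra.smul_def, mul_one, smul_eq_mul]
        exact (Subalgebra.mem_center_iff.1 (h6 i hi) (d i)).symm) a (Finset.mem_insert_self a s)
    rw [dif_pos (Finset.mem_insert_self a s)] at h7
    have h8 := congrArg Subtype.val h7
    change l a * (l a)⁻¹ = 0 at h8
    rw [mul_inv_cancel₀ h0] at h8
    exact one_ne_zero h8

/-- The `L`-span of the left multiplications is a subalgebra that acts densely, if `L` is its own
centralizer. -/
theorem exists_mem_span_leftMulEnd (hcent : ∀ e, (∀ l, e * j l = j l * e) → ∃ l, e = j l)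
    (g : Module.End L D) (s : Finset D) :
    ∃ r ∈ Submodule.span L (Set.range (leftMulEnd hj)), ∀ m ∈ s, r m = g m := by
  let R := Algebra.adjoin L (Set.range (leftMulEnd hj))
  have hR : ∀ a, leftMulEnd hj a ∈ R := fun a => Algebra.subset_adjoin ⟨a, rfl⟩
  have hsimple : IsSimpleModule R D := by
    refine isSimpleModule_iff_toSpanSingleton_surjective.2 ⟨inferInstance, fun x hx d => ?_⟩
    refine ⟨⟨_, hR (d * x⁻¹)⟩, ?_⟩
    change d * x⁻¹ * x = d
    rw [inv_mul_cancel_right₀ hx]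
  -- An endomorphism commuting with R is right multiplication by an element centralizing L, hence by
  -- an element of L. So every L-linear `g` lies in the double commutant and the density theorem
  -- applies.
  let f : Module.End (Module.End R D) D :=
    { g with
      map_smul' := fun φ d => by
        change g (φ d) = φ (g d)
        have h1 : ∀ d, φ d = d * φ 1 := fun d => by
          have := φ.map_smul ⟨_, hR d⟩ 1
          change φ (d * 1) = d * φ 1 at this
          rwa [mul_one] at this
        obtain ⟨l, hl⟩ := hcent (φ 1) fun l => by
          have := φ.map_smul (algebraMap L R l) 1
          change φ (l • 1) = l • φ 1 at this
          rw [hj, one_mul, hj, h1] at this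
          exact this.symm
        rw [h1 d, h1 (g d), hl, ← hj, ← hj, map_smul] }
  obtain ⟨r, hr⟩ := jacobson_density (R := R) (M := D) f s
  refine ⟨r.1, ?_, fun m hm => (hr m hm).symm⟩
  have h1 := r.2
  rw [← Subalgebra.mem_toSubmodule, Algebra.adjoin_eq_span] at h1
  -- Left multiplications are closed under composition, so their L-span is already the algebra they
  -- generate.
  have h2 : (Submonoid.closure (Set.range (leftMulEnd hj)) : Set (Module.End L D)) =
      Set.range (leftMulEnd hj) := by
    have := Submonoid.closure_eq (MonoidHom.mrange (leftMulEnd hj : D →* Module.End L D))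
    rw [MonoidHom.coe_mrange] at this
    exact congrArg SetLike.coe this
  rwa [h2] at h1

/-- A multilinear identity with central coefficients survives extension of scalars to `L`; this is
what multilinearization is for. -/
theorem sum_prod_eq_zero_of_mem_span {n : ℕ} {c : Equiv.Perm (Fin n) → L}
    (hc : ∀ σ d, j (c σ) * d = d * j (c σ))
    (h : ∀ y : Fin n → D, ∑ σ : Equiv.Perm (Fin n), (List.ofFn (y ∘ σ)).prod * j (c σ) = 0)
    (T : Fin n → Module.End L D)
    (hT : ∀ i, T i ∈ Submodule.span L (Set.range (leftMulEnd hj))) :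
    ∑ σ, c σ • (List.ofFn (T ∘ σ)).prod = 0 := by
  let Q : MultilinearMap L (fun _ : Fin n => Module.End L D) (Module.End L D) :=
    ∑ σ, c σ • (MultilinearMap.mkPiAlgebraFin L n (Module.End L D)).domDomCongr σ
  have hQ : ∀ T, Q T = ∑ σ, c σ • (List.ofFn (T ∘ σ)).prod := fun T => by
    rw [sum_apply]
    rfl
  rw [← hQ]
  refine Q.eq_zero_of_mem_span (fun z hz => ?_) hT
  choose y hy using hz
  obtain rfl : leftMulEnd hj ∘ y = z := funext hy
  rw [hQ]
  ext x
  rw [LinearMap.sum_apply, LinearMap.zero_apply]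
  refine Eq.trans (Finset.sum_congr rfl fun σ _ => ?_)
    ((Finset.sum_mul _ _ _).symm.trans ((congrArg (· * x) (h y)).trans (zero_mul x)))
  have h3 : (List.ofFn ((leftMulEnd hj ∘ y) ∘ σ)).prod =
      leftMulEnd hj (List.ofFn (y ∘ σ)).prod := by
    rw [map_list_prod, List.map_ofFn]
    rfl
  rw [h3, LinearMap.smul_apply, leftMulEnd_apply, hj, mul_assoc, mul_assoc, hc]

-- If n + 1 vectors were independent over L, density would supply operators shifting them one by
-- one, and the identity evaluated on these would give c_1 v_0 = 0. Hence D has dimension at most n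
-- over L.
include hj in
theorem finite_of_multilinear_identity (hcent : ∀ e, (∀ l, e * j l = j l * e) → ∃ l, e = j l)
    {n : ℕ} {c : Equiv.Perm (Fin n) → L} (hc : ∀ σ d, j (c σ) * d = d * j (c σ)) (hc1 : c 1 ≠ 0)
    (h : ∀ y : Fin n → D, ∑ σ : Equiv.Perm (Fin n), (List.ofFn (y ∘ σ)).prod * j (c σ) = 0) : Module.Finite L D := by
  classical
  have key : ∀ v : Fin (n + 1) → D, ¬ LinearIndependent L v := fun v hv => by
    have hT : ∀ i : Fin n, ∃ r ∈ Submodule.span L (Set.range (leftMulEnd hj)),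
        ∀ j : Fin n, r (v j.succ) = if i = j then v j.castSucc else 0 := fun i => by
      -- The i-th operator sends v_{i+1} to v_i and all the other vectors, v_0 included, to zero.
      let w : Fin (n + 1) → D := Fin.cons 0 fun j => if i = j then v j.castSucc else 0
      obtain ⟨g, hg⟩ := LinearMap.exists_extend ((Module.Basis.span hv).constr L w)
      obtain ⟨r, hr, hrg⟩ := exists_mem_span_leftMulEnd hj hcent g (Finset.univ.image v)
      refine ⟨r, hr, fun j => ?_⟩
      rw [hrg _ (Finset.mem_image_of_mem v (Finset.mem_univ _))]
      have h1 := LinearMap.congr_fun hg (Module.Basis.span hv j.succ)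
      rw [Module.Basis.constr_basis, LinearMap.comp_apply, Submodule.subtype_apply,
        Module.Basis.span_apply] at h1
      exact h1
    choose T hT hT' using hT
    have h1 := sum_prod_shift_apply_last (c := c) hT'
    have h2 := LinearMap.congr_fun (sum_prod_eq_zero_of_mem_span hj hc h T hT) (v (Fin.last n))
    rw [LinearMap.sum_apply] at h2
    have h3 := h1.symm.trans h2
    exact (smul_ne_zero hc1 (hv.ne_zero 0)) h3
  have hrank : Module.rank L D ≤ n := by
    refine rank_le fun s hs => ?_
    by_contra hlt
    obtain ⟨t, ht, hcard⟩ := Finset.exists_subset_card_eq (not_le.1 hlt)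
    have h1 : LinearIndependent L ((↑) : t → D) := hs.comp (Set.inclusion ht) (Set.inclusion_injective ht)
    exact key _ (h1.comp _ (t.equivFinOfCardEq hcard).symm.injective)
  exact Module.rank_lt_aleph0_iff.1 (hrank.trans_lt (Cardinal.natCast_lt_aleph0))

-- Left multiplications by a basis of D over its center are L-independent in End_L(D), which is
-- finite dimensional.
include hj in
theorem finite_center_of_finite {k : Type v} [Field k] [Algebra k D] [Module.Finite L D] :
    Module.Finite (Subalgebra.center k D) D := by
  let b := Module.Free.chooseBasis (Subalgebra.center k D) D
  have hli : LinearIndependent L fun i => leftMulEnd hj (b i) := by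
    refine linearIndependent_iff'.2 fun s l h i hi => ?_
    refine j.injective ((eq_zero_of_forall_sum_mul_mul_eq_zero (k := k) b b.linearIndependent s
      (fun i => j (l i)) (fun x => ?_) i hi).trans (map_zero j).symm)
    have := LinearMap.congr_fun h x
    rw [LinearMap.sum_apply] at this
    exact (Finset.sum_congr rfl fun i _ => (hj (l i) (b i * x)).symm).trans this
  have := hli.finite
  exact Module.Finite.of_basis b

end Density

/-! ### Kaplansky's theorem -/

section PI

variable {k : Type v} {D : Type u} [Field k] [DivisionRing D] [Algebra k D]

variable (k D) in
/-- A maximal commuting subset of a division algebra is its own centralizer. -/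
theorem exists_subalgebra_eq_centralizer : ∃ L : Subalgebra k D, (∀ x ∈ L, x⁻¹ ∈ L) ∧
    (∀ x ∈ L, ∀ y ∈ L, x * y = y * x) ∧ ∀ e, (∀ x ∈ L, e * x = x * e) → e ∈ L := by
  obtain ⟨M, hM⟩ := zorn_subset {S : Set D | ∀ a ∈ S, ∀ b ∈ S, a * b = b * a} fun c hc hchain => by
    refine ⟨⋃₀ c, ?_, fun s hs => Set.subset_sUnion_of_mem hs⟩
    rintro a ⟨s, hs, ha⟩ b ⟨t, ht, hb⟩
    rcases hchain.total hs ht with h | h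
    · exact hc ht a (h ha) b hb
    · exact hc hs a ha b (h hb)
  have hmem : ∀ e, (∀ a ∈ M, a * e = e * a) → e ∈ M := fun e he => by
    refine hM.2 (y := insert e M) ?_ (Set.subset_insert e M) (Set.mem_insert e M)
    rintro a (rfl | ha) b (rfl | hb)
    · rfl
    · exact (he b hb).symm
    · exact he a ha
    · exact hM.1 a ha b hb
  refine ⟨Subalgebra.centralizer k M, fun x hx => Set.inv_mem_centralizer₀ hx, fun x hx y hy => ?_,
    fun e he => ?_⟩
  · exact Subalgebra.mem_centralizer_iff k |>.1 hy x (hmem x (Subalgebra.mem_centralizer_iff k |>.1 hx))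
  · refine Subalgebra.mem_centralizer_iff k |>.2 fun a ha => (he a ?_).symm
    exact Subalgebra.mem_centralizer_iff k |>.2 fun b hb => hM.1 b hb a ha

theorem finite_center_of_subfield {L : Type u} [Field L] [Algebra k L] (j : L →ₐ[k] D)
    (hcent : ∀ e, (∀ l, e * j l = j l * e) → ∃ l, e = j l) (h : IsPIAlgebra k D) :
    Module.Finite (Subalgebra.center k D) D := by
  let _ : Module L D := Module.compHom D ((j : L →+* D).toOpposite fun x y => by
    change j x * j y = j y * j x
    rw [← map_mul, mul_comm, map_mul])
  have hj : ∀ (l : L) (d : D), l • d = d * (j : L →+* D) l := fun l d => rfl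
  obtain ⟨n, c, hc, h⟩ := h.exists_multilinear
  have hjc : ∀ a, (j : L →+* D) (algebraMap k L a) = algebraMap k D a := j.commutes
  have := finite_of_multilinear_identity hj hcent (c := fun σ => algebraMap k L (c σ))
    (fun σ d => by rw [hjc, Algebra.commutes])
    (fun h0 => hc ((map_eq_zero_iff _ (algebraMap k L).injective).1 h0)) fun y => by
      rw [← h y]
      exact Finset.sum_congr rfl fun σ _ => by rw [hjc, ← Algebra.commutes, Algebra.smul_def]
  exact finite_center_of_finite hj

/-- Kaplansky's theorem: a division algebra satisfying a polynomial identity is finite over its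
center. -/
theorem IsPIAlgebra.finite_center (h : IsPIAlgebra k D) : Module.Finite (Subalgebra.center k D) D := by
  obtain ⟨L, hinv, hcomm, hcent⟩ := exists_subalgebra_eq_centralizer k D
  let _ : Field L :=
    { L.divisionRing hinv with mul_comm := fun x y => Subtype.ext (hcomm x x.2 y y.2) }
  exact finite_center_of_subfield L.val
    (fun e he => ⟨⟨e, hcent e fun x hx => he ⟨x, hx⟩⟩, rfl⟩) h

end PI

/-! ### Finitely generated field extensions, part (d) -/

open Polynomial in
/-- A simple transcendental extension is the quotient field of a (skew) polynomial ring. -/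
theorem exists_isQuotientDivisionRing_of_transcendental {k : Type v} [Field k] {C D : Type u}
    [Field C] [Algebra k C] [Field D] [Algebra k D] (f : C →ₐ[k] D) (a : D)
    (ha : ∀ p : C[X], p.eval₂ (f : C →+* D) a = 0 → p = 0)
    (hd : ∀ d, ∃ r s : C[X], d = r.eval₂ (f : C →+* D) a / s.eval₂ (f : C →+* D) a) :
    letI := skewAction (AlgEquiv.refl : C ≃ₐ[k] C)
    ∃ F : SkewPolynomial C →+* D, (∀ c, F (SkewPolynomial.C c) = f c) ∧
      IsQuotientDivisionRing F := by
  let _ := skewAction (AlgEquiv.refl : C ≃ₐ[k] C)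
  have hsmul : ∀ (n : Multiplicative ℕ) (c : C), n • c = c := fun n c => by
    change (powersHom (C ≃ₐ[k] C) AlgEquiv.refl n) c = c
    rw [powersHom_apply, ← AlgEquiv.aut_one, one_pow]
    rfl
  let F : SkewPolynomial C →+* D := SkewMonoidAlgebra.liftNCRingHom (f : C →+* D) (powersHom D a)
    fun {x y} => by rw [hsmul, mul_comm]
  have hF : ∀ n c, F (SkewPolynomial.monomial n c) = f c * a ^ n := fun n c =>
    SkewMonoidAlgebra.liftNC_single _ _ _ _
  have hFC : ∀ c, F (SkewPolynomial.C c) = f c := fun c => by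
    rw [← SkewPolynomial.monomial_zero_left, hF, pow_zero, mul_one]
  have hsurj : ∀ p : C[X], ∃ q, F q = p.eval₂ (f : C →+* D) a := fun p => by
    induction p using Polynomial.induction_on' with
    | add p q hp hq =>
      obtain ⟨p', hp⟩ := hp
      obtain ⟨q', hq⟩ := hq
      exact ⟨p' + q', by rw [map_add, hp, hq, eval₂_add]⟩
    | monomial n c => exact ⟨SkewPolynomial.monomial n c, by rw [hF, eval₂_monomial]; rfl⟩
  have hpoly : ∀ q, ∃ p : C[X], F q = p.eval₂ (f : C →+* D) a ∧ ∀ n, p.coeff n = q.coeff n := by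
    intro q
    refine ⟨q.sum fun n c => monomial n c, ?_, fun m => ?_⟩
    · conv_lhs => rw [← SkewPolynomial.sum_monomial q]
      rw [SkewPolynomial.sum_def, SkewPolynomial.sum_def, map_sum, eval₂_finsetSum]
      refine Finset.sum_congr rfl fun n _ => ?_
      rw [hF, eval₂_monomial]
      rfl
    · rw [SkewPolynomial.sum_def, finsetSum_coeff]
      simp_rw [coeff_monomial]
      rw [Finset.sum_ite_eq']
      split_ifs with h
      · rfl
      · exact (SkewPolynomial.notMem_support_iff.1 h).symm
  refine ⟨F, hFC, (injective_iff_map_eq_zero F).2 fun q hq => ?_, fun d => ?_⟩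
  · obtain ⟨p, hp, hpq⟩ := hpoly q
    ext n
    rw [← hpq, ha p (hp.symm.trans hq)]
    rfl
  · obtain ⟨r, s, rfl⟩ := hd d
    by_cases hs : s.eval₂ (f : C →+* D) a = 0
    · refine ⟨0, 1, fun h => one_ne_zero ((map_one F).symm.trans ((congrArg F h).trans (map_zero F))), ?_⟩
      rw [hs, div_zero, map_zero, mul_zero]
    · obtain ⟨r', hr⟩ := hsurj r
      obtain ⟨s', hs'⟩ := hsurj s
      refine ⟨r', s', fun h => hs ?_, ?_⟩
      · rw [← hs', h, map_zero]
      · rw [hr, hs', div_eq_inv_mul]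

section FieldExtension

variable {k : Type v} [Field k]

/-- The value of htr C certifies that the projective dimension bound is sharp, since htr never
exceeds the projective dimension. -/
theorem projDimLT_env_and_htr_eq_of_transcendental {C D : Type u} [Field C] [Algebra k C] [Field D]
    [Algebra k D] (f : C →ₐ[k] D) (a : D)
    (ha : ∀ p : Polynomial C, p.eval₂ (f : C →+* D) a = 0 → p = 0)
    (hd : ∀ d, ∃ r s : Polynomial C, d = r.eval₂ (f : C →+* D) a / s.eval₂ (f : C →+* D) a)
    [IsNoetherianRing (EnvAlg k C)] {d : ℕ} (h : ProjDimLT (EnvAlg k C) C (d + 1))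
    (h' : htr k C = (d : ℕ∞)) :
    ProjDimLT (EnvAlg k D) D (d + 2) ∧ htr k D = ((d + 1 : ℕ) : ℕ∞) := by
  refine projDimLT_env_and_htr_eq_of_skewPolynomial AlgEquiv.refl f
    (exists_isQuotientDivisionRing_of_transcendental f a ha hd) h fun h0 => ?_
  cases d with
  | zero => exact not_projDimLT_env_zero h0
  | succ d =>
    have h1 := h'.symm.trans_le (htr_le_of_projDimLT h0)
    have h2 : ((d + 1 : ℕ) : ℕ∞) ≤ (d : ℕ∞) := WithBot.coe_le_coe.1 h1
    have h3 := Nat.cast_le.1 h2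
    lia

/-- E ⊗ E is essentially of finite type over the field E. -/
theorem isNoetherianRing_env {E : Type u} [Field E] [Algebra k E] [Algebra.EssFiniteType k E] :
    IsNoetherianRing (EnvAlg k E) := by
  have := Algebra.EssFiniteType.isNoetherianRing E (E ⊗[k] E)
  let e : E ≃ₐ[k] Eᵐᵒᵖ := AlgEquiv.toOpposite k E
  exact isNoetherianRing_of_ringEquiv (E ⊗[k] E)
    (Algebra.TensorProduct.congr (AlgEquiv.refl (R := k)) e).toRingEquiv

/-- When E is the ground field, every tensor is x ⊗ 1, so the bimodule E is a summand of E^e. -/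
theorem projDimLT_env_and_htr_eq_of_surjective {E : Type u} [Field E] [Algebra k E]
    (hE : Function.Surjective (algebraMap k E)) :
    ProjDimLT (EnvAlg k E) E 1 ∧ htr k E = (0 : ℕ) := by
  have hproj : Module.Projective (EnvAlg k E) E := by
    have h1 : ∀ s : EnvAlg k E, s = (s • (1 : E)) ⊗ₜ[k] 1 := fun s => by
      induction s using TensorProduct.induction_on with
      | zero => exact ((congrArg (· ⊗ₜ[k] 1) (zero_smul (EnvAlg k E) (1 : E))).trans (zero_tmul _ _)).symm
      | add x y hx hy => rw [add_smul, add_tmul, ← hx, ← hy]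
      | tmul x y =>
        obtain ⟨y, rfl⟩ := MulOpposite.op_surjective y
        obtain ⟨c, rfl⟩ := hE y
        rw [env_smul, mul_one, MulOpposite.unop_op, mul_comm, ← Algebra.smul_def, smul_tmul]
        congr 1
        rw [← mul_one (MulOpposite.op _), Algebra.smul_def]
        rfl
    exact Module.Projective.of_split
      ({ toFun := fun x => x ⊗ₜ[k] 1
         map_add' := fun x y => add_tmul _ _ _
         map_smul' := fun s x => by
          have h2 := h1 (s * x ⊗ₜ[k] 1)
          rw [mul_smul, env_smul] at h2
          rw [RingHom.id_apply, smul_eq_mul, h2]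
          simp } : E →ₗ[EnvAlg k E] EnvAlg k E)
      (LinearMap.toSpanSingleton (EnvAlg k E) E 1)
      (LinearMap.ext fun x => by
        change (x ⊗ₜ[k] 1 : EnvAlg k E) • (1 : E) = x
        rw [env_smul]
        simp)
  have h := projDimLT_one_iff.2 hproj
  refine ⟨h, le_antisymm (htr_le_of_projDimLT h) ?_⟩
  have := htr_ne_bot (k := k) E
  generalize htr k E = x at *
  induction x with
  | bot => exact absurd rfl this
  | coe x => exact WithBot.coe_le_coe.2 bot_le

-- Each independent element adds a simple transcendental extension. Noetherianity at every stage
-- comes from finite generation.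
open IntermediateField algebraAdjoinAdjoin in
theorem projDimLT_env_and_htr_adjoin {K : Type u} [Field K] [Algebra k K] (s : Finset K)
    (hs : AlgebraicIndepOn k id (s : Set K)) :
    ProjDimLT (EnvAlg k (adjoin k (s : Set K))) (adjoin k (s : Set K)) (s.card + 1) ∧
      htr k (adjoin k (s : Set K)) = (s.card : ℕ∞) := by
  classical
  induction s using Finset.induction_on with
  | empty =>
    refine projDimLT_env_and_htr_eq_of_surjective fun x => ?_
    obtain ⟨x, hx⟩ := x
    have hx' := hx
    rw [Finset.coe_empty, adjoin_empty, mem_bot] at hx'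
    obtain ⟨c, rfl⟩ := hx'
    exact ⟨c, rfl⟩
  | insert a s ha ih =>
    rw [Finset.coe_insert, AlgebraicIndepOn.insert_iff (by simpa using ha), Set.image_id] at hs
    obtain ⟨h1, h2⟩ := ih hs.1
    have htr : Transcendental (adjoin k (s : Set K)) a := by
      have := hs.2
      rwa [Transcendental, IsFractionRing.isAlgebraic_iff _ (adjoin k (s : Set K)) K] at this
    have hle : adjoin k (s : Set K) ≤ adjoin k (↑(insert a s) : Set K) :=
      adjoin.mono _ _ _ (by simp)
    have : Algebra.EssFiniteType k (adjoin k (s : Set K)) :=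
      essFiniteType_iff.2 (fg_adjoin_finset s)
    have := isNoetherianRing_env (k := k) (E := adjoin k (s : Set K))
    have hmem : a ∈ adjoin k (↑(insert a s) : Set K) := subset_adjoin _ _ (by simp)
    have haeval : ∀ p : Polynomial (adjoin k (s : Set K)),
        ((p.eval₂ (inclusion hle : _ →+* adjoin k (↑(insert a s) : Set K)) ⟨a, hmem⟩ :
          adjoin k (↑(insert a s) : Set K)) : K) = Polynomial.aeval a p := fun p =>
      Polynomial.hom_eval₂ p _ (algebraMap (adjoin k (↑(insert a s) : Set K)) K) _
    rw [Finset.card_insert_of_notMem ha]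
    refine projDimLT_env_and_htr_eq_of_transcendental (inclusion hle) ⟨a, hmem⟩ (fun p hp => ?_)
      (fun ⟨d, hd⟩ => ?_) h1 h2
    · refine (transcendental_iff.1 htr) p ?_
      rw [← haeval, hp]
      rfl
    · have hd' := hd
      rw [Finset.coe_insert, ← Set.union_singleton, ← adjoin_adjoin_left, mem_restrictScalars,
        mem_adjoin_simple_iff] at hd'
      obtain ⟨r, t, hrt⟩ := hd'
      refine ⟨r, t, Subtype.ext ?_⟩
      rw [IntermediateField.coe_div, haeval, haeval, ← hrt]

/-- The homological transcendence degree of a finitely generated field extension is its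
transcendence degree. -/
theorem htr_eq_trdeg (K : Type u) [Field K] [Algebra k K] [Algebra.EssFiniteType k K] :
    htr k K = ((Cardinal.toENat (Algebra.trdeg k K) : ℕ∞) : WithBot ℕ∞) := by
  obtain ⟨s, hs⟩ := exists_finset_isTranscendenceBasis k K
  have h1 := (projDimLT_env_and_htr_adjoin s hs.1).2
  rw [← hs.cardinalMk_eq_trdeg]
  -- Algebraic and finitely generated over k(s) means finite, so part (b) reduces K to k(s).
  have halg : Algebra.IsAlgebraic (IntermediateField.adjoin k (s : Set K)) K := by
    have := hs.isAlgebraic_field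
    rwa [Subtype.range_coe_subtype] at this
  have hfin : Module.Finite (IntermediateField.adjoin k (s : Set K)) K := by
    have := Algebra.EssFiniteType.of_comp k (IntermediateField.adjoin k (s : Set K)) K
    exact Algebra.finite_of_essFiniteType_of_isAlgebraic
  rw [← (IntermediateField.adjoin k (s : Set K)).toSubalgebra.htr_eq_of_finite
    (fun x hx => IntermediateField.inv_mem _ hx) (.inl hfin)]
  refine h1.trans ?_
  simp

end FieldExtension

/-- D is finite over its center, so (b) reduces the claim to a finitely generated field. -/
theorem IsPIAlgebra.htr_eq_classicalTr {k : Type v} {D : Type u} [Field k] [DivisionRing D]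
    [Algebra k D] (h : IsPIAlgebra k D)
    (hfg : (⊤ : IntermediateField k (Subalgebra.center k D)).FG) :
    htr k D = ((Cardinal.toENat (classicalTr k D) : ℕ∞) : WithBot ℕ∞) := by
  have := IntermediateField.fg_top_iff.1 hfg
  rw [← (Subalgebra.center k D).htr_eq_of_finite (fun x hx => Set.inv_mem_center hx)
    (.inl h.finite_center)]
  exact htr_eq_trdeg _

theorem proposition0p4 (k : Type v) (D : Type u) [Field k] [DivisionRing D] [Algebra k D]
    (C : Subalgebra k D) (hC : ∀ x ∈ C, x⁻¹ ∈ C) :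
    -- (a)
    htr k C ≤ htr k D ∧
    -- (b) finite as a left module, respectively as a right module
    (Module.Finite C D ∨ Module.Finite C.op Dᵐᵒᵖ → htr k C = htr k D) ∧
    -- (c)
    (IsNoetherianRing (EnvAlg k C) → globalDim (EnvAlg k C) < ⊤ →
      ∀ α : C ≃ₐ[k] C, IsQuotientOfSkewPolynomial C α → htr k D = htr k C + 1) ∧
    -- (d)
    (IsPIAlgebra k D → (⊤ : IntermediateField k (Subalgebra.center k D)).FG →
      htr k D = ((Cardinal.toENat (classicalTr k D) : ℕ∞) : WithBot ℕ∞)) ∧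
    -- (e)
    htr k D = htr k Dᵐᵒᵖ := by
  refine ⟨C.htr_le hC, C.htr_eq_of_finite hC, C.htr_eq_of_isQuotientOfSkewPolynomial hC,
    fun h hfg => h.htr_eq_classicalTr hfg, htr_op D⟩
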